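/- **Setting.** Let $N\ge 1$, and fix a real $\epsilon$ with $0<\epsilon<1/2$. Let $\mathcal X=\{(N,k): k \text{ odd}\}\sqcup\{(i,k): 1\le i<N,\ k \text{ even}\}\subset\{1,\dots,N\}\times\mathbb Z$. Monomials are elements of the free abelian multiplicative group on variables $Y_{i,k}$ ($1\le i\le N$, $k\in\mathbb Z$), with $Y_{0,k}:=1$. The alphabet is $1<2<\dots<N<0<\overline N<\dots<\overline 2<\overline 1$. **Diagrams and tableaux.** A skew diagram is a finite set $\lambda/\mu\subset\mathbb Z\times\mathbb Z_{>0}$ of boxes (row, column) such that, if it is non-empty, column $1$ is non-empty, and such that whenever $(i,j)\notin\lambda/\mu$, either no $(i',j')$ with $i'\ge i,\ j'\ge j$ lies in $\lambda/\mu$, or no $(i',j')$ with $i'\le i,\ j'\le j$ does. It is generic super if $\#\{i:(i,j),(i,j+1)\in\lambda/\mu\}<2N$ for all $j\ge1$. For a non-empty column $j$, let $t_j$, $b_j$ be the rows of its top (minimal) and bottom (maximal) boxes and $l_j=b_j-t_j+1$. $\mathrm{Tab}(\lambda/\mu)$ is the set of fillings $\mathcal T$ of $\lambda/\mu$ by letters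 such that $\mathcal T(i,j)\le\mathcal T(i,j+1)$ with $(\mathcal T(i,j),\mathcal T(i,j+1))\ne(0,0)$, and $\mathcal T(i,j)<\mathcal T(i+1,j)$ or $(\mathcal T(i,j),\mathcal T(i+1,j))=(0,0)$. Put $M(\mathcal T)=\prod_{(i,j)\in\lambda/\mu}\mathfrak m(\mathcal T(i,j),4(j-i))$, where $\mathfrak m(i,k)=Y_{i-1,2i+k}^{-1}Y_{i,2i-2+k}$ and $\mathfrak m(\overline i,k)=Y_{i,4N-2i+k}^{-1}Y_{i-1,4N-2-2i+k}$ for $1\le i\le N-1$, $\mathfrak m(N,k)=Y_{N-1,2N+k}^{-1}Y_{N,2N-3+k}Y_{N,2N-1+k}$, $\mathfrak m(0,k)=Y_{N,2N+1+k}^{-1}Y_{N,2N-3+k}$, and $\mathfrak m(\overline N,k)=Y_{N,2N-1+k}^{-1}Y_{N,2N+1+k}^{-1}Y_{N-1,2N-2+k}$. **The snake.** The dominant tableau $\mathcal T_+$ fills the columns from left to right, each from the top box downwards: first the letters $1,2,\dots,r\le N$ with $r$ as large as possible; then as many $0$'s as the horizontal rule with the preceding column allows; then $\overline N,\overline{N-1},\dots$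 in the remaining boxes. Write $M(\mathcal T_+)=\prod_{t=1}^TY_{i_t,k_t}$ with the pairs sorted by $k_t$, and by $i_t$ when the $k_t$ are equal; $(i_t,k_t)_{1\le t\le T}$ is the associated snake. A non-empty column $j$ is special if $l_j\ge N$ and $(t_j+N,j+1)\notin\lambda/\mu$. For a non-empty column $j$ let $\varsigma_j=\#\{\text{non-empty columns }j'\le j\}+\#\{\text{special columns }j'<j\}$. **Paths.** For $k$ odd, $\mathscr P_{N,k}$ is the set of sequences of points $((x_r,y_r))_{0\le r\le N}$ with $(x_0,\dots,x_N)=(0,2,\dots,2N-2,2N-1)$ if $k\equiv3$ and $(4N-2,4N-4,\dots,2N,2N-1)$ if $k\equiv1\pmod 4$, with $y_0=k+2N-1$, $y_{r+1}-y_r\in\{2,-2\}$ for $0\le r\le N-2$, and $y_N-y_{N-1}\in\{1+\epsilon,-1-\epsilon\}$. For $(i,k)\in\mathcal X$ with $i<N$, $\mathscr P_{i,k}$ is the set of sequences $(a_0,\dots,a_N,\overline a_N,\dots,\overline a_0)$ with $a\in\mathscr P_{N,k-(2N-2i-1)}$, $\overline a\in\mathscr P_{N,k+(2N-2i-1)}$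 and $a_N-\overline a_N=(0,y)$, $y>0$. Let $\iota:\mathcal X\to\mathbb Z^2$ be given by $\iota(N,k)=(2N-1,k)$ and, for $i<N$, $\iota(i,k)=(2i,k)$ if $2N+k-2i\equiv2\pmod 4$ and $\iota(i,k)=(4N-2-2i,k)$ if $2N+k-2i\equiv0\pmod 4$. For a path $p=((j_r,l_r))_r$, the set $C_{p,+}$ (resp. $C_{p,-}$) consists of the $\iota^{-1}(j_r,l_r)$ with $j_r\notin\{0,2N-1,4N-2\}$ and $l_{r\pm1}>l_r$ (resp. $l_{r\pm1}<l_r$), together with the $(N,l)\in\mathcal X$ such that $(2N-1,l-\epsilon)\in p$ and $(2N-1,l+\epsilon)\notin p$ (resp. $(2N-1,l+\epsilon)\in p$ and $(2N-1,l-\epsilon)\notin p$). Put $\mathfrak m(p)=\prod_{(j,l)\in C_{p,+}}Y_{j,l}\prod_{(j,l)\in C_{p,-}}Y_{j,l}^{-1}$. A tuple $(p_1,\dots,p_T)$ with $p_t\in\mathscr P_{i_t,k_t}$ is non-overlapping if for all $s<t$, $(x,y)\in p_s$ and $(x,z)\in p_t$ imply $y<z$; let $\overline{\mathscr P}$ be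 the set of non-overlapping tuples. For $p\in\mathscr P_{N,k}$, put $R_p=\{r: 1\le r\le N,\ y_r-y_{r-1}<0\}$ and $\overline R_p=\{\overline r: 1\le r\le N,\ y_r-y_{r-1}>0\}$. For $p\in\mathscr P_{i,k}$ with $i<N$, $a=((x_r,y_r))_r$, $\overline a=((\overline x_r,\overline y_r))_r$, put $R_p=\{r:\overline y_r-\overline y_{r-1}<0\}$, $\overline R_p=\{\overline r: y_r-y_{r-1}>0\}$, $S_p=\{r:y_r-y_{r-1}<0\}$, $\overline S_p=\{\overline r:\overline y_r-\overline y_{r-1}>0\}$ ($1\le r\le N$ throughout). **The map.** For $(p_1,\dots,p_T)\in\overline{\mathscr P}$, the filling $\mathcal T_{(p_t)}$ of $\lambda/\mu$ is defined in each non-empty column $j$ as follows. Let $(B,\overline B)=(S_{p_{\varsigma_j}},\overline S_{p_{\varsigma_j}})$ if $l_j<N$, and $(B,\overline B)=(R_{p_{\varsigma_j+1}},\overline R_{p_{\varsigma_j}})$ if $l_j\ge N$. Enter the letters of $B$ in alphabetical order from the top box downwards, the letters of $\overline B$ in reverse alphabetical order from the bottom box upwards, and $0$ into all remaining boxes. **Proposition.**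 Let $\lambda/\mu$ be a generic super skew diagram. For every $(p_1,\dots,p_T)\in\overline{\mathscr P}$ no box is filled twice in this procedure (that is, $\#B+\#\overline B\le l_j$ in each non-empty column $j$), the map $(p_1,\dots,p_T)\mapsto\mathcal T_{(p_t)}$ is a bijection from $\overline{\mathscr P}$ onto $\mathrm{Tab}(\lambda/\mu)$, and $$\prod_{t=1}^T\mathfrak m(p_t)=M(\mathcal T_{(p_t)}).$$ -/

import Mathlib

noncomputable section

/-- The set of indices `𝒳` in type `B_N`: pairs `(N, k)` with `k` odd and pairs `(i, k)` with
`1 ≤ i < N` and `k` even. -/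
def indexX (N : ℕ) : Set (ℕ × ℤ) :=
  {c | (c.1 = N ∧ Odd c.2) ∨ (1 ≤ c.1 ∧ c.1 < N ∧ Even c.2)}

/-! ### Monomials -/

/-- The free abelian multiplicative group on symbols `Y_{i,k}`; the exponent of `Y_{i,k}` is the
value at `(i, k)`. -/
abbrev Monomials : Type := Multiplicative (ℕ × ℤ →₀ ℤ)

/-- The variable `Y_{i,k}` for `1 ≤ i ≤ N`, with the convention `Y_{0,k} = Y_{N+1,k} = 1`. -/
def varY (N i : ℕ) (k : ℤ) : Monomials :=
  if 1 ≤ i ∧ i ≤ N then Multiplicative.ofAdd (Finsupp.single (i, k) 1) else 1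

/-- For a dominant monomial `m = ∏ Y_{i_t,k_t}`, the list of the `(i_t, k_t)` (with multiplicity),
sorted by `k` and, for equal `k`, by `i`. -/
def indexSequence (m : Monomials) : List (ℕ × ℤ) :=
  let exps : ℕ × ℤ →₀ ℕ := (Multiplicative.toAdd m).mapRange Int.toNat rfl
  (((Finsupp.toMultiset exps).map fun c => toLex (c.2, c.1)).sort (· ≤ ·)).map
    fun c => ((ofLex c).2, (ofLex c).1)

/-! ### The alphabet -/

/-- The alphabet `1 < 2 < ⋯ < N < 0 < N̄ < ⋯ < 2̄ < 1̄`, listed in increasing order by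
`Fin (2 * N + 1)`. -/
abbrev Letter (N : ℕ) : Type := Fin (2 * N + 1)

/-- The letter `r`, for `1 ≤ r ≤ N`. -/
def letter (N r : ℕ) : Letter N := Fin.ofNat (2 * N + 1) (r - 1)

/-- The letter `0`. -/
def letterZero (N : ℕ) : Letter N := Fin.ofNat (2 * N + 1) N

/-- The letter `r̄`, for `1 ≤ r ≤ N`. -/
def letterBar (N r : ℕ) : Letter N := Fin.ofNat (2 * N + 1) (2 * N + 1 - r)

/-! ### Skew diagrams and tableaux -/

/-- `D` is a skew diagram: a finite set of boxes `(row, column)` in `ℤ × ℤ_{>0}`; if it is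
non-empty then its first column is non-empty, and no box outside `D` lies (weakly) between
two boxes of `D`. -/
def IsSkewDiagram (D : Finset (ℤ × ℕ)) : Prop :=
  (∀ x ∈ D, 0 < x.2) ∧
  (D.Nonempty → ∃ i : ℤ, (i, 1) ∈ D) ∧
  ∀ (i : ℤ) (j : ℕ), 0 < j → (i, j) ∉ D →
    (∀ (i' : ℤ) (j' : ℕ), i ≤ i' → j ≤ j' → (i', j') ∉ D) ∨
    (∀ (i' : ℤ) (j' : ℕ), i' ≤ i → 0 < j' → j' ≤ j → (i', j') ∉ D)

/-- The set of rows of the boxes in column `j`. -/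
def column (D : Finset (ℤ × ℕ)) (j : ℕ) : Finset ℤ :=
  (D.filter fun x => x.2 = j).image Prod.fst

/-- The row `t_j` of the top box of a non-empty column `j`. -/
def topRow (D : Finset (ℤ × ℕ)) (j : ℕ) : ℤ :=
  if h : (column D j).Nonempty then (column D j).min' h else 0

/-- The row `b_j` of the bottom box of a non-empty column `j`. -/
def bottomRow (D : Finset (ℤ × ℕ)) (j : ℕ) : ℤ :=
  if h : (column D j).Nonempty then (column D j).max' h else 0

/-- The length `l_j` of column `j`. -/
def colLength (D : Finset (ℤ × ℕ)) (j : ℕ) : ℕ := (column D j).card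

/-- `D` is a generic super skew diagram: a skew diagram in which any two consecutive columns have
fewer than `2 N` rows in common. -/
def IsGenericSuperSkewDiagram (N : ℕ) (D : Finset (ℤ × ℕ)) : Prop :=
  IsSkewDiagram D ∧ ∀ j : ℕ, 0 < j → (column D j ∩ column D (j + 1)).card < 2 * N

/-- The set of skew tableaux of shape `D`: fillings satisfying the horizontal and the vertical
rule. -/
def tableaux (N : ℕ) (D : Finset (ℤ × ℕ)) : Set ({x // x ∈ D} → Letter N) :=
  {T | (∀ (i : ℤ) (j : ℕ) (h : (i, j) ∈ D) (h' : (i, j + 1) ∈ D),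
          T ⟨(i, j), h⟩ ≤ T ⟨(i, j + 1), h'⟩ ∧
          ¬(T ⟨(i, j), h⟩ = letterZero N ∧ T ⟨(i, j + 1), h'⟩ = letterZero N)) ∧
       (∀ (i : ℤ) (j : ℕ) (h : (i, j) ∈ D) (h' : (i + 1, j) ∈ D),
          T ⟨(i, j), h⟩ < T ⟨(i + 1, j), h'⟩ ∨
          (T ⟨(i, j), h⟩ = letterZero N ∧ T ⟨(i + 1, j), h'⟩ = letterZero N))}

/-- The contribution `𝔪(a, k)` of a box with letter `a`. The five cases are `a = i` with `i < N`,
`a = N`, `a = 0`, `a = N̄`, and `a = ī` with `i < N`. -/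
def boxMonomial (N : ℕ) (a : Letter N) (k : ℤ) : Monomials :=
  if a.val + 1 < N then
    let i : ℕ := a.val + 1
    (varY N (i - 1) (2 * i + k))⁻¹ * varY N i (2 * i - 2 + k)
  else if a.val + 1 = N then
    (varY N (N - 1) (2 * N + k))⁻¹ * varY N N (2 * N - 3 + k) * varY N N (2 * N - 1 + k)
  else if a.val = N then
    (varY N N (2 * N + 1 + k))⁻¹ * varY N N (2 * N - 3 + k)
  else if a.val = N + 1 then
    (varY N N (2 * N - 1 + k))⁻¹ * (varY N N (2 * N + 1 + k))⁻¹ * varY N (N - 1) (2 * N - 2 + k)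
  else
    let i : ℕ := 2 * N + 1 - a.val
    (varY N i (4 * N - 2 * i + k))⁻¹ * varY N (i - 1) (4 * N - 2 - 2 * i + k)

/-- The monomial `M(T) = ∏_{(i,j)} 𝔪(T(i,j), 4(j - i))` of a filling of `D`. -/
def tableauMonomial (N : ℕ) (D : Finset (ℤ × ℕ)) (T : {x // x ∈ D} → Letter N) : Monomials :=
  ∏ x : {x // x ∈ D}, boxMonomial N (T x) (4 * ((x.1.2 : ℤ) - x.1.1))

/-! ### The dominant tableau and the associated snake -/

/-- The box in row `i` of column `j + 1`, below the letters `1, …, N`, can be reached by a run of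
zeros respecting the horizontal rule with respect to the filling `prev` of column `j`. -/
def ZeroFits (N : ℕ) (D : Finset (ℤ × ℕ)) (j : ℕ) (prev : ℤ → Letter N) (i : ℤ) : Prop :=
  ∀ i' ∈ Finset.Icc (topRow D (j + 1) + N) i, (i', j) ∈ D →
    prev i' ≤ letterZero N ∧ prev i' ≠ letterZero N

open scoped Classical in
/-- The entry in row `i` of column `j` of the dominant tableau, defined column by column:
from the top box downwards, first the letters `1, 2, …` up to at most `N`, then as many zeros as
the horizontal rule with respect to the preceding column permits, then `N̄`, and so on in
alphabetical order. The value matters only for the boxes of `D`. -/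
def dominantEntry (N : ℕ) (D : Finset (ℤ × ℕ)) : ℕ → ℤ → Letter N
  | 0, _ => letterZero N
  | j + 1, i =>
    if i < topRow D (j + 1) + N then letter N (i - topRow D (j + 1) + 1).toNat
    else if ZeroFits N D j (dominantEntry N D j) i then letterZero N
    else letterBar N (N - ((Finset.Ico (topRow D (j + 1) + N) i).filter
      fun i' => ¬ ZeroFits N D j (dominantEntry N D j) i').card)

/-- The dominant tableau `T₊`. -/
def dominantTableau (N : ℕ) (D : Finset (ℤ × ℕ)) : {x // x ∈ D} → Letter N :=
  fun x => dominantEntry N D x.1.2 x.1.1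

/-- The snake `(i_t, k_t)_{1 ≤ t ≤ T}` associated with `D`: the index sequence of the monomial
`m₊ = M(T₊)`. -/
def snake (N : ℕ) (D : Finset (ℤ × ℕ)) : List (ℕ × ℤ) :=
  indexSequence (tableauMonomial N D (dominantTableau N D))

/-- The non-empty columns. -/
def nonemptyColumns (D : Finset (ℤ × ℕ)) : Finset ℕ := D.image Prod.snd

/-- The special columns: those with `l_j ≥ N` such that `(s_j + 1, j + 1) ∉ D`, where
`s_j = t_j + N - 1`. -/
def specialColumns (N : ℕ) (D : Finset (ℤ × ℕ)) : Finset ℕ :=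
  (nonemptyColumns D).filter fun j => N ≤ colLength D j ∧ (topRow D j + N - 1 + 1, j + 1) ∉ D

/-- The position `ς_j` (counted from `1`) in the snake of the node contributed by the non-empty
column `j`: the number of non-empty columns up to `j` plus the number of special columns
before `j`. -/
def columnPosition (N : ℕ) (D : Finset (ℤ × ℕ)) (j : ℕ) : ℕ :=
  ((nonemptyColumns D).filter fun j' => j' ≤ j).card +
    ((specialColumns N D).filter fun j' => j' < j).card

/-! ### Paths -/

/-- A path is a finite sequence of points of the plane. -/
abbrev Path2 : Type := List (ℝ × ℝ)

/-- The horizontal coordinates of the points of the paths in `𝒫_{N,k}`: `0, 2, …, 2N-2, 2N-1` if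
`k ≡ 3 mod 4` and `4N-2, 4N-4, …, 2N, 2N-1` if `k ≡ 1 mod 4`. -/
def spinAbscissa (N : ℕ) (k : ℤ) (r : ℕ) : ℝ :=
  if r = N then 2 * N - 1 else if k % 4 = 3 then 2 * r else 4 * N - 2 - 2 * r

/-- The set of paths `𝒫_{N,k}`, for `k` odd. -/
def spinPaths (N : ℕ) (ε : ℝ) (k : ℤ) : Set Path2 :=
  {p | ∃ y : ℕ → ℝ, y 0 = k + 2 * N - 1 ∧
    (∀ r : ℕ, r + 2 ≤ N → y (r + 1) - y r = 2 ∨ y (r + 1) - y r = -2) ∧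
    (y N - y (N - 1) = 1 + ε ∨ y N - y (N - 1) = -1 - ε) ∧
    p = (List.range (N + 1)).map fun r => (spinAbscissa N k r, y r)}

/-- The set of paths `𝒫_{i,k}`, for `(i, k) ∈ 𝒳`. For `i < N` its elements are the concatenations
`(a_0, …, a_N, ā_N, …, ā_0)` with `a ∈ 𝒫_{N,k-(2N-2i-1)}`, `ā ∈ 𝒫_{N,k+(2N-2i-1)}` and
`a_N - ā_N = (0, y)`, `y > 0`. -/
def paths (N : ℕ) (ε : ℝ) (i : ℕ) (k : ℤ) : Set Path2 :=
  if i = N then spinPaths N ε k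
  else {p | ∃ a ∈ spinPaths N ε (k - (2 * N - 2 * i - 1)),
    ∃ b ∈ spinPaths N ε (k + (2 * N - 2 * i - 1)),
      (∃ y : ℝ, 0 < y ∧ a.getD N 0 - b.getD N 0 = (0, y)) ∧ p = a ++ b.reverse}

/-- The injective map `ι : 𝒳 → ℤ × ℤ`, with values regarded as points of the plane. -/
def iota (N : ℕ) (c : ℕ × ℤ) : ℝ × ℝ :=
  if c.1 < N then
    if (2 * (N : ℤ) + c.2 - 2 * c.1) % 4 = 2 then (2 * (c.1 : ℝ), (c.2 : ℝ))
    else (4 * (N : ℝ) - 2 - 2 * c.1, (c.2 : ℝ))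
  else (2 * (N : ℝ) - 1, (c.2 : ℝ))

/-- The set of upper corners `C_{p,+}` of a path. -/
def upperCorners (N : ℕ) (ε : ℝ) (p : Path2) : Set (ℕ × ℤ) :=
  {c | c ∈ indexX N ∧ ∃ r : ℕ, 1 ≤ r ∧ r + 1 < p.length ∧ p.getD r 0 = iota N c ∧
      (p.getD r 0).1 ≠ 0 ∧ (p.getD r 0).1 ≠ 2 * N - 1 ∧ (p.getD r 0).1 ≠ 4 * N - 2 ∧
      (p.getD r 0).2 < (p.getD (r - 1) 0).2 ∧ (p.getD r 0).2 < (p.getD (r + 1) 0).2} ∪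
  {c | c ∈ indexX N ∧ c.1 = N ∧
      ((2 * (N : ℝ) - 1, (c.2 : ℝ) - ε) : ℝ × ℝ) ∈ p ∧
      ((2 * (N : ℝ) - 1, (c.2 : ℝ) + ε) : ℝ × ℝ) ∉ p}

/-- The set of lower corners `C_{p,-}` of a path. -/
def lowerCorners (N : ℕ) (ε : ℝ) (p : Path2) : Set (ℕ × ℤ) :=
  {c | c ∈ indexX N ∧ ∃ r : ℕ, 1 ≤ r ∧ r + 1 < p.length ∧ p.getD r 0 = iota N c ∧
      (p.getD r 0).1 ≠ 0 ∧ (p.getD r 0).1 ≠ 2 * N - 1 ∧ (p.getD r 0).1 ≠ 4 * N - 2 ∧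
      (p.getD (r - 1) 0).2 < (p.getD r 0).2 ∧ (p.getD (r + 1) 0).2 < (p.getD r 0).2} ∪
  {c | c ∈ indexX N ∧ c.1 = N ∧
      ((2 * (N : ℝ) - 1, (c.2 : ℝ) + ε) : ℝ × ℝ) ∈ p ∧
      ((2 * (N : ℝ) - 1, (c.2 : ℝ) - ε) : ℝ × ℝ) ∉ p}

/-- The monomial `𝔪(p)` of a path. (The sets of corners of a path are finite, as each corner is
determined by a point of the path.) -/
def pathMonomial (N : ℕ) (ε : ℝ) (p : Path2) : Monomials :=
  (∏ᶠ c ∈ upperCorners N ε p, varY N c.1 c.2) * ∏ᶠ c ∈ lowerCorners N ε p, (varY N c.1 c.2)⁻¹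

/-- `p` is strictly above `q` (the vertical axis points downwards). -/
def StrictlyAbove (p q : Path2) : Prop :=
  ∀ x y z : ℝ, (x, y) ∈ p → (x, z) ∈ q → y < z

/-- The set of non-overlapping tuples of paths `(p_1, …, p_T)` with `p_t ∈ 𝒫_{i_t,k_t}`. -/
def nonOverlapping (N : ℕ) (ε : ℝ) (s : List (ℕ × ℤ)) : Set (Fin s.length → Path2) :=
  {p | (∀ t, p t ∈ paths N ε (s.get t).1 (s.get t).2) ∧
    ∀ t u, t < u → StrictlyAbove (p t) (p u)}

/-- The set of `1 ≤ r ≤ N` with `y_r - y_{r-1} > 0`. -/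
def upSteps (N : ℕ) (a : Path2) : Finset ℕ :=
  (Finset.Icc 1 N).filter fun r => (a.getD r 0).2 - (a.getD (r - 1) 0).2 > 0

/-- The set of `1 ≤ r ≤ N` with `y_r - y_{r-1} < 0`. -/
def downSteps (N : ℕ) (a : Path2) : Finset ℕ :=
  (Finset.Icc 1 N).filter fun r => (a.getD r 0).2 - (a.getD (r - 1) 0).2 < 0

/-- The first half `a` of a path `p ∈ 𝒫_{i,k}` with `i < N`. -/
def halfA (N : ℕ) (p : Path2) : Path2 := p.take (N + 1)

/-- The second half `ā` of a path `p ∈ 𝒫_{i,k}` with `i < N`, listed as `ā_0, …, ā_N`. -/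
def halfB (N : ℕ) (p : Path2) : Path2 := (p.drop (N + 1)).reverse

/-- The set `R_p` of a path `p ∈ 𝒫_{i,k}`. -/
def setR (N i : ℕ) (p : Path2) : Finset (Letter N) :=
  if i = N then (downSteps N p).image (letter N) else (downSteps N (halfB N p)).image (letter N)

/-- The set `R̄_p` of a path `p ∈ 𝒫_{i,k}`. -/
def setRbar (N i : ℕ) (p : Path2) : Finset (Letter N) :=
  if i = N then (upSteps N p).image (letterBar N) else (upSteps N (halfA N p)).image (letterBar N)

/-- The set `S_p` of a path `p ∈ 𝒫_{i,k}` with `i < N`. -/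
def setS (N : ℕ) (p : Path2) : Finset (Letter N) := (downSteps N (halfA N p)).image (letter N)

/-- The set `S̄_p` of a path `p ∈ 𝒫_{i,k}` with `i < N`. -/
def setSbar (N : ℕ) (p : Path2) : Finset (Letter N) := (upSteps N (halfB N p)).image (letterBar N)

/-! ### The map from tuples of paths to tableaux -/

/-- The path `p_t` of a tuple `(p_1, …, p_T)`. -/
def pathAt {T : ℕ} (p : Fin T → Path2) (t : ℕ) : Path2 :=
  if h : t - 1 < T then p ⟨t - 1, h⟩ else []

/-- The first entry `i_t` of the node `(i_t, k_t)` of the sequence `s`, `1 ≤ t ≤ T`. -/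
def nodeAt (s : List (ℕ × ℤ)) (t : ℕ) : ℕ := (s.getD (t - 1) (0, 0)).1

/-- The set of letters entered into column `j` from the top downwards: `S_{ς_j}` if `l_j < N`, and
`R_{ς_j + 1}` if `l_j ≥ N`. -/
def topLetters (N : ℕ) (D : Finset (ℤ × ℕ)) (p : Fin (snake N D).length → Path2) (j : ℕ) :
    Finset (Letter N) :=
  if colLength D j < N then setS N (pathAt p (columnPosition N D j))
  else setR N (nodeAt (snake N D) (columnPosition N D j + 1))
    (pathAt p (columnPosition N D j + 1))

/-- The set of letters entered into column `j` from the bottom upwards: `S̄_{ς_j}` if `l_j < N`, and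
`R̄_{ς_j}` if `l_j ≥ N`. -/
def bottomLetters (N : ℕ) (D : Finset (ℤ × ℕ)) (p : Fin (snake N D).length → Path2) (j : ℕ) :
    Finset (Letter N) :=
  if colLength D j < N then setSbar N (pathAt p (columnPosition N D j))
  else setRbar N (nodeAt (snake N D) (columnPosition N D j)) (pathAt p (columnPosition N D j))

/-- The filling of `D` attached to a tuple of paths: in column `j` the letters of `topLetters` are
entered in alphabetical order from the top box downwards, those of `bottomLetters` in reverse
alphabetical order from the bottom box upwards, and `0` into all remaining boxes. -/
def fillDiagram (N : ℕ) (D : Finset (ℤ × ℕ)) (p : Fin (snake N D).length → Path2) :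
    {x // x ∈ D} → Letter N :=
  fun x =>
    let fromTop : ℕ := (x.1.1 - topRow D x.1.2).toNat
    let fromBottom : ℕ := (bottomRow D x.1.2 - x.1.1).toNat
    if fromTop < (topLetters N D p x.1.2).card then
      ((topLetters N D p x.1.2).sort (· ≤ ·)).getD fromTop (letterZero N)
    else if fromBottom < (bottomLetters N D p x.1.2).card then
      ((bottomLetters N D p x.1.2).sort (· ≥ ·)).getD fromBottom (letterZero N)
    else letterZero N

end

/-!
Every path of `𝒫_{i,k}` with `i < N` is a concatenation of two *spin paths*, that is, elements of
the sets `𝒫_{N,κ}`, and a spin path is the same as its set `E ⊆ {1, …, N}` of descents. The proof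
decomposes both sides of the bijection into such sets.

**The chain of a diagram.** A non-empty column `j` with rows `t_j, …, b_j` contributes two spin
indices (`spinNode`): `κ_{2j} = 4 (j - b_j) + 2N - 3` for its bottom and
`κ_{2j+1} = 4 (j - t_j) - 2N + 3` for its top. They form a chain indexed by a finite set `S` of
natural numbers. The nodes `(i, k)` of the snake with `i < N` arise exactly from the neighbours
`m, m + 1 ∈ S` that are inverted, `κ_{m+1} < κ_m` (`Merged`): for `m = 2j` this says that column `j`
has fewer than `N` boxes, and for `m = 2j + 1` that column `j` is not special. That these nodes are
the snake (`snake_eq`) is seen by computing the monomial of the dominant tableau, as the product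
over the chain of the monomials of the spin paths with the highest weight. The nodes are listed in
the order of their second entries (`IsSpinChain.nodeKey_lt`), so the position of a node in the snake
is the number of nodes before it (`columnPosition_eq`).

**Paths.** Paths starting on different sides meet only on the central line. Consequently, a tuple of
paths is non-overlapping if and only if the spin paths it consists of, in the order of the chain,
are pairwise strictly above each other (`IsSpinChain.nonOverlapping_iff`).

**Tableaux.** A filling of a column with the vertical rule is the same as a pair of sets
`B, B' ⊆ {1, …, N}` with `#B + #B' ≤ l_j`: the unbarred and the barred letters that occur. Take
`E_{2j+1} = B_j` and `E_{2j} = {1, …, N} \ B'_j`. The condition on the end points of the paths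
`2j` and `2j + 1` says that `#B_j + #B'_j ≤ l_j`; the one for `2j + 1` and `2j + 2` says that in
column `j + 1` all boxes below the unbarred letters of column `j` contain barred letters; and the
conditions for two paths on the same side compare, for each `r`, the numbers of letters up to `r` in
two columns, which is the horizontal rule for unbarred or barred letters
(`IsSpinFamily.mem_tableaux`, `exists_isSpinFamily`).

**Monomials.** The monomial of a path is the product of the monomials of its spin paths, since an
end point that is no longer a corner is cancelled by the other one (`pathMonomial_append`). The
product over the boxes of a column is the product of the monomials of its two spin paths
(`prod_column`): the contribution of the zeros telescopes and joins the two ends. Taking the product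
over all columns gives the last claim.
-/

/-! ### Spin paths and their sets of descents -/

/-- The number of elements of `E` that are at most `r`. -/
def cnt (E : Finset ℕ) (r : ℕ) : ℕ := (E.filter (· ≤ r)).card

lemma cnt_zero {N : ℕ} {E : Finset ℕ} (hE : E ⊆ Finset.Icc 1 N) : cnt E 0 = 0 := by
  unfold cnt
  rw [Finset.card_eq_zero, Finset.filter_eq_empty_iff]
  intro x hx h
  have := Finset.mem_Icc.1 (hE hx)
  omega

lemma cnt_succ (E : Finset ℕ) (r : ℕ) : cnt E (r + 1) = cnt E r + if r + 1 ∈ E then 1 else 0 := by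
  unfold cnt
  have h : E.filter (· ≤ r + 1) = E.filter (· ≤ r) ∪ E.filter (· = r + 1) := by
    ext x; simp only [Finset.mem_filter, Finset.mem_union]; grind
  rw [h, Finset.card_union_of_disjoint]
  · congr 1
    rw [Finset.filter_eq']
    split_ifs <;> simp
  · rw [Finset.disjoint_filter]; intro x _ h1 h2; omega

lemma cnt_mono (E : Finset ℕ) {r s : ℕ} (h : r ≤ s) : cnt E r ≤ cnt E s :=
  Finset.card_le_card (Finset.monotone_filter_right _ fun _ _ hx => le_trans hx h)

lemma cnt_lt {E : Finset ℕ} {r s : ℕ} (h : r < s) (hs : s ∈ E) : cnt E r < cnt E s := by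
  obtain ⟨s, rfl⟩ : ∃ k, s = k + 1 := ⟨s - 1, by omega⟩
  have := cnt_mono E (show r ≤ s by omega)
  rw [cnt_succ, if_pos hs]; omega

lemma cnt_pos {E : Finset ℕ} {s : ℕ} (hs : s ∈ E) : 0 < cnt E s :=
  Finset.card_pos.2 ⟨s, Finset.mem_filter.2 ⟨hs, le_rfl⟩⟩

lemma cnt_le_card (E : Finset ℕ) (r : ℕ) : cnt E r ≤ E.card := Finset.card_filter_le _ _

lemma cnt_top {N : ℕ} {E : Finset ℕ} (hE : E ⊆ Finset.Icc 1 N) : cnt E N = E.card := by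
  unfold cnt
  rw [Finset.filter_true_of_mem]
  intro x hx; exact (Finset.mem_Icc.1 (hE hx)).2

lemma cnt_inj {E : Finset ℕ} {r s : ℕ} (hr : r ∈ E) (hs : s ∈ E) (h : cnt E r = cnt E s) :
    r = s := by
  rcases lt_trichotomy r s with h' | h' | h'
  · have := cnt_lt h' hs; omega
  · exact h'
  · have := cnt_lt h' hr; omega

/-- A set of naturals with more than `n` elements has an element of rank `n + 1`. -/
lemma exists_cnt_eq {E : Finset ℕ} {N n : ℕ} (hE : E ⊆ Finset.Icc 1 N) (hn : n < cnt E N) :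
    ∃ s ∈ E, cnt E s = n + 1 := by
  have key : ∀ M, n < cnt E M → ∃ s ∈ E, cnt E s = n + 1 := by
    intro M
    induction M with
    | zero => intro h; rw [cnt_zero hE] at h; omega
    | succ M ih =>
      intro h
      by_cases h' : n < cnt E M
      · exact ih h'
      · have h2 := cnt_succ E M
        by_cases hm : M + 1 ∈ E
        · rw [if_pos hm] at h2
          exact ⟨M + 1, hm, by omega⟩
        · rw [if_neg hm] at h2; omega
  exact key _ hn

lemma cnt_compl {N : ℕ} {E : Finset ℕ} {r : ℕ} (hr : r ≤ N) (hE : E ⊆ Finset.Icc 1 N) :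
    cnt (Finset.Icc 1 N \ E) r + cnt E r = r := by
  induction r with
  | zero => rw [cnt_zero hE, cnt_zero Finset.sdiff_subset]
  | succ r ih =>
    have := ih (by omega)
    rw [cnt_succ, cnt_succ]
    by_cases h : r + 1 ∈ E
    · rw [if_pos h, if_neg (by simp [h])]; omega
    · rw [if_neg h, if_pos (by simp [h]; omega)]; omega

lemma cnt_Icc (i r : ℕ) : cnt (Finset.Icc 1 i) r = min i r := by
  induction r with
  | zero => rw [cnt_zero subset_rfl]; simp
  | succ r ih =>
    rw [cnt_succ, ih]
    by_cases h : r + 1 ≤ i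
    · rw [if_pos (by simp; omega)]; omega
    · rw [if_neg (by simp; omega)]; omega

/-- The vertical coordinate of the `r`-th point, `r < N`, of the path in `𝒫_{N,k}` whose set of
descents is `E`. -/
def spinHt (N : ℕ) (k : ℤ) (E : Finset ℕ) (r : ℕ) : ℤ := k + 2 * N - 1 + 2 * r - 4 * cnt E r

/-- The integer nearest to the vertical coordinate of the last point of the path in `𝒫_{N,k}` whose
set of descents is `E`. -/
def spinEnd (N : ℕ) (k : ℤ) (E : Finset ℕ) : ℤ :=
  k + 4 * N - 4 * E.card - if N ∈ E then 0 else 2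

/-- The vertical coordinate of the last point of the path in `𝒫_{N,k}` whose set of descents
is `E`. -/
def spinCtr (N : ℕ) (ε : ℝ) (k : ℤ) (E : Finset ℕ) : ℝ :=
  (spinEnd N k E : ℝ) + if N ∈ E then -ε else ε

/-- The vertical coordinates of the path in `𝒫_{N,k}` whose set of descents is `E`. -/
def spinY (N : ℕ) (ε : ℝ) (k : ℤ) (E : Finset ℕ) (r : ℕ) : ℝ :=
  if r < N then (spinHt N k E r : ℝ) else spinCtr N ε k E

/-- The path in `𝒫_{N,k}` whose set of descents is `E`. -/
def spinPath (N : ℕ) (ε : ℝ) (k : ℤ) (E : Finset ℕ) : Path2 :=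
  (List.range (N + 1)).map fun r => (spinAbscissa N k r, spinY N ε k E r)

lemma spinHt_succ (N : ℕ) (k : ℤ) (E : Finset ℕ) (r : ℕ) :
    spinHt N k E (r + 1) = spinHt N k E r + if r + 1 ∈ E then -2 else 2 := by
  unfold spinHt
  rw [cnt_succ]
  split_ifs <;> push_cast <;> ring

lemma spinEnd_eq {N : ℕ} (hN : 1 ≤ N) (k : ℤ) {E : Finset ℕ} (hE : E ⊆ Finset.Icc 1 N) :
    spinEnd N k E = spinHt N k E (N - 1) + if N ∈ E then -1 else 1 := by
  obtain ⟨M, rfl⟩ : ∃ M, N = M + 1 := ⟨N - 1, by omega⟩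
  have h := cnt_succ E M
  rw [cnt_top hE] at h
  simp only [spinEnd, spinHt, Nat.add_sub_cancel]
  rw [h]
  split_ifs <;> push_cast <;> ring

lemma spinCtr_sub {N : ℕ} (hN : 1 ≤ N) (ε : ℝ) (k : ℤ) {E : Finset ℕ}
    (hE : E ⊆ Finset.Icc 1 N) :
    spinCtr N ε k E - spinHt N k E (N - 1) = if N ∈ E then -1 - ε else 1 + ε := by
  rw [spinCtr, spinEnd_eq hN k hE]
  split_ifs <;> push_cast <;> ring

lemma spinY_step {N : ℕ} {ε : ℝ} (k : ℤ) {E : Finset ℕ}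
    (hE : E ⊆ Finset.Icc 1 N) {r : ℕ} (hr : r + 1 ≤ N) :
    spinY N ε k E (r + 1) - spinY N ε k E r =
      (if r + 1 ∈ E then -1 else 1) * (if r + 1 = N then 1 + ε else 2) := by
  rcases Nat.lt_or_ge (r + 1) N with h | h
  · have := spinHt_succ N k E r
    rw [spinY, spinY, if_pos h, if_pos (by omega), if_neg (by omega : ¬ r + 1 = N), this]
    split_ifs <;> push_cast <;> ring
  · obtain rfl : N = r + 1 := by omega
    have := spinCtr_sub (by omega) ε k hE
    rw [spinY, spinY, if_neg (by omega), if_pos (by omega)]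
    simp only [Nat.add_sub_cancel] at this
    rw [this, if_pos rfl]
    split_ifs <;> ring

lemma spinY_lt_iff {N : ℕ} {ε : ℝ} (hε : 0 < ε) (k : ℤ) {E : Finset ℕ}
    (hE : E ⊆ Finset.Icc 1 N) {r : ℕ} (hr : r + 1 ≤ N) :
    spinY N ε k E (r + 1) < spinY N ε k E r ↔ r + 1 ∈ E := by
  have := spinY_step (ε := ε) k hE hr
  constructor
  · intro h
    by_contra hh
    rw [if_neg hh] at this
    split_ifs at this <;> linarith
  · intro h
    rw [if_pos h] at this
    split_ifs at this <;> linarith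

lemma lt_spinY_iff {N : ℕ} {ε : ℝ} (hε : 0 < ε) (k : ℤ) {E : Finset ℕ}
    (hE : E ⊆ Finset.Icc 1 N) {r : ℕ} (hr : r + 1 ≤ N) :
    spinY N ε k E r < spinY N ε k E (r + 1) ↔ r + 1 ∉ E := by
  have := spinY_step (ε := ε) k hE hr
  constructor
  · intro h hh
    rw [if_pos hh] at this
    split_ifs at this <;> linarith
  · intro h
    rw [if_neg h] at this
    split_ifs at this <;> linarith

@[simp] lemma length_spinPath (N : ℕ) (ε : ℝ) (k : ℤ) (E : Finset ℕ) :
    (spinPath N ε k E).length = N + 1 := by simp [spinPath]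

lemma getD_spinPath {N r : ℕ} (ε : ℝ) (k : ℤ) (E : Finset ℕ) (hr : r ≤ N) :
    (spinPath N ε k E).getD r 0 = (spinAbscissa N k r, spinY N ε k E r) := by
  rw [List.getD_eq_getElem _ _ (by simp; omega)]
  simp [spinPath]

lemma mem_spinPath {N : ℕ} {ε : ℝ} {k : ℤ} {E : Finset ℕ} {x y : ℝ} :
    (x, y) ∈ spinPath N ε k E ↔ ∃ r ≤ N, x = spinAbscissa N k r ∧ y = spinY N ε k E r := by
  simp only [spinPath, List.mem_map, List.mem_range, Prod.mk.injEq]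
  constructor
  · rintro ⟨r, h, h1, h2⟩; exact ⟨r, by omega, h1.symm, h2.symm⟩
  · rintro ⟨r, h, h1, h2⟩; exact ⟨r, by omega, h1.symm, h2.symm⟩

/-- A path of `𝒫_{N,k}` is determined by its set of descents, which is arbitrary. -/
lemma mem_spinPaths_iff {N : ℕ} (hN : 1 ≤ N) {ε : ℝ} (hε : 0 < ε) {k : ℤ} {p : Path2} :
    p ∈ spinPaths N ε k ↔ ∃ E ⊆ Finset.Icc 1 N, p = spinPath N ε k E := by
  constructor
  · rintro ⟨y, h0, h1, h2, rfl⟩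
    have hE : (Finset.Icc 1 N).filter (fun r => y r < y (r - 1)) ⊆ Finset.Icc 1 N :=
      Finset.filter_subset _ _
    refine ⟨_, hE, ?_⟩
    set E := (Finset.Icc 1 N).filter (fun r => y r < y (r - 1)) with hEdef
    have hmem : ∀ r, r + 1 ≤ N → (r + 1 ∈ E ↔ y (r + 1) < y r) := by
      intro r hr; simp [hEdef]; omega
    have key : ∀ r ≤ N, y r = spinY N ε k E r := by
      intro r
      induction r with
      | zero =>
        intro _
        rw [spinY, if_pos (by omega), spinHt, cnt_zero hE, h0]; push_cast; ring
      | succ r ih =>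
        intro hr
        have e := ih (by omega)
        have s := spinY_step (ε := ε) k hE hr
        have m := hmem r hr
        rcases Nat.lt_or_ge (r + 1) N with h | h
        · rw [if_neg (by omega : ¬ r + 1 = N)] at s
          rcases h1 r (by omega) with h' | h'
          · rw [if_neg (by rw [m]; linarith)] at s; linarith
          · rw [if_pos (by rw [m]; linarith)] at s; linarith
        · obtain rfl : N = r + 1 := by omega
          rw [if_pos rfl] at s
          simp only [Nat.add_sub_cancel] at h2
          rcases h2 with h' | h'
          · rw [if_neg (by rw [m]; linarith)] at s; linarith
          · rw [if_pos (by rw [m]; linarith)] at s; linarith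
    apply List.map_congr_left
    intro r hr
    rw [key r (by simp at hr; omega)]
  · rintro ⟨E, hE, rfl⟩
    refine ⟨spinY N ε k E, ?_, ?_, ?_, rfl⟩
    · rw [spinY, if_pos (by omega), spinHt, cnt_zero hE]; push_cast; ring
    · intro r hr
      have s := spinY_step (ε := ε) k hE (show r + 1 ≤ N by omega)
      rw [s, if_neg (by omega : ¬ r + 1 = N)]
      split_ifs
      · right; norm_num
      · left; norm_num
    · obtain ⟨M, rfl⟩ : ∃ M, N = M + 1 := ⟨N - 1, by omega⟩
      have s := spinY_step (ε := ε) k hE (show M + 1 ≤ M + 1 by omega)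
      simp only [Nat.add_sub_cancel]
      rw [s, if_pos rfl]
      split_ifs
      · right; ring
      · left; ring

lemma downSteps_spinPath {N : ℕ} {ε : ℝ} (hε : 0 < ε) (k : ℤ) {E : Finset ℕ}
    (hE : E ⊆ Finset.Icc 1 N) : downSteps N (spinPath N ε k E) = E := by
  ext r
  simp only [downSteps, Finset.mem_filter, Finset.mem_Icc]
  constructor
  · rintro ⟨⟨h1, h2⟩, h⟩
    rw [getD_spinPath _ _ _ h2, getD_spinPath _ _ _ (by omega)] at h
    obtain ⟨r, rfl⟩ : ∃ s, r = s + 1 := ⟨r - 1, by omega⟩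
    exact (spinY_lt_iff hε k hE h2).1 (by simpa using h)
  · intro h
    have hr := Finset.mem_Icc.1 (hE h)
    refine ⟨hr, ?_⟩
    rw [getD_spinPath _ _ _ hr.2, getD_spinPath _ _ _ (by omega)]
    obtain ⟨r, rfl⟩ : ∃ s, r = s + 1 := ⟨r - 1, by omega⟩
    simpa using (spinY_lt_iff hε k hE hr.2).2 h

lemma upSteps_spinPath {N : ℕ} {ε : ℝ} (hε : 0 < ε) (k : ℤ) {E : Finset ℕ}
    (hE : E ⊆ Finset.Icc 1 N) : upSteps N (spinPath N ε k E) = Finset.Icc 1 N \ E := by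
  ext r
  simp only [upSteps, Finset.mem_filter, Finset.mem_Icc, Finset.mem_sdiff]
  refine and_congr_right fun hr => ?_
  rw [getD_spinPath _ _ _ hr.2, getD_spinPath _ _ _ (by omega)]
  obtain ⟨r, rfl⟩ : ∃ s, r = s + 1 := ⟨r - 1, by omega⟩
  simpa using lt_spinY_iff hε k hE hr.2

/-! ### Comparison of spin paths -/

lemma spinAbscissa_inj {N : ℕ} {k k' : ℤ} {r r' : ℕ}
    (hk : k % 4 = k' % 4) (h : spinAbscissa N k r = spinAbscissa N k' r') : r = r' := by
  unfold spinAbscissa at h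
  rw [hk] at h
  split_ifs at h with h1 h2 h3 h4 h5
  · omega
  · have : (2 * (N : ℤ) - 1) = 2 * r' := by exact_mod_cast h
    omega
  · have : (2 * (N : ℤ) - 1) = 4 * N - 2 - 2 * r' := by exact_mod_cast h
    omega
  · have : (2 * (r : ℤ)) = 2 * N - 1 := by exact_mod_cast h
    omega
  · have : (2 * (r : ℤ)) = 2 * r' := by exact_mod_cast h
    omega
  · have : (4 * (N : ℤ) - 2 - 2 * r) = 2 * N - 1 := by exact_mod_cast h
    omega
  · have : (4 * (N : ℤ) - 2 - 2 * r) = 4 * N - 2 - 2 * r' := by exact_mod_cast h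
    omega

lemma spinAbscissa_ne {N : ℕ} {k k' : ℤ} {r r' : ℕ} (hr : r ≤ N) (hr' : r' ≤ N)
    (ho : k % 2 = 1) (hk : (k' - k) % 4 = 2) (h : spinAbscissa N k r = spinAbscissa N k' r') :
    r = N ∧ r' = N := by
  unfold spinAbscissa at h
  split_ifs at h with h1 h2 h3 h4 h5
  · omega
  · have : (2 * (N : ℤ) - 1) = 2 * r' := by exact_mod_cast h
    omega
  · have : (2 * (N : ℤ) - 1) = 4 * N - 2 - 2 * r' := by exact_mod_cast h
    omega
  · have : (2 * (r : ℤ)) = 2 * N - 1 := by exact_mod_cast h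
    omega
  · omega
  · have : (2 * (r : ℤ)) = 4 * N - 2 - 2 * r' := by exact_mod_cast h
    omega
  · have : (4 * (N : ℤ) - 2 - 2 * r) = 2 * N - 1 := by exact_mod_cast h
    omega
  · have : (4 * (N : ℤ) - 2 - 2 * r) = 2 * r' := by exact_mod_cast h
    omega
  · omega

lemma strictlyAbove_spinPath_same {N : ℕ} {ε : ℝ} {k k' : ℤ} {E E' : Finset ℕ}
    (hk : k % 4 = k' % 4) :
    StrictlyAbove (spinPath N ε k E) (spinPath N ε k' E') ↔
      (∀ r < N, spinHt N k E r < spinHt N k' E' r) ∧ spinCtr N ε k E < spinCtr N ε k' E' := by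
  constructor
  · intro h
    have h' : ∀ r ≤ N, spinY N ε k E r < spinY N ε k' E' r := by
      intro r hr
      refine h (spinAbscissa N k r) _ _ (mem_spinPath.2 ⟨r, hr, rfl, rfl⟩)
        (mem_spinPath.2 ⟨r, hr, ?_, rfl⟩)
      simp [spinAbscissa, hk]
    refine ⟨fun r hr => ?_, ?_⟩
    · have := h' r hr.le
      rw [spinY, spinY, if_pos hr, if_pos hr] at this
      exact_mod_cast this
    · simpa [spinY] using h' N le_rfl
  · rintro ⟨h1, h2⟩ x y z hy hz
    obtain ⟨r, hr, rfl, rfl⟩ := mem_spinPath.1 hy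
    obtain ⟨r', hr', hx, rfl⟩ := mem_spinPath.1 hz
    obtain rfl := spinAbscissa_inj hk hx
    by_cases h : r < N
    · rw [spinY, spinY, if_pos h, if_pos h]
      exact_mod_cast h1 r h
    · rw [spinY, spinY, if_neg h, if_neg h]
      exact h2

/-- Paths starting on different sides meet the same vertical line only at their end points. -/
lemma strictlyAbove_spinPath_opposite {N : ℕ} {ε : ℝ} {k k' : ℤ} {E E' : Finset ℕ}
    (ho : k % 2 = 1) (hk : (k' - k) % 4 = 2) :
    StrictlyAbove (spinPath N ε k E) (spinPath N ε k' E') ↔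
      spinCtr N ε k E < spinCtr N ε k' E' := by
  constructor
  · intro h
    have := h (2 * N - 1) _ _ (mem_spinPath.2 ⟨N, le_rfl, by simp [spinAbscissa], rfl⟩)
        (mem_spinPath.2 ⟨N, le_rfl, by simp [spinAbscissa], rfl⟩)
    simpa [spinY] using this
  · rintro h2 x y z hy hz
    obtain ⟨r, hr, rfl, rfl⟩ := mem_spinPath.1 hy
    obtain ⟨r', hr', hx, rfl⟩ := mem_spinPath.1 hz
    obtain ⟨rfl, rfl⟩ := spinAbscissa_ne hr hr' ho hk hx
    simpa [spinY] using h2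

/-- For paths starting on different sides the order of the end points does not see the last steps
of the paths. -/
lemma spinCtr_lt_iff {N : ℕ} {ε : ℝ} (hε0 : 0 < ε) (hε : ε < 1 / 2) {k k' : ℤ} {E E' : Finset ℕ}
    (hk : (k' - k) % 4 = 2) :
    spinCtr N ε k E < spinCtr N ε k' E' ↔ k - 4 * E.card < k' - 4 * E'.card := by
  have e : ∃ d : ℤ, (k' - 4 * E'.card) - (k - 4 * E.card) = 4 * d + 2 :=
    ⟨((k' - 4 * E'.card) - (k - 4 * E.card)) / 4, by omega⟩
  obtain ⟨d, hd⟩ := e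
  have hd' : ((k' : ℝ) - 4 * E'.card) - (k - 4 * E.card) = 4 * d + 2 := by exact_mod_cast hd
  unfold spinCtr spinEnd
  constructor
  · intro h
    have : 0 ≤ d := by
      by_contra hneg
      have h1 : (d : ℝ) ≤ -1 := by exact_mod_cast (by omega : d ≤ -1)
      split_ifs at h <;> push_cast at h <;> linarith
    omega
  · intro h
    have h1 : (0 : ℝ) ≤ d := by exact_mod_cast (by omega : 0 ≤ d)
    split_ifs <;> push_cast <;> linarith

lemma spinCtr_lt_of_lt {N : ℕ} {ε : ℝ} (hε0 : 0 < ε) (hε : ε < 1 / 2) {k k' : ℤ}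
    {E E' : Finset ℕ} (hk : k % 4 = k' % 4) (h : k - 4 * E.card < k' - 4 * E'.card) :
    spinCtr N ε k E < spinCtr N ε k' E' := by
  have e : (k : ℤ) - 4 * E.card + 4 ≤ k' - 4 * E'.card := by omega
  have e' : (k : ℝ) - 4 * E.card + 4 ≤ k' - 4 * E'.card := by exact_mod_cast e
  unfold spinCtr spinEnd
  split_ifs <;> push_cast <;> linarith

/-! ### Monomials of paths -/

lemma spinHt_even {N : ℕ} {k : ℤ} (hk : k % 2 = 1) (E : Finset ℕ) (r : ℕ) :
    Even (spinHt N k E r) := by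
  rw [Int.even_iff]; unfold spinHt; omega

lemma spinEnd_odd {N : ℕ} {k : ℤ} (hk : k % 2 = 1) (E : Finset ℕ) : Odd (spinEnd N k E) := by
  rw [Int.odd_iff]; unfold spinEnd; split_ifs <;> omega

lemma iota_eq_iff {N : ℕ} {k : ℤ} (hk : k % 2 = 1) (E : Finset ℕ) {r : ℕ} (hr1 : 1 ≤ r)
    (hr : r < N) {c : ℕ × ℤ} (hc : c ∈ indexX N) :
    (spinAbscissa N k r, spinY N ε k E r) = iota N c ↔ c = (r, spinHt N k E r) := by
  obtain ⟨i, l⟩ := c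
  rw [spinY, if_pos hr]
  constructor
  · intro h
    have hi : i < N := by
      by_contra hi
      rw [iota, if_neg hi, Prod.mk.injEq] at h
      have := spinAbscissa_inj (k := k) (k' := k) (r := r) (r' := N) rfl
        (by rw [h.1]; simp [spinAbscissa])
      omega
    have hx := congrArg Prod.fst h
    have hy := congrArg Prod.snd h
    rw [iota, if_pos hi] at hx hy
    simp only [apply_ite Prod.fst] at hx
    have hl : l = spinHt N k E r := by
      split_ifs at hy
      · simp only at hy; exact_mod_cast hy.symm
      · simp only at hy; exact_mod_cast hy.symm
    rw [Prod.mk.injEq]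
    refine ⟨?_, hl⟩
    unfold spinAbscissa at hx
    rw [if_neg (by omega)] at hx
    split_ifs at hx
    · have : (2 * (r : ℤ)) = 2 * i := by exact_mod_cast hx
      omega
    · have : (2 * (r : ℤ)) = 4 * N - 2 - 2 * i := by exact_mod_cast hx
      omega
    · have : (4 * (N : ℤ) - 2 - 2 * r) = 2 * i := by exact_mod_cast hx
      omega
    · have : (4 * (N : ℤ) - 2 - 2 * r) = 4 * N - 2 - 2 * i := by exact_mod_cast hx
      omega
  · intro h
    rw [Prod.mk.injEq] at h
    obtain ⟨rfl, rfl⟩ := h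
    rw [iota, if_pos hr, spinAbscissa, if_neg (by omega)]
    simp only
    have e : (2 * (N : ℤ) + spinHt N k E i - 2 * i) % 4 = 2 ↔ k % 4 = 3 := by
      unfold spinHt; omega
    by_cases h3 : k % 4 = 3
    · rw [if_pos h3, if_pos (e.2 h3)]
    · rw [if_neg h3, if_neg (fun h => h3 (e.1 h))]

lemma mem_indexX_spinHt {N : ℕ} {k : ℤ} (hk : k % 2 = 1) (E : Finset ℕ) {r : ℕ} (hr1 : 1 ≤ r)
    (hr : r < N) : (r, spinHt N k E r) ∈ indexX N :=
  Or.inr ⟨hr1, hr, spinHt_even hk E r⟩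

/-- The upper corners of a spin path away from its end point. -/
def sideUpper (N : ℕ) (k : ℤ) (E : Finset ℕ) : Finset (ℕ × ℤ) :=
  ((Finset.Ico 1 N).filter fun r => r ∈ E ∧ r + 1 ∉ E).image fun r => (r, spinHt N k E r)

/-- The lower corners of a spin path away from its end point. -/
def sideLower (N : ℕ) (k : ℤ) (E : Finset ℕ) : Finset (ℕ × ℤ) :=
  ((Finset.Ico 1 N).filter fun r => r ∉ E ∧ r + 1 ∈ E).image fun r => (r, spinHt N k E r)

/-- The upper corner of a spin path at its end point, if there is one. -/
def endUpper (N : ℕ) (k : ℤ) (E : Finset ℕ) : Finset (ℕ × ℤ) :=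
  if N ∈ E then {(N, spinEnd N k E)} else ∅

/-- The lower corner of a spin path at its end point, if there is one. -/
def endLower (N : ℕ) (k : ℤ) (E : Finset ℕ) : Finset (ℕ × ℤ) :=
  if N ∈ E then ∅ else {(N, spinEnd N k E)}

/-- The contribution to the monomial of a spin path of its corners away from the end point. -/
noncomputable def sideMonomial (N : ℕ) (k : ℤ) (E : Finset ℕ) : Monomials :=
  (∏ c ∈ sideUpper N k E, varY N c.1 c.2) * ∏ c ∈ sideLower N k E, (varY N c.1 c.2)⁻¹

/-- The contribution to the monomial of a spin path of its end point. -/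
noncomputable def endMonomial (N : ℕ) (k : ℤ) (E : Finset ℕ) : Monomials :=
  if N ∈ E then varY N N (spinEnd N k E) else (varY N N (spinEnd N k E))⁻¹

/-- The monomial of the path in `𝒫_{N,k}` whose set of descents is `E`. -/
noncomputable def spinMonomial (N : ℕ) (k : ℤ) (E : Finset ℕ) : Monomials :=
  sideMonomial N k E * endMonomial N k E

lemma center_mem_spinPath {N : ℕ} {ε : ℝ} {k : ℤ} {E : Finset ℕ} {y : ℝ} :
    (2 * (N : ℝ) - 1, y) ∈ spinPath N ε k E ↔ y = spinCtr N ε k E := by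
  rw [mem_spinPath]
  constructor
  · rintro ⟨r, hr, hx, rfl⟩
    have : r = N := spinAbscissa_inj (k := k) (k' := k) rfl (by rw [← hx]; simp [spinAbscissa])
    subst this
    simp [spinY]
  · rintro rfl
    exact ⟨N, le_rfl, by simp [spinAbscissa], by simp [spinY]⟩

lemma sub_eq_spinCtr {N : ℕ} {ε : ℝ} (hε0 : 0 < ε) (hε : ε < 1 / 2) {k : ℤ} {E : Finset ℕ}
    {l : ℤ} : (l : ℝ) - ε = spinCtr N ε k E ↔ N ∈ E ∧ l = spinEnd N k E := by
  unfold spinCtr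
  constructor
  · intro h
    by_cases hm : N ∈ E
    · rw [if_pos hm] at h
      exact ⟨hm, by exact_mod_cast (by linarith : (l : ℝ) = spinEnd N k E)⟩
    · rw [if_neg hm] at h
      have h1 : ((spinEnd N k E : ℤ) : ℝ) < l := by linarith
      have h2 : (l : ℝ) < ((spinEnd N k E + 1 : ℤ) : ℝ) := by push_cast; linarith
      have h1' : spinEnd N k E < l := by exact_mod_cast h1
      have h2' : l < spinEnd N k E + 1 := by exact_mod_cast h2
      omega
  · rintro ⟨h, rfl⟩
    rw [if_pos h]; ring

lemma add_eq_spinCtr {N : ℕ} {ε : ℝ} (hε0 : 0 < ε) (hε : ε < 1 / 2) {k : ℤ} {E : Finset ℕ}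
    {l : ℤ} : (l : ℝ) + ε = spinCtr N ε k E ↔ N ∉ E ∧ l = spinEnd N k E := by
  unfold spinCtr
  constructor
  · intro h
    by_cases hm : N ∈ E
    · rw [if_pos hm] at h
      have h1 : (l : ℝ) < ((spinEnd N k E : ℤ) : ℝ) := by linarith
      have h2 : ((spinEnd N k E : ℤ) : ℝ) < ((l + 1 : ℤ) : ℝ) := by push_cast; linarith
      have h1' : l < spinEnd N k E := by exact_mod_cast h1
      have h2' : spinEnd N k E < l + 1 := by exact_mod_cast h2
      omega
    · rw [if_neg hm] at h
      exact ⟨hm, by exact_mod_cast (by linarith : (l : ℝ) = spinEnd N k E)⟩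
  · rintro ⟨h, rfl⟩
    rw [if_neg h]

lemma spinAbscissa_interior {N : ℕ} {k : ℤ} {r : ℕ} (hr1 : 1 ≤ r) (hr : r < N) :
    spinAbscissa N k r ≠ 0 ∧ spinAbscissa N k r ≠ 2 * N - 1 ∧ spinAbscissa N k r ≠ 4 * N - 2 := by
  have h1 : (1 : ℝ) ≤ r := by exact_mod_cast hr1
  have h2 : (r : ℝ) + 1 ≤ N := by exact_mod_cast hr
  unfold spinAbscissa
  rw [if_neg (by omega)]
  refine ⟨?_, fun h => ?_, ?_⟩
  · split_ifs <;> intro h <;> linarith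
  · split_ifs at h
    · have : (2 * (r : ℤ)) = 2 * N - 1 := by exact_mod_cast h
      omega
    · have : (4 * (N : ℤ) - 2 - 2 * r) = 2 * N - 1 := by exact_mod_cast h
      omega
  · split_ifs <;> intro h <;> linarith

lemma upper_corner_iff {N : ℕ} {ε : ℝ} (hε0 : 0 < ε) {k : ℤ} {E : Finset ℕ}
    (hE : E ⊆ Finset.Icc 1 N) {r : ℕ} (hr1 : 1 ≤ r) (hr : r < N) :
    (spinY N ε k E r < spinY N ε k E (r - 1) ∧ spinY N ε k E r < spinY N ε k E (r + 1)) ↔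
      r ∈ E ∧ r + 1 ∉ E := by
  rw [lt_spinY_iff hε0 k hE (by omega)]
  obtain ⟨r, rfl⟩ : ∃ s, r = s + 1 := ⟨r - 1, by omega⟩
  rw [Nat.add_sub_cancel, spinY_lt_iff hε0 k hE (by omega)]

lemma lower_corner_iff {N : ℕ} {ε : ℝ} (hε0 : 0 < ε) {k : ℤ} {E : Finset ℕ}
    (hE : E ⊆ Finset.Icc 1 N) {r : ℕ} (hr1 : 1 ≤ r) (hr : r < N) :
    (spinY N ε k E (r - 1) < spinY N ε k E r ∧ spinY N ε k E (r + 1) < spinY N ε k E r) ↔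
      r ∉ E ∧ r + 1 ∈ E := by
  rw [spinY_lt_iff hε0 k hE (by omega)]
  obtain ⟨r, rfl⟩ : ∃ s, r = s + 1 := ⟨r - 1, by omega⟩
  rw [Nat.add_sub_cancel, lt_spinY_iff hε0 k hE (by omega)]

/-- The corners of a spin path away from its end point, described by a relation `R` between the
vertical coordinates of three consecutive points. -/
lemma spinPath_corners {N : ℕ} {ε : ℝ} {k : ℤ} (hk : k % 2 = 1)
    {E : Finset ℕ} (R : ℝ → ℝ → ℝ → Prop) (Q : ℕ → Prop) [DecidablePred Q]
    (hR : ∀ r, 1 ≤ r → r < N →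
      (R (spinY N ε k E (r - 1)) (spinY N ε k E r) (spinY N ε k E (r + 1)) ↔ Q r)) :
    {c | c ∈ indexX N ∧ ∃ r : ℕ, 1 ≤ r ∧ r < N ∧ (spinPath N ε k E).getD r 0 = iota N c ∧
      R ((spinPath N ε k E).getD (r - 1) 0).2 ((spinPath N ε k E).getD r 0).2
        ((spinPath N ε k E).getD (r + 1) 0).2} =
    (((Finset.Ico 1 N).filter Q).image fun r => (r, spinHt N k E r) : Finset (ℕ × ℤ)) := by
  ext c
  simp only [Set.mem_ofPred_eq, Finset.coe_image, Set.mem_image, Finset.mem_coe, Finset.mem_filter,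
    Finset.mem_Ico]
  constructor
  · rintro ⟨hc, r, h1, h2, h3, h4⟩
    rw [getD_spinPath _ _ _ (by omega), getD_spinPath _ _ _ (by omega),
      getD_spinPath _ _ _ (by omega)] at h4
    rw [getD_spinPath _ _ _ (by omega), iota_eq_iff hk E h1 h2 hc] at h3
    exact ⟨r, ⟨⟨h1, h2⟩, (hR r h1 h2).1 h4⟩, h3.symm⟩
  · rintro ⟨r, ⟨⟨h1, h2⟩, hQ⟩, rfl⟩
    have hc := mem_indexX_spinHt hk E h1 h2
    refine ⟨hc, r, h1, h2, ?_, ?_⟩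
    · rw [getD_spinPath _ _ _ (by omega), iota_eq_iff hk E h1 h2 hc]
    · rw [getD_spinPath _ _ _ (by omega), getD_spinPath _ _ _ (by omega),
        getD_spinPath _ _ _ (by omega)]
      exact (hR r h1 h2).2 hQ

lemma pathMonomial_of_corners {N : ℕ} {ε : ℝ} {p : Path2} {A B A' B' : Finset (ℕ × ℤ)}
    (hU : upperCorners N ε p = ↑A ∪ ↑B) (hL : lowerCorners N ε p = ↑A' ∪ ↑B')
    (hA : ∀ c ∈ A, c.1 < N) (hB : ∀ c ∈ B, c.1 = N) (hA' : ∀ c ∈ A', c.1 < N)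
    (hB' : ∀ c ∈ B', c.1 = N) :
    pathMonomial N ε p =
      ((∏ c ∈ A, varY N c.1 c.2) * ∏ c ∈ A', (varY N c.1 c.2)⁻¹) *
      ((∏ c ∈ B, varY N c.1 c.2) * ∏ c ∈ B', (varY N c.1 c.2)⁻¹) := by
  have d : Disjoint A B := Finset.disjoint_left.2 fun c h h' => by
    have := hA c h; have := hB c h'; omega
  have d' : Disjoint A' B' := Finset.disjoint_left.2 fun c h h' => by
    have := hA' c h; have := hB' c h'; omega
  rw [pathMonomial, hU, hL, ← Finset.coe_union, ← Finset.coe_union, finprod_mem_coe_finset,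
    finprod_mem_coe_finset, Finset.prod_union d, Finset.prod_union d']
  exact mul_mul_mul_comm _ _ _ _

lemma sideUpper_lt {N : ℕ} {k : ℤ} {E : Finset ℕ} : ∀ c ∈ sideUpper N k E, c.1 < N := by
  intro c hc
  simp only [sideUpper, Finset.mem_image, Finset.mem_filter, Finset.mem_Ico] at hc
  obtain ⟨r, ⟨⟨_, h⟩, _⟩, rfl⟩ := hc
  exact h

lemma sideLower_lt {N : ℕ} {k : ℤ} {E : Finset ℕ} : ∀ c ∈ sideLower N k E, c.1 < N := by
  intro c hc
  simp only [sideLower, Finset.mem_image, Finset.mem_filter, Finset.mem_Ico] at hc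
  obtain ⟨r, ⟨⟨_, h⟩, _⟩, rfl⟩ := hc
  exact h

theorem pathMonomial_spinPath {N : ℕ} {ε : ℝ} (hε0 : 0 < ε) (hε : ε < 1 / 2)
    {k : ℤ} (hk : k % 2 = 1) {E : Finset ℕ} (hE : E ⊆ Finset.Icc 1 N) :
    pathMonomial N ε (spinPath N ε k E) = spinMonomial N k E := by
  have hX : (N, spinEnd N k E) ∈ indexX N := Or.inl ⟨rfl, spinEnd_odd hk E⟩
  have hU : upperCorners N ε (spinPath N ε k E) = ↑(sideUpper N k E) ∪ ↑(endUpper N k E) := by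
    unfold upperCorners
    congr 1
    · rw [sideUpper, ← spinPath_corners hk (fun a b c => b < a ∧ b < c) _
        (fun r h1 h2 => upper_corner_iff hε0 hE h1 h2)]
      ext c
      simp only [Set.mem_ofPred_eq, length_spinPath]
      refine and_congr_right fun hc => exists_congr fun r => ?_
      constructor
      · rintro ⟨h1, h2, h3, -, -, -, h4⟩; exact ⟨h1, by omega, h3, h4⟩
      · rintro ⟨h1, h2, h3, h4⟩
        have := spinAbscissa_interior (k := k) h1 h2
        have e := getD_spinPath ε k E h2.le
        refine ⟨h1, by omega, h3, ?_, ?_, ?_, h4⟩ <;> rw [e] <;> tauto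
    · ext ⟨i, l⟩
      simp only [Set.mem_ofPred_eq, center_mem_spinPath, sub_eq_spinCtr hε0 hε,
        add_eq_spinCtr hε0 hε, endUpper]
      by_cases h : N ∈ E
      · simp only [h, true_and, not_true, false_and, if_true, not_false_eq_true, and_true,
          Finset.coe_singleton, Set.mem_singleton_iff, Prod.mk.injEq]
        constructor
        · rintro ⟨_, h⟩; exact h
        · rintro ⟨rfl, rfl⟩; exact ⟨hX, rfl, rfl⟩
      · simp [h]
  have hL : lowerCorners N ε (spinPath N ε k E) = ↑(sideLower N k E) ∪ ↑(endLower N k E) := by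
    unfold lowerCorners
    congr 1
    · rw [sideLower, ← spinPath_corners hk (fun a b c => a < b ∧ c < b) _
        (fun r h1 h2 => lower_corner_iff hε0 hE h1 h2)]
      ext c
      simp only [Set.mem_ofPred_eq, length_spinPath]
      refine and_congr_right fun hc => exists_congr fun r => ?_
      constructor
      · rintro ⟨h1, h2, h3, -, -, -, h4⟩; exact ⟨h1, by omega, h3, h4⟩
      · rintro ⟨h1, h2, h3, h4⟩
        have := spinAbscissa_interior (k := k) h1 h2
        have e := getD_spinPath ε k E h2.le
        refine ⟨h1, by omega, h3, ?_, ?_, ?_, h4⟩ <;> rw [e] <;> tauto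
    · ext ⟨i, l⟩
      simp only [Set.mem_ofPred_eq, center_mem_spinPath, sub_eq_spinCtr hε0 hε,
        add_eq_spinCtr hε0 hε, endLower]
      by_cases h : N ∈ E
      · simp [h]
      · simp only [h, true_and, false_and, if_false, not_false_eq_true, and_true,
          Finset.coe_singleton, Set.mem_singleton_iff, Prod.mk.injEq]
        constructor
        · rintro ⟨_, h⟩; exact h
        · rintro ⟨rfl, rfl⟩; exact ⟨hX, rfl, rfl⟩
  rw [pathMonomial_of_corners hU hL sideUpper_lt _ sideLower_lt _, spinMonomial, sideMonomial]
  · congr 1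
    unfold endUpper endLower endMonomial
    split_ifs <;> simp
  · unfold endUpper; split_ifs <;> simp
  · unfold endLower; split_ifs <;> simp

lemma getD_append_reverse_left {N r : ℕ} {a b : Path2} (ha : a.length = N + 1) (hr : r ≤ N) :
    (a ++ b.reverse).getD r 0 = a.getD r 0 := by
  rw [List.getD_append _ _ _ _ (by omega)]

lemma getD_append_reverse_right {N r : ℕ} {a b : Path2} (ha : a.length = N + 1)
    (hb : b.length = N + 1) (hr : r ≤ N) :
    (a ++ b.reverse).getD (2 * N + 1 - r) 0 = b.getD r 0 := by
  rw [List.getD_append_right _ _ _ _ (by omega), List.getD_eq_getElem _ _ (by simp; omega),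
    List.getElem_reverse, List.getD_eq_getElem _ _ (by omega)]
  congr 1
  omega

/-- The corners, away from the central line, of the concatenation of two spin paths. -/
lemma append_corners {N : ℕ} {ε : ℝ} {k k' : ℤ} {E E' : Finset ℕ} (R : ℝ → ℝ → ℝ → Prop)
    (hsymm : ∀ a b c, R a b c → R c b a) :
    {c | c ∈ indexX N ∧ ∃ r : ℕ, 1 ≤ r ∧
      r + 1 < (spinPath N ε k E ++ (spinPath N ε k' E').reverse).length ∧
      (spinPath N ε k E ++ (spinPath N ε k' E').reverse).getD r 0 = iota N c ∧
      ((spinPath N ε k E ++ (spinPath N ε k' E').reverse).getD r 0).1 ≠ 0 ∧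
      ((spinPath N ε k E ++ (spinPath N ε k' E').reverse).getD r 0).1 ≠ 2 * N - 1 ∧
      ((spinPath N ε k E ++ (spinPath N ε k' E').reverse).getD r 0).1 ≠ 4 * N - 2 ∧
      R ((spinPath N ε k E ++ (spinPath N ε k' E').reverse).getD (r - 1) 0).2
        ((spinPath N ε k E ++ (spinPath N ε k' E').reverse).getD r 0).2
        ((spinPath N ε k E ++ (spinPath N ε k' E').reverse).getD (r + 1) 0).2} =
    {c | c ∈ indexX N ∧ ∃ r : ℕ, 1 ≤ r ∧ r < N ∧ (spinPath N ε k E).getD r 0 = iota N c ∧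
      R ((spinPath N ε k E).getD (r - 1) 0).2 ((spinPath N ε k E).getD r 0).2
        ((spinPath N ε k E).getD (r + 1) 0).2} ∪
    {c | c ∈ indexX N ∧ ∃ r : ℕ, 1 ≤ r ∧ r < N ∧ (spinPath N ε k' E').getD r 0 = iota N c ∧
      R ((spinPath N ε k' E').getD (r - 1) 0).2 ((spinPath N ε k' E').getD r 0).2
        ((spinPath N ε k' E').getD (r + 1) 0).2} := by
  have ha := length_spinPath N ε k E
  have hb := length_spinPath N ε k' E'
  ext c
  simp only [Set.mem_ofPred_eq, Set.mem_union, List.length_append, List.length_reverse, ha, hb]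
  rw [← and_or_left]
  refine and_congr_right fun hc => ?_
  constructor
  · rintro ⟨r, h1, h2, h3, -, h4, -, h5⟩
    rcases lt_trichotomy r N with h | rfl | h
    · left
      rw [getD_append_reverse_left ha (by omega)] at h3
      rw [getD_append_reverse_left ha (by omega), getD_append_reverse_left ha (by omega),
        getD_append_reverse_left ha (by omega)] at h5
      exact ⟨r, h1, h, h3, h5⟩
    · exfalso
      apply h4
      rw [getD_append_reverse_left ha le_rfl, getD_spinPath _ _ _ le_rfl]
      simp [spinAbscissa]
    · right
      obtain ⟨s, hs, rfl⟩ : ∃ s, s ≤ N ∧ r = 2 * N + 1 - s := ⟨2 * N + 1 - r, by omega, by omega⟩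
      rw [getD_append_reverse_right ha hb hs] at h3 h4
      have hsN : s ≠ N := by
        rintro rfl
        apply h4
        rw [getD_spinPath _ _ _ le_rfl]
        simp [spinAbscissa]
      rw [show 2 * N + 1 - s - 1 = 2 * N + 1 - (s + 1) by omega,
        show 2 * N + 1 - s + 1 = 2 * N + 1 - (s - 1) by omega,
        getD_append_reverse_right ha hb (by omega), getD_append_reverse_right ha hb (by omega),
        getD_append_reverse_right ha hb (by omega)] at h5
      exact ⟨s, by omega, by omega, h3, hsymm _ _ _ h5⟩
  · rintro (⟨r, h1, h2, h3, h4⟩ | ⟨s, h1, h2, h3, h4⟩)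
    · refine ⟨r, h1, by omega, ?_⟩
      rw [getD_append_reverse_left ha (by omega), getD_append_reverse_left ha (by omega),
        getD_append_reverse_left ha (by omega)]
      have := spinAbscissa_interior (k := k) h1 h2
      refine ⟨h3, ?_, ?_, ?_, h4⟩ <;> rw [getD_spinPath _ _ _ h2.le] <;> tauto
    · refine ⟨2 * N + 1 - s, by omega, by omega, ?_⟩
      rw [show 2 * N + 1 - s - 1 = 2 * N + 1 - (s + 1) by omega,
        show 2 * N + 1 - s + 1 = 2 * N + 1 - (s - 1) by omega,
        getD_append_reverse_right ha hb (by omega), getD_append_reverse_right ha hb (by omega),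
        getD_append_reverse_right ha hb (by omega)]
      have := spinAbscissa_interior (k := k') h1 h2
      refine ⟨h3, ?_, ?_, ?_, hsymm _ _ _ h4⟩ <;> rw [getD_spinPath _ _ _ h2.le] <;> tauto

lemma sideMonomial_disjoint {N : ℕ} {k k' : ℤ} (hk : k % 2 = 1) (hkk : (k' - k) % 4 = 2)
    {E E' : Finset ℕ} (Q Q' : ℕ → Prop) [DecidablePred Q] [DecidablePred Q'] :
    Disjoint (((Finset.Ico 1 N).filter Q).image fun r => (r, spinHt N k E r))
      (((Finset.Ico 1 N).filter Q').image fun r => (r, spinHt N k' E' r)) := by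
  rw [Finset.disjoint_left]
  intro c h h'
  simp only [Finset.mem_image] at h h'
  obtain ⟨r, -, rfl⟩ := h
  obtain ⟨r', -, h⟩ := h'
  rw [Prod.mk.injEq] at h
  obtain ⟨rfl, h⟩ := h
  unfold spinHt at h
  omega

/-- The monomial of the concatenation of two spin paths is the product of their monomials: the only
corners that can disappear are the two end points, and if they do then they cancel. -/
theorem pathMonomial_append {N : ℕ} {ε : ℝ} (hε0 : 0 < ε) (hε : ε < 1 / 2)
    {k k' : ℤ} (hk : k % 2 = 1) (hkk : (k' - k) % 4 = 2) {E E' : Finset ℕ}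
    (hE : E ⊆ Finset.Icc 1 N) (hE' : E' ⊆ Finset.Icc 1 N)
    (hlt : spinCtr N ε k' E' < spinCtr N ε k E) :
    pathMonomial N ε (spinPath N ε k E ++ (spinPath N ε k' E').reverse) =
      spinMonomial N k E * spinMonomial N k' E' := by
  have hk' : k' % 2 = 1 := by omega
  have hX : (N, spinEnd N k E) ∈ indexX N := Or.inl ⟨rfl, spinEnd_odd hk E⟩
  have hX' : (N, spinEnd N k' E') ∈ indexX N := Or.inl ⟨rfl, spinEnd_odd hk' E'⟩
  set q := spinPath N ε k E ++ (spinPath N ε k' E').reverse with hq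
  have hmem : ∀ y, (2 * (N : ℝ) - 1, y) ∈ q ↔ (y = spinCtr N ε k E ∨ y = spinCtr N ε k' E') := by
    intro y
    rw [hq, List.mem_append, List.mem_reverse, center_mem_spinPath, center_mem_spinPath]
  have hU : upperCorners N ε q = ↑(sideUpper N k E ∪ sideUpper N k' E') ∪
      ↑((endUpper N k E ∪ endUpper N k' E') \ (endLower N k E ∪ endLower N k' E')) := by
    unfold upperCorners
    congr 1
    · rw [hq, append_corners (fun a b c => b < a ∧ b < c) (fun a b c h => ⟨h.2, h.1⟩),
        spinPath_corners hk (fun a b c => b < a ∧ b < c) _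
        (fun r h1 h2 => upper_corner_iff hε0 hE h1 h2),
        spinPath_corners hk' (fun a b c => b < a ∧ b < c) _
        (fun r h1 h2 => upper_corner_iff hε0 hE' h1 h2), Finset.coe_union]
      rfl
    · ext ⟨i, l⟩
      simp only [Set.mem_ofPred_eq, hmem, sub_eq_spinCtr hε0 hε,
        add_eq_spinCtr hε0 hε, endUpper, endLower]
      split_ifs with h h' h' <;> simp [h, h'] <;> grind
  have hL : lowerCorners N ε q = ↑(sideLower N k E ∪ sideLower N k' E') ∪
      ↑((endLower N k E ∪ endLower N k' E') \ (endUpper N k E ∪ endUpper N k' E')) := by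
    unfold lowerCorners
    congr 1
    · rw [hq, append_corners (fun a b c => a < b ∧ c < b) (fun a b c h => ⟨h.2, h.1⟩),
        spinPath_corners hk (fun a b c => a < b ∧ c < b) _
        (fun r h1 h2 => lower_corner_iff hε0 hE h1 h2),
        spinPath_corners hk' (fun a b c => a < b ∧ c < b) _
        (fun r h1 h2 => lower_corner_iff hε0 hE' h1 h2), Finset.coe_union]
      rfl
    · ext ⟨i, l⟩
      simp only [Set.mem_ofPred_eq, hmem, sub_eq_spinCtr hε0 hε,
        add_eq_spinCtr hε0 hε, endUpper, endLower]
      split_ifs with h h' h' <;> simp [h, h'] <;> grind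
  have eU : ∀ c ∈ endUpper N k E ∪ endUpper N k' E', c.1 = N := by
    intro c hc
    simp only [endUpper, Finset.mem_union] at hc
    split_ifs at hc <;> simp at hc <;> grind
  have eL : ∀ c ∈ endLower N k E ∪ endLower N k' E', c.1 = N := by
    intro c hc
    simp only [endLower, Finset.mem_union] at hc
    split_ifs at hc <;> simp at hc <;> grind
  rw [pathMonomial_of_corners hU hL
    (fun c hc => by
      rcases Finset.mem_union.1 hc with h | h
      · exact sideUpper_lt _ h
      · exact sideUpper_lt _ h)
    (fun c hc => eU c (Finset.mem_sdiff.1 hc).1)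
    (fun c hc => by
      rcases Finset.mem_union.1 hc with h | h
      · exact sideLower_lt _ h
      · exact sideLower_lt _ h)
    (fun c hc => eL c (Finset.mem_sdiff.1 hc).1)]
  refine Eq.trans (congrArg₂ (· * ·) (?_ : _ = sideMonomial N k E * sideMonomial N k' E')
    (?_ : _ = endMonomial N k E * endMonomial N k' E')) (mul_mul_mul_comm _ _ _ _)
  · unfold sideMonomial sideUpper sideLower
    rw [Finset.prod_union (sideMonomial_disjoint hk hkk _ _),
      Finset.prod_union (sideMonomial_disjoint hk hkk _ _)]
    exact mul_mul_mul_comm _ _ _ _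
  unfold spinCtr at hlt
  unfold endUpper endLower endMonomial
  by_cases h : N ∈ E <;> by_cases h' : N ∈ E' <;>
    simp only [h, h', if_true, if_false] at hlt ⊢
  · have hne : spinEnd N k E ≠ spinEnd N k' E' := by
      intro e; rw [e] at hlt; exact lt_irrefl _ hlt
    have : ¬ ((N, spinEnd N k E) = (N, spinEnd N k' E')) := by simpa using hne
    rw [Finset.union_empty, Finset.sdiff_empty, Finset.empty_sdiff,
      Finset.prod_union (by simpa using hne)]
    simp
  · have hne : spinEnd N k E ≠ spinEnd N k' E' := by
      intro e; rw [e] at hlt; linarith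
    simp [hne, hne.symm, Finset.sdiff_singleton_eq_erase]
  · by_cases hne : spinEnd N k E = spinEnd N k' E'
    · simp [hne]
    · have hne' : ¬ (spinEnd N k' E' = spinEnd N k E) := fun h => hne h.symm
      simp [hne, hne', Finset.sdiff_singleton_eq_erase, mul_comm]
  · have hne : spinEnd N k E ≠ spinEnd N k' E' := by
      intro e; rw [e] at hlt; exact lt_irrefl _ hlt
    rw [Finset.union_empty, Finset.sdiff_empty, Finset.empty_sdiff,
      Finset.prod_union (by simpa using hne)]
    simp

/-! ### Columns and their monomials -/

lemma letter_val {N s : ℕ} (h1 : 1 ≤ s) (h : s ≤ N) : (letter N s).val = s - 1 := by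
  simp only [letter, Fin.ofNat]
  exact Nat.mod_eq_of_lt (by omega)

lemma letterZero_val (N : ℕ) : (letterZero N).val = N := by
  simp only [letterZero, Fin.ofNat]
  exact Nat.mod_eq_of_lt (by omega)

lemma letterBar_val {N s : ℕ} (h1 : 1 ≤ s) (h : s ≤ N) :
    (letterBar N s).val = 2 * N + 1 - s := by
  simp only [letterBar, Fin.ofNat]
  exact Nat.mod_eq_of_lt (by omega)

/-- The function `f` fills a column with rows `t, …, b` by the letters of `B` in alphabetical order
from the top downwards, by the letters `s̄`, `s ∈ B'`, in reverse alphabetical order from the bottom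
upwards, and by `0` in the remaining boxes. -/
def IsColumnFilling (N : ℕ) (t b : ℤ) (B B' : Finset ℕ) (f : ℤ → Letter N) : Prop :=
  (∀ i, t ≤ i → i < t + B.card → ∃ s ∈ B, (cnt B s : ℤ) = i - t + 1 ∧ f i = letter N s) ∧
  (∀ i, t + B.card ≤ i → i ≤ b - B'.card → f i = letterZero N) ∧
  (∀ i, b - B'.card < i → i ≤ b → ∃ s ∈ B', (cnt B' s : ℤ) = b - i + 1 ∧ f i = letterBar N s)

/-- The variable at the `r`-th point of a spin path. -/
noncomputable def spinVar (N : ℕ) (k : ℤ) (E : Finset ℕ) (r : ℕ) : Monomials :=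
  varY N r (spinHt N k E r)

lemma spinVar_zero (N : ℕ) (k : ℤ) (E : Finset ℕ) : spinVar N k E 0 = 1 := by
  simp [spinVar, varY]

lemma sideMonomial_eq (N : ℕ) (k : ℤ) (E : Finset ℕ) :
    sideMonomial N k E = ∏ r ∈ Finset.Ico 1 N, ((if r ∈ E then spinVar N k E r else 1) *
      if r + 1 ∈ E then (spinVar N k E r)⁻¹ else 1) := by
  unfold sideMonomial sideUpper sideLower
  rw [Finset.prod_image (fun a _ b _ h => (Prod.mk.inj h).1),
    Finset.prod_image (fun a _ b _ h => (Prod.mk.inj h).1), Finset.prod_filter,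
    Finset.prod_filter, ← Finset.prod_mul_distrib]
  refine Finset.prod_congr rfl fun r _ => ?_
  by_cases h : r ∈ E <;> by_cases h' : r + 1 ∈ E <;> simp [h, h', spinVar]

lemma prod_shift {N : ℕ} {B : Finset ℕ} (hB : B ⊆ Finset.Icc 1 N) (V : ℕ → Monomials)
    (hV : V 0 = 1) :
    ∏ s ∈ B, V (s - 1) = ∏ r ∈ Finset.Ico 1 N, if r + 1 ∈ B then V r else 1 := by
  rw [← Finset.prod_filter]
  symm
  have : ∏ s ∈ B, V (s - 1) = ∏ s ∈ B.filter (fun s => s ≠ 1), V (s - 1) := by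
    rw [Finset.prod_filter]
    refine Finset.prod_congr rfl fun s _ => ?_
    split_ifs with h
    · rfl
    · push Not at h; rw [h]; simpa using hV
  rw [this]
  refine Finset.prod_bij (fun r _ => r + 1) ?_ ?_ ?_ ?_
  · intro r hr
    simp only [Finset.mem_filter, Finset.mem_Ico] at hr ⊢
    exact ⟨hr.2, by omega⟩
  · intro a _ b _ h; exact Nat.add_right_cancel h
  · intro s hs
    simp only [Finset.mem_filter] at hs
    have := Finset.mem_Icc.1 (hB hs.1)
    have e : s - 1 + 1 = s := by omega
    refine ⟨s - 1, ?_, e⟩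
    simp only [Finset.mem_filter, Finset.mem_Ico]
    rw [e]
    exact ⟨by omega, hs.1⟩
  · intro r _; rfl

lemma prod_below {N : ℕ} {B : Finset ℕ} (hB : B ⊆ Finset.Icc 1 N) (V : ℕ → Monomials) :
    ∏ s ∈ B, (if s < N then V s else 1) = ∏ r ∈ Finset.Ico 1 N, if r ∈ B then V r else 1 := by
  rw [← Finset.prod_filter, ← Finset.prod_filter]
  refine Finset.prod_congr ?_ fun _ _ => rfl
  ext s
  simp only [Finset.mem_filter, Finset.mem_Ico]
  constructor
  · rintro ⟨h1, h2⟩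
    have := Finset.mem_Icc.1 (hB h1)
    exact ⟨⟨this.1, h2⟩, h1⟩
  · rintro ⟨⟨_, h1⟩, h2⟩
    exact ⟨h2, h1⟩

lemma prod_last {N : ℕ} {B : Finset ℕ} (hB : B ⊆ Finset.Icc 1 N) (x : Monomials) :
    ∏ s ∈ B, (if s < N then 1 else x) = if N ∈ B then x else 1 := by
  have h : ∀ s ∈ B, (if s < N then 1 else x) = if s = N then x else 1 := by
    intro s hs
    have := Finset.mem_Icc.1 (hB hs)
    by_cases h : s < N
    · rw [if_pos h, if_neg (by omega)]
    · rw [if_neg h, if_pos (by omega)]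
  rw [Finset.prod_congr rfl h, Finset.prod_ite_eq']

lemma boxMonomial_letter {N s : ℕ} (h1 : 1 ≤ s) (h : s ≤ N) (k : ℤ) :
    boxMonomial N (letter N s) k =
      (varY N (s - 1) (2 * s + k))⁻¹ * ((if s < N then varY N s (2 * s - 2 + k) else 1) *
        if s < N then 1 else varY N N (2 * N - 3 + k) * varY N N (2 * N - 1 + k)) := by
  unfold boxMonomial
  rw [letter_val h1 h]
  by_cases hs : s < N
  · rw [if_pos (by omega), if_pos hs, if_pos hs, mul_one]
    have e : s - 1 + 1 = s := by omega
    simp only [e]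
  · obtain rfl : s = N := by omega
    rw [if_neg (by omega), if_pos (by omega), if_neg hs, if_neg hs, one_mul, mul_assoc]

lemma boxMonomial_zero (N : ℕ) (k : ℤ) :
    boxMonomial N (letterZero N) k =
      (varY N N (2 * N + 1 + k))⁻¹ * varY N N (2 * N - 3 + k) := by
  unfold boxMonomial
  rw [letterZero_val, if_neg (by omega), if_neg (by omega), if_pos rfl]

lemma boxMonomial_letterBar {N s : ℕ} (h1 : 1 ≤ s) (h : s ≤ N) (k : ℤ) :
    boxMonomial N (letterBar N s) k =
      varY N (s - 1) (4 * N - 2 - 2 * s + k) *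
        ((if s < N then (varY N s (4 * N - 2 * s + k))⁻¹ else 1) *
        if s < N then 1 else (varY N N (2 * N - 1 + k) * varY N N (2 * N + 1 + k))⁻¹) := by
  unfold boxMonomial
  rw [letterBar_val h1 h]
  by_cases hs : s < N
  · rw [if_neg (by omega), if_neg (by omega), if_neg (by omega), if_neg (by omega), if_pos hs,
      if_pos hs, mul_one]
    have e : 2 * N + 1 - (2 * N + 1 - s) = s := by omega
    simp only [e]
    exact mul_comm _ _
  · obtain rfl : s = N := by omega
    rw [if_neg (by omega), if_neg (by omega), if_neg (by omega), if_pos (by omega), if_neg hs,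
      if_neg hs, one_mul, mul_inv, mul_comm]
    congr 2
    ring

/-- The letters `1, …, N` of a column contribute the monomial of a spin path, up to a factor that
depends only on the first row below them. -/
lemma prod_top {N : ℕ} {t j : ℤ} {B : Finset ℕ} (hB : B ⊆ Finset.Icc 1 N) {f : ℤ → Letter N}
    (hf : ∀ i, t ≤ i → i < t + B.card →
      ∃ s ∈ B, (cnt B s : ℤ) = i - t + 1 ∧ f i = letter N s) :
    ∏ i ∈ Finset.Ico t (t + B.card), boxMonomial N (f i) (4 * (j - i)) =
      spinMonomial N (4 * (j - t) - 2 * N + 3) B *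
        varY N N (2 * N + 1 + 4 * (j - (t + B.card))) := by
  set k : ℤ := 4 * (j - t) - 2 * N + 3 with hk
  have h1 : ∏ i ∈ Finset.Ico t (t + B.card), boxMonomial N (f i) (4 * (j - i)) =
      ∏ s ∈ B, ((spinVar N k B (s - 1))⁻¹ * ((if s < N then spinVar N k B s else 1) *
        if s < N then 1 else varY N N (spinEnd N k B - 2) * varY N N (spinEnd N k B))) := by
    symm
    refine Finset.prod_bij (fun s _ => t + cnt B s - 1) ?_ ?_ ?_ ?_
    · intro s hs
      have := cnt_pos hs
      have := cnt_le_card B s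
      rw [Finset.mem_Ico]; omega
    · intro a ha b hb h
      exact cnt_inj ha hb (by omega)
    · intro i hi
      rw [Finset.mem_Ico] at hi
      obtain ⟨s, hs, e, -⟩ := hf i hi.1 hi.2
      exact ⟨s, hs, by omega⟩
    · intro s hs
      have p := cnt_pos hs
      have q := cnt_le_card B s
      have hs' := Finset.mem_Icc.1 (hB hs)
      obtain ⟨s', hs1, e, e'⟩ := hf (t + cnt B s - 1) (by omega) (by omega)
      obtain rfl : s' = s := cnt_inj hs1 hs (by omega)
      rw [e', boxMonomial_letter hs'.1 hs'.2]
      have hc := cnt_succ B (s' - 1)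
      rw [show s' - 1 + 1 = s' by omega, if_pos hs] at hc
      congr 1
      · rw [spinVar, spinHt]
        congr 2
        push_cast [hs'.1]
        omega
      · congr 1
        · split_ifs with h
          · rw [spinVar, spinHt]
            congr 1
            omega
          · rfl
        · split_ifs with h
          · rfl
          · obtain rfl : s' = N := by omega
            rw [cnt_top hB] at *
            rw [spinEnd, if_pos hs]
            congr 2 <;> omega
  rw [h1, Finset.prod_mul_distrib, Finset.prod_mul_distrib, prod_below hB, prod_last hB,
    prod_shift hB (fun r => (spinVar N k B r)⁻¹) (by simp [spinVar_zero]), ← mul_assoc, mul_comm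
    (∏ r ∈ Finset.Ico 1 N, _), ← Finset.prod_mul_distrib, ← sideMonomial_eq, spinMonomial,
    mul_assoc, endMonomial]
  congr 1
  by_cases h : N ∈ B
  · rw [if_pos h, if_pos h, mul_comm]
    congr 2
    rw [spinEnd, if_pos h]; ring
  · rw [if_neg h, if_neg h]
    symm
    rw [inv_mul_eq_one]
    congr 1
    rw [spinEnd, if_neg h]; ring

/-- A run of zeros in a column telescopes. -/
lemma prod_zeros (N : ℕ) (j c : ℤ) (n : ℕ) :
    ∏ i ∈ Finset.Ico c (c + n), boxMonomial N (letterZero N) (4 * (j - i)) =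
      (varY N N (2 * N + 1 + 4 * (j - c)))⁻¹ * varY N N (2 * N + 1 + 4 * (j - (c + n))) := by
  induction n with
  | zero => simp
  | succ n ih =>
    have : Finset.Ico c (c + (n + 1 : ℕ)) = insert (c + n) (Finset.Ico c (c + n)) := by
      ext x; simp only [Finset.mem_insert, Finset.mem_Ico]; omega
    rw [this, Finset.prod_insert (by simp), ih, boxMonomial_zero]
    have e : (2 * N - 3 + 4 * (j - (c + n)) : ℤ) = 2 * N + 1 + 4 * (j - (c + (n + 1 : ℕ))) := by
      push_cast; ring
    rw [e]
    set x := varY N N (2 * N + 1 + 4 * (j - (c + n)))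
    set y := varY N N (2 * N + 1 + 4 * (j - (c + (n + 1 : ℕ))))
    set z := varY N N (2 * N + 1 + 4 * (j - c))
    calc x⁻¹ * y * (z⁻¹ * x) = z⁻¹ * y * (x⁻¹ * x) := by
          rw [mul_comm z⁻¹ x, mul_mul_mul_comm, mul_comm y z⁻¹, mul_comm]
      _ = z⁻¹ * y := by rw [inv_mul_cancel, mul_one]

/-- The letters `N̄, …, 1̄` of a column contribute the monomial of a spin path, up to a factor that
depends only on the first row occupied by them. -/
lemma prod_bottom {N : ℕ} {b j : ℤ} {B : Finset ℕ} (hB : B ⊆ Finset.Icc 1 N)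
    {f : ℤ → Letter N}
    (hf : ∀ i, b - B.card < i → i ≤ b →
      ∃ s ∈ B, (cnt B s : ℤ) = b - i + 1 ∧ f i = letterBar N s) :
    ∏ i ∈ Finset.Ico (b - B.card + 1) (b + 1), boxMonomial N (f i) (4 * (j - i)) =
      spinMonomial N (4 * (j - b) + 2 * N - 3) (Finset.Icc 1 N \ B) *
        (varY N N (2 * N + 1 + 4 * (j - (b - B.card + 1))))⁻¹ := by
  set k : ℤ := 4 * (j - b) + 2 * N - 3 with hk
  set E := Finset.Icc 1 N \ B with hE
  have hmem : ∀ r, 1 ≤ r → r ≤ N → (r ∈ E ↔ r ∉ B) := by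
    intro r h1 h2; simp [hE]; tauto
  have h1 : ∏ i ∈ Finset.Ico (b - B.card + 1) (b + 1), boxMonomial N (f i) (4 * (j - i)) =
      ∏ s ∈ B, (spinVar N k E (s - 1) * ((if s < N then (spinVar N k E s)⁻¹ else 1) *
        if s < N then 1 else (varY N N (spinEnd N k E) * varY N N (spinEnd N k E + 2))⁻¹)) := by
    symm
    refine Finset.prod_bij (fun s _ => b - cnt B s + 1) ?_ ?_ ?_ ?_
    · intro s hs
      have := cnt_pos hs
      have := cnt_le_card B s
      rw [Finset.mem_Ico]; omega
    · intro a ha b hb h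
      exact cnt_inj ha hb (by omega)
    · intro i hi
      rw [Finset.mem_Ico] at hi
      obtain ⟨s, hs, e, -⟩ := hf i (by omega) (by omega)
      exact ⟨s, hs, by omega⟩
    · intro s hs
      have p := cnt_pos hs
      have q := cnt_le_card B s
      have hs' := Finset.mem_Icc.1 (hB hs)
      obtain ⟨s', hs1, e, e'⟩ := hf (b - cnt B s + 1) (by omega) (by omega)
      obtain rfl : s' = s := cnt_inj hs1 hs (by omega)
      rw [e', boxMonomial_letterBar hs'.1 hs'.2]
      have hc := cnt_succ B (s' - 1)
      rw [show s' - 1 + 1 = s' by omega, if_pos hs] at hc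
      have c1 := cnt_compl hs'.2 hB
      have c2 := cnt_compl (show s' - 1 ≤ N by omega) hB
      rw [← hE] at c1 c2
      congr 1
      · rw [spinVar, spinHt]
        congr 1
        push_cast [hs'.1]
        omega
      · congr 1
        · split_ifs with h
          · rw [spinVar, spinHt]
            congr 2
            omega
          · rfl
        · split_ifs with h
          · rfl
          · obtain rfl : s' = N := by omega
            rw [cnt_top hB, cnt_top (E := E) Finset.sdiff_subset] at c1
            rw [cnt_top hB]
            rw [spinEnd, if_neg (by rw [hmem _ hs'.1 hs'.2]; exact not_not.2 hs)]
            congr 3 <;> omega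
  have hcard : E.card + B.card = N := by
    have := cnt_compl le_rfl hB
    rwa [cnt_top hB, cnt_top Finset.sdiff_subset] at this
  rw [h1, Finset.prod_mul_distrib, Finset.prod_mul_distrib,
    prod_below hB (fun r => (spinVar N k E r)⁻¹), prod_last hB,
    prod_shift hB (fun r => spinVar N k E r) (by simp [spinVar_zero]), ← mul_assoc,
    ← Finset.prod_mul_distrib, spinMonomial, sideMonomial_eq, mul_assoc, endMonomial]
  congr 1
  · refine Finset.prod_congr rfl fun r hr => ?_
    rw [Finset.mem_Ico] at hr
    have m1 := hmem r (by omega) (by omega)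
    have m2 := hmem (r + 1) (by omega) (by omega)
    by_cases h : r ∈ B <;> by_cases h' : r + 1 ∈ B <;> simp [h, h', m1, m2]
  · by_cases h : N ∈ B
    · have hN : N ∉ E := by simp [hE, h]
      rw [if_pos h, if_neg hN, mul_inv]
      congr 3
      rw [spinEnd, if_neg hN]; omega
    · rw [if_neg h]
      symm
      by_cases hN : N ∈ E
      · rw [if_pos hN, mul_inv_eq_one]
        congr 1
        rw [spinEnd, if_pos hN]; omega
      · have h0 : N = 0 := by
          by_contra h0
          exact hN ((hmem N (by omega) le_rfl).2 h)
        subst h0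
        simp [varY]

/-- The monomial of a column is the product of the monomials of two spin paths. -/
theorem prod_column {N : ℕ} {t b j : ℤ} {B B' : Finset ℕ} (hB : B ⊆ Finset.Icc 1 N)
    (hB' : B' ⊆ Finset.Icc 1 N) (hcard : (B.card : ℤ) + B'.card ≤ b - t + 1) {f : ℤ → Letter N}
    (hf : IsColumnFilling N t b B B' f) :
    ∏ i ∈ Finset.Icc t b, boxMonomial N (f i) (4 * (j - i)) =
      spinMonomial N (4 * (j - t) - 2 * N + 3) B *
        spinMonomial N (4 * (j - b) + 2 * N - 3) (Finset.Icc 1 N \ B') := by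
  obtain ⟨n, hn⟩ : ∃ n : ℕ, b - B'.card + 1 = t + B.card + n :=
    ⟨(b - B'.card + 1 - (t + B.card)).toNat, by omega⟩
  have hI : Finset.Icc t b = Finset.Ico t (b + 1) := by
    ext x; simp only [Finset.mem_Icc, Finset.mem_Ico]; omega
  have hI2 : Finset.Ico t (b + 1) = Finset.Ico t (t + B.card) ∪
      (Finset.Ico (t + B.card) (t + B.card + n) ∪ Finset.Ico (b - B'.card + 1) (b + 1)) := by
    ext x; simp only [Finset.mem_union, Finset.mem_Ico]; omega
  rw [hI, hI2, Finset.prod_union, Finset.prod_union, prod_top hB hf.1, prod_bottom hB' hf.2.2]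
  · have hz : ∏ i ∈ Finset.Ico (t + (B.card : ℤ)) (t + B.card + n),
        boxMonomial N (f i) (4 * (j - i)) =
        ∏ i ∈ Finset.Ico (t + (B.card : ℤ)) (t + B.card + n),
        boxMonomial N (letterZero N) (4 * (j - i)) := by
      refine Finset.prod_congr rfl fun i hi => ?_
      rw [Finset.mem_Ico] at hi
      rw [hf.2.1 i (by omega) (by omega)]
    rw [hz, prod_zeros, hn]
    set x := varY N N (2 * N + 1 + 4 * (j - (t + B.card)))
    set y := varY N N (2 * N + 1 + 4 * (j - (t + B.card + n)))
    set u := spinMonomial N (4 * (j - t) - 2 * N + 3) B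
    set v := spinMonomial N (4 * (j - b) + 2 * N - 3) (Finset.Icc 1 N \ B')
    rw [mul_comm v, mul_assoc x⁻¹, mul_inv_cancel_left, mul_assoc, mul_inv_cancel_left]
  · rw [Finset.disjoint_left]; intro x; simp only [Finset.mem_Ico]; omega
  · rw [Finset.disjoint_left]; intro x; simp only [Finset.mem_union, Finset.mem_Ico]; omega

/-! ### Skew diagrams -/

lemma mem_column {D : Finset (ℤ × ℕ)} {i : ℤ} {j : ℕ} : i ∈ column D j ↔ (i, j) ∈ D := by
  simp only [column, Finset.mem_image, Finset.mem_filter]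
  constructor
  · rintro ⟨⟨a, b⟩, ⟨h, rfl⟩, rfl⟩; exact h
  · intro h; exact ⟨(i, j), ⟨h, rfl⟩, rfl⟩

lemma mem_nonemptyColumns {D : Finset (ℤ × ℕ)} {j : ℕ} :
    j ∈ nonemptyColumns D ↔ ∃ i, (i, j) ∈ D := by
  simp only [nonemptyColumns, Finset.mem_image]
  constructor
  · rintro ⟨⟨a, b⟩, h, rfl⟩; exact ⟨a, h⟩
  · rintro ⟨i, h⟩; exact ⟨(i, j), h, rfl⟩

lemma column_nonempty {D : Finset (ℤ × ℕ)} {j : ℕ} (hj : j ∈ nonemptyColumns D) :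
    (column D j).Nonempty := by
  obtain ⟨i, h⟩ := mem_nonemptyColumns.1 hj
  exact ⟨i, mem_column.2 h⟩

lemma topRow_mem {D : Finset (ℤ × ℕ)} {j : ℕ} (hj : j ∈ nonemptyColumns D) :
    (topRow D j, j) ∈ D := by
  rw [topRow, dif_pos (column_nonempty hj)]
  exact mem_column.1 (Finset.min'_mem _ _)

lemma bottomRow_mem {D : Finset (ℤ × ℕ)} {j : ℕ} (hj : j ∈ nonemptyColumns D) :
    (bottomRow D j, j) ∈ D := by
  rw [bottomRow, dif_pos (column_nonempty hj)]
  exact mem_column.1 (Finset.max'_mem _ _)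

lemma topRow_le {D : Finset (ℤ × ℕ)} {i : ℤ} {j : ℕ} (h : (i, j) ∈ D) : topRow D j ≤ i := by
  rw [topRow, dif_pos ⟨i, mem_column.2 h⟩]
  exact Finset.min'_le _ _ (mem_column.2 h)

lemma le_bottomRow {D : Finset (ℤ × ℕ)} {i : ℤ} {j : ℕ} (h : (i, j) ∈ D) :
    i ≤ bottomRow D j := by
  rw [bottomRow, dif_pos ⟨i, mem_column.2 h⟩]
  exact Finset.le_max' _ _ (mem_column.2 h)

lemma topRow_le_bottomRow {D : Finset (ℤ × ℕ)} {j : ℕ} (hj : j ∈ nonemptyColumns D) :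
    topRow D j ≤ bottomRow D j := topRow_le (bottomRow_mem hj)

namespace IsSkewDiagram

variable {D : Finset (ℤ × ℕ)} (hD : IsSkewDiagram D)
include hD

lemma pos {j : ℕ} (hj : j ∈ nonemptyColumns D) : 0 < j := hD.1 _ (topRow_mem hj)

/-- A box weakly between two boxes of a skew diagram belongs to the diagram. -/
lemma between {i i' i'' : ℤ} {j j' j'' : ℕ} (h : (i, j) ∈ D) (h'' : (i'', j'') ∈ D)
    (h1 : i ≤ i') (h2 : i' ≤ i'') (h3 : j ≤ j') (h4 : j' ≤ j'') : (i', j') ∈ D := by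
  by_contra hn
  have hj : 0 < j := hD.1 _ h
  rcases hD.2.2 i' j' (by omega) hn with h' | h'
  · exact h' _ _ h2 h4 h''
  · exact h' _ _ h1 hj h3 h

lemma mem_iff {i : ℤ} {j : ℕ} (hj : j ∈ nonemptyColumns D) :
    (i, j) ∈ D ↔ topRow D j ≤ i ∧ i ≤ bottomRow D j :=
  ⟨fun h => ⟨topRow_le h, le_bottomRow h⟩,
    fun h => hD.between (topRow_mem hj) (bottomRow_mem hj) h.1 h.2 le_rfl le_rfl⟩

lemma column_eq {j : ℕ} (hj : j ∈ nonemptyColumns D) :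
    column D j = Finset.Icc (topRow D j) (bottomRow D j) := by
  ext i; rw [mem_column, hD.mem_iff hj, Finset.mem_Icc]

lemma colLength_eq {j : ℕ} (hj : j ∈ nonemptyColumns D) :
    (colLength D j : ℤ) = bottomRow D j - topRow D j + 1 := by
  have := topRow_le_bottomRow hj
  rw [colLength, hD.column_eq hj, Int.card_Icc]; omega

lemma topRow_anti {j j' : ℕ} (hj : j ∈ nonemptyColumns D) (hj' : j' ∈ nonemptyColumns D)
    (h : j ≤ j') : topRow D j' ≤ topRow D j := by
  by_contra hn
  have := hD.between (topRow_mem hj) (topRow_mem hj') le_rfl (by omega) h le_rfl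
  exact hn (topRow_le this)

lemma bottomRow_anti {j j' : ℕ} (hj : j ∈ nonemptyColumns D) (hj' : j' ∈ nonemptyColumns D)
    (h : j ≤ j') : bottomRow D j' ≤ bottomRow D j := by
  by_contra hn
  have := hD.between (bottomRow_mem hj) (bottomRow_mem hj') (by omega) le_rfl le_rfl h
  exact hn (le_bottomRow this)

/-- If the column to the right of column `j` is empty then all later columns lie strictly above
column `j`. -/
lemma bottomRow_lt_topRow {j g j' : ℕ} (hj : j ∈ nonemptyColumns D)
    (hj' : j' ∈ nonemptyColumns D) (hg : g ∉ nonemptyColumns D) (h1 : j ≤ g) (h2 : g ≤ j') :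
    bottomRow D j' < topRow D j := by
  by_contra hn
  exact hg (mem_nonemptyColumns.2
    ⟨_, hD.between (topRow_mem hj) (bottomRow_mem hj') le_rfl (by omega) h1 h2⟩)

end IsSkewDiagram

lemma IsGenericSuperSkewDiagram.overlap_lt {N : ℕ} {D : Finset (ℤ × ℕ)}
    (hD : IsGenericSuperSkewDiagram N D) {j : ℕ} (hj : j ∈ nonemptyColumns D)
    (hj' : j + 1 ∈ nonemptyColumns D) (h : topRow D j ≤ bottomRow D (j + 1)) :
    bottomRow D (j + 1) - topRow D j + 1 < 2 * N := by
  have h1 := hD.2 j (hD.1.pos hj)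
  have h2 : column D j ∩ column D (j + 1) = Finset.Icc (topRow D j) (bottomRow D (j + 1)) := by
    have a := hD.1.topRow_anti hj hj' (Nat.le_succ j)
    have b := hD.1.bottomRow_anti hj hj' (Nat.le_succ j)
    rw [hD.1.column_eq hj, hD.1.column_eq hj']
    ext i
    simp only [Finset.mem_inter, Finset.mem_Icc]
    omega
  rw [h2, Int.card_Icc] at h1
  omega

/-! ### Fillings of columns -/

lemma List.getD_countP_of_pairwise {α : Type*} {R : α → α → Prop} [DecidableRel R]
    (hasymm : ∀ a b, R a b → ¬ R b a) (d : α) {l : List α} (hl : l.Pairwise R) {a : α}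
    (ha : a ∈ l) : l.getD (l.countP fun b => R b a) d = a := by
  induction l with
  | nil => simp at ha
  | cons x xs ih =>
    rw [List.pairwise_cons] at hl
    by_cases hx : R x a
    · have ha' : a ∈ xs := by
        rcases List.mem_cons.1 ha with rfl | h
        · exact absurd hx (hasymm _ _ hx)
        · exact h
      rw [List.countP_cons_of_pos (by simpa using hx), List.getD_cons_succ]
      exact ih hl.2 ha'
    · have hxa : a = x := by
        rcases List.mem_cons.1 ha with h | h
        · exact h
        · exact absurd (hl.1 a h) hx
      subst hxa
      rw [List.countP_cons_of_neg (by simpa using hx)]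
      have : xs.countP (fun b => R b a) = 0 := by
        rw [List.countP_eq_zero]
        intro b hb
        simpa using hasymm _ _ (hl.1 b hb)
      rw [this, List.getD_cons_zero]

lemma Finset.getD_sort_le {α : Type*} [LinearOrder α] (s : Finset α) (d : α) {a : α}
    (ha : a ∈ s) : (s.sort (· ≤ ·)).getD (s.filter (· < a)).card d = a := by
  have h := List.getD_countP_of_pairwise (R := fun a b : α => a < b) (fun _ _ h => not_lt_of_gt h) d
    (s.sortedLT_sort).pairwise ((Finset.mem_sort _).2 ha)
  have e : (s.sort (· ≤ ·)).countP (fun b => b < a) = (s.filter (· < a)).card := by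
    rw [← Multiset.coe_countP, Finset.sort_eq, Multiset.countP_eq_card_filter]; rfl
  rw [← e]; exact h

lemma Finset.getD_sort_ge {α : Type*} [LinearOrder α] (s : Finset α) (d : α) {a : α}
    (ha : a ∈ s) : (s.sort (· ≥ ·)).getD (s.filter (a < ·)).card d = a := by
  have h := List.getD_countP_of_pairwise (R := fun a b : α => b < a) (fun _ _ h => not_lt_of_gt h) d
    (s.sortedGT_sort).pairwise ((Finset.mem_sort _).2 ha)
  have e : (s.sort (· ≥ ·)).countP (fun b => a < b) = (s.filter (a < ·)).card := by
    rw [← Multiset.coe_countP, Finset.sort_eq, Multiset.countP_eq_card_filter]; rfl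
  rw [← e]; exact h

lemma card_filter_lt {B : Finset ℕ} {s : ℕ} (hs : s ∈ B) :
    (B.filter (· < s)).card + 1 = cnt B s := by
  have : B.filter (· ≤ s) = insert s (B.filter (· < s)) := by
    ext x; simp only [Finset.mem_filter, Finset.mem_insert]; grind
  rw [cnt, this, Finset.card_insert_of_notMem (by simp)]

lemma letter_lt_letter {N r s : ℕ} (hr : r ∈ Finset.Icc 1 N) (hs : s ∈ Finset.Icc 1 N) :
    letter N r < letter N s ↔ r < s := by
  rw [Finset.mem_Icc] at hr hs
  rw [Fin.lt_def, letter_val hr.1 hr.2, letter_val hs.1 hs.2]; omega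

lemma letterBar_lt_letterBar {N r s : ℕ} (hr : r ∈ Finset.Icc 1 N) (hs : s ∈ Finset.Icc 1 N) :
    letterBar N r < letterBar N s ↔ s < r := by
  rw [Finset.mem_Icc] at hr hs
  rw [Fin.lt_def, letterBar_val hr.1 hr.2, letterBar_val hs.1 hs.2]; omega

lemma letter_injOn {N : ℕ} {B : Finset ℕ} (hB : B ⊆ Finset.Icc 1 N) :
    Set.InjOn (letter N) B := by
  intro r hr s hs h
  have h1 := (letter_lt_letter (hB hr) (hB hs)).not.1 (by rw [h]; exact lt_irrefl _)
  have h2 := (letter_lt_letter (hB hs) (hB hr)).not.1 (by rw [h]; exact lt_irrefl _)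
  omega

lemma letterBar_injOn {N : ℕ} {B : Finset ℕ} (hB : B ⊆ Finset.Icc 1 N) :
    Set.InjOn (letterBar N) B := by
  intro r hr s hs h
  have h1 := (letterBar_lt_letterBar (hB hr) (hB hs)).not.1 (by rw [h]; exact lt_irrefl _)
  have h2 := (letterBar_lt_letterBar (hB hs) (hB hr)).not.1 (by rw [h]; exact lt_irrefl _)
  omega

lemma sort_letters {N : ℕ} {B : Finset ℕ} (hB : B ⊆ Finset.Icc 1 N) (d : Letter N) {s n : ℕ}
    (hs : s ∈ B) (hn : cnt B s = n + 1) :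
    ((B.image (letter N)).sort (· ≤ ·)).getD n d = letter N s := by
  have h := Finset.getD_sort_le (B.image (letter N)) d (Finset.mem_image_of_mem _ hs)
  have e : (B.image (letter N)).filter (· < letter N s) = (B.filter (· < s)).image (letter N) := by
    rw [Finset.filter_image]
    congr 1
    exact Finset.filter_congr fun r hr => letter_lt_letter (hB hr) (hB hs)
  have := card_filter_lt hs
  rw [e, Finset.card_image_of_injOn (letter_injOn ((Finset.filter_subset _ _).trans hB))] at h
  rwa [show n = (B.filter (· < s)).card by omega]

lemma sort_letterBars {N : ℕ} {B : Finset ℕ} (hB : B ⊆ Finset.Icc 1 N) (d : Letter N) {s n : ℕ}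
    (hs : s ∈ B) (hn : cnt B s = n + 1) :
    ((B.image (letterBar N)).sort (· ≥ ·)).getD n d = letterBar N s := by
  have h := Finset.getD_sort_ge (B.image (letterBar N)) d (Finset.mem_image_of_mem _ hs)
  have e : (B.image (letterBar N)).filter (letterBar N s < ·) =
      (B.filter (· < s)).image (letterBar N) := by
    rw [Finset.filter_image]
    congr 1
    exact Finset.filter_congr fun r hr => letterBar_lt_letterBar (hB hs) (hB hr)
  have := card_filter_lt hs
  rw [e, Finset.card_image_of_injOn (letterBar_injOn ((Finset.filter_subset _ _).trans hB))] at h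
  rwa [show n = (B.filter (· < s)).card by omega]

/-- Column `j` of a filling of `D`, as a function of the row (with value `0` outside `D`). -/
def colFun {N : ℕ} (D : Finset (ℤ × ℕ)) (T : {x // x ∈ D} → Letter N) (j : ℕ) (i : ℤ) :
    Letter N :=
  if h : (i, j) ∈ D then T ⟨(i, j), h⟩ else letterZero N

lemma colFun_eq {N : ℕ} {D : Finset (ℤ × ℕ)} (T : {x // x ∈ D} → Letter N) {j : ℕ} {i : ℤ}
    (h : (i, j) ∈ D) : colFun D T j i = T ⟨(i, j), h⟩ := dif_pos h

lemma isColumnFilling_fillDiagram {N : ℕ} {D : Finset (ℤ × ℕ)} (hD : IsSkewDiagram D)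
    {p : Fin (snake N D).length → Path2} {j : ℕ} (hj : j ∈ nonemptyColumns D)
    {B B' : Finset ℕ} (hB : B ⊆ Finset.Icc 1 N) (hB' : B' ⊆ Finset.Icc 1 N)
    (ht : topLetters N D p j = B.image (letter N))
    (hb : bottomLetters N D p j = B'.image (letterBar N))
    (hc : B.card + B'.card ≤ colLength D j) :
    IsColumnFilling N (topRow D j) (bottomRow D j) B B' (colFun D (fillDiagram N D p) j) := by
  have hl := hD.colLength_eq hj
  have cB : (B.image (letter N)).card = B.card := Finset.card_image_of_injOn (letter_injOn hB)
  have cB' : (B'.image (letterBar N)).card = B'.card :=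
    Finset.card_image_of_injOn (letterBar_injOn hB')
  refine ⟨fun i h1 h2 => ?_, fun i h1 h2 => ?_, fun i h1 h2 => ?_⟩
  · obtain ⟨s, hs, e⟩ := exists_cnt_eq hB (n := (i - topRow D j).toNat)
      (by rw [cnt_top hB]; omega)
    refine ⟨s, hs, by omega, ?_⟩
    rw [colFun_eq _ ((hD.mem_iff hj).2 ⟨h1, by omega⟩)]
    simp only [fillDiagram, ht, cB]
    rw [if_pos (by omega), sort_letters hB _ hs e]
  · rw [colFun_eq _ ((hD.mem_iff hj).2 ⟨by omega, by omega⟩)]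
    simp only [fillDiagram, ht, hb, cB, cB']
    rw [if_neg (by omega), if_neg (by omega)]
  · obtain ⟨s, hs, e⟩ := exists_cnt_eq hB' (n := (bottomRow D j - i).toNat)
      (by rw [cnt_top hB']; omega)
    refine ⟨s, hs, by omega, ?_⟩
    rw [colFun_eq _ ((hD.mem_iff hj).2 ⟨by omega, by omega⟩)]
    simp only [fillDiagram, ht, hb, cB, cB']
    rw [if_neg (by omega), if_pos (by omega), sort_letterBars hB' _ hs e]

namespace IsColumnFilling

variable {N : ℕ} {t b : ℤ} {B B' : Finset ℕ} {f : ℤ → Letter N}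

lemma congr (hf : IsColumnFilling N t b B B' f) {g : ℤ → Letter N}
    (hg : IsColumnFilling N t b B B' g) {i : ℤ} (h1 : t ≤ i) (h2 : i ≤ b) : f i = g i := by
  by_cases h : i < t + B.card
  · obtain ⟨s, hs, e, e'⟩ := hf.1 i h1 h
    obtain ⟨s', hs', e1, e1'⟩ := hg.1 i h1 h
    rw [e', e1', cnt_inj hs hs' (by omega)]
  · by_cases h' : i ≤ b - B'.card
    · rw [hf.2.1 i (by omega) h', hg.2.1 i (by omega) h']
    · obtain ⟨s, hs, e, e'⟩ := hf.2.2 i (by omega) h2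
      obtain ⟨s', hs', e1, e1'⟩ := hg.2.2 i (by omega) h2
      rw [e', e1', cnt_inj hs hs' (by omega)]

lemma val_top (hf : IsColumnFilling N t b B B' f) (hB : B ⊆ Finset.Icc 1 N) {i : ℤ}
    (h1 : t ≤ i) (h2 : i < t + B.card) : (f i).val < N := by
  obtain ⟨s, hs, -, e⟩ := hf.1 i h1 h2
  have := Finset.mem_Icc.1 (hB hs)
  rw [e, letter_val this.1 this.2]; omega

lemma val_mid (hf : IsColumnFilling N t b B B' f) {i : ℤ}
    (h1 : t + B.card ≤ i) (h2 : i ≤ b - B'.card) : (f i).val = N := by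
  rw [hf.2.1 i h1 h2, letterZero_val]

lemma val_bottom (hf : IsColumnFilling N t b B B' f) (hB' : B' ⊆ Finset.Icc 1 N) {i : ℤ}
    (h1 : b - B'.card < i) (h2 : i ≤ b) : N < (f i).val := by
  obtain ⟨s, hs, -, e⟩ := hf.2.2 i h1 h2
  have := Finset.mem_Icc.1 (hB' hs)
  rw [e, letterBar_val this.1 this.2]; omega

lemma top_subset (hf : IsColumnFilling N t b B B' f) (hB : B ⊆ Finset.Icc 1 N)
    (hc : (B.card : ℤ) + B'.card ≤ b - t + 1) {C C' : Finset ℕ}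
    (hg : IsColumnFilling N t b C C' f) (hC : C ⊆ Finset.Icc 1 N) (hC' : C' ⊆ Finset.Icc 1 N) :
    B ⊆ C := by
  intro s hs
  have p := cnt_pos hs
  have q := cnt_le_card B s
  have hs' := Finset.mem_Icc.1 (hB hs)
  obtain ⟨s1, hs1, e1, e2⟩ := hf.1 (t + cnt B s - 1) (by omega) (by omega)
  obtain rfl : s1 = s := cnt_inj hs1 hs (by omega)
  have hv : (f (t + cnt B s1 - 1)).val < N := hf.val_top hB (by omega) (by omega)
  by_cases h : t + cnt B s1 - 1 < t + (C.card : ℤ)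
  · obtain ⟨s2, hs2, -, e3⟩ := hg.1 _ (by omega) h
    have hs2' := Finset.mem_Icc.1 (hC hs2)
    have := congrArg Fin.val (e2.symm.trans e3)
    rw [letter_val hs'.1 hs'.2, letter_val hs2'.1 hs2'.2] at this
    obtain rfl : s1 = s2 := by omega
    exact hs2
  · by_cases h' : t + cnt B s1 - 1 ≤ b - (C'.card : ℤ)
    · have := hg.val_mid (by omega) h'; omega
    · have := hg.val_bottom hC' (i := t + cnt B s1 - 1) (by omega) (by omega); omega

lemma bottom_subset (hf : IsColumnFilling N t b B B' f) (hB' : B' ⊆ Finset.Icc 1 N)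
    (hc : (B.card : ℤ) + B'.card ≤ b - t + 1) {C C' : Finset ℕ}
    (hg : IsColumnFilling N t b C C' f) (hC : C ⊆ Finset.Icc 1 N) (hC' : C' ⊆ Finset.Icc 1 N) :
    B' ⊆ C' := by
  intro s hs
  have p := cnt_pos hs
  have q := cnt_le_card B' s
  have hs' := Finset.mem_Icc.1 (hB' hs)
  obtain ⟨s1, hs1, e1, e2⟩ := hf.2.2 (b - cnt B' s + 1) (by omega) (by omega)
  obtain rfl : s1 = s := cnt_inj hs1 hs (by omega)
  have hv : N < (f (b - cnt B' s1 + 1)).val := hf.val_bottom hB' (by omega) (by omega)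
  by_cases h : b - (C'.card : ℤ) < b - cnt B' s1 + 1
  · obtain ⟨s2, hs2, -, e3⟩ := hg.2.2 _ h (by omega)
    have hs2' := Finset.mem_Icc.1 (hC' hs2)
    have := congrArg Fin.val (e2.symm.trans e3)
    rw [letterBar_val hs'.1 hs'.2, letterBar_val hs2'.1 hs2'.2] at this
    obtain rfl : s1 = s2 := by omega
    exact hs2
  · by_cases h' : t + (C.card : ℤ) ≤ b - cnt B' s1 + 1
    · have := hg.val_mid h' (by omega); omega
    · have := hg.val_top hC (i := b - cnt B' s1 + 1) (by omega) (by omega); omega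

end IsColumnFilling

/-- The vertical rule for the function `f` on the rows `t, …, b`. -/
def VerticalRule (N : ℕ) (t b : ℤ) (f : ℤ → Letter N) : Prop :=
  ∀ i, t ≤ i → i < b → f i < f (i + 1) ∨ (f i = letterZero N ∧ f (i + 1) = letterZero N)

lemma VerticalRule.lt {N : ℕ} {t b : ℤ} {f : ℤ → Letter N} (hf : VerticalRule N t b f) {i : ℤ}
    (hi : t ≤ i) (n : ℕ) (hn : i + (n + 1 : ℕ) ≤ b) :
    f i < f (i + (n + 1 : ℕ)) ∨ (f i = letterZero N ∧ f (i + (n + 1 : ℕ)) = letterZero N) := by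
  induction n with
  | zero => simpa using hf i hi (by push_cast at hn; omega)
  | succ n ih =>
    have h1 := ih (by push_cast at hn ⊢; omega)
    have h2 := hf (i + (n + 1 : ℕ)) (by omega) (by push_cast at hn ⊢; omega)
    have e : i + ((n + 1 : ℕ) : ℤ) + 1 = i + ((n + 1 + 1 : ℕ) : ℤ) := by push_cast; ring
    rw [e] at h2
    rcases h1 with h1 | h1 <;> rcases h2 with h2 | h2
    · exact Or.inl (h1.trans h2)
    · left; rw [h2.2, ← h2.1]; exact h1
    · left; rw [h1.1, ← h1.2]; exact h2
    · exact Or.inr ⟨h1.1, h2.2⟩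

lemma VerticalRule.lt' {N : ℕ} {t b : ℤ} {f : ℤ → Letter N} (hf : VerticalRule N t b f) {i i' : ℤ}
    (hi : t ≤ i) (h : i < i') (h' : i' ≤ b) :
    f i < f i' ∨ (f i = letterZero N ∧ f i' = letterZero N) := by
  have e : i + ((i' - i - 1).toNat + 1 : ℕ) = i' := by push_cast; omega
  have := hf.lt hi (i' - i - 1).toNat (by omega)
  rwa [e] at this

lemma VerticalRule.exists_top {N : ℕ} {t b : ℤ} {f : ℤ → Letter N} (hf : VerticalRule N t b f)
    (htb : t ≤ b) :
    ∃ B ⊆ Finset.Icc 1 N, (B.card : ℤ) ≤ b - t + 1 ∧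
      (∀ i, t ≤ i → i ≤ b → ((f i).val < N ↔ i < t + B.card)) ∧
      ∀ i, t ≤ i → i < t + B.card → ∃ s ∈ B, (cnt B s : ℤ) = i - t + 1 ∧ f i = letter N s := by
  classical
  set B := (Finset.Icc 1 N).filter (fun s => ∃ i ∈ Finset.Icc t b, f i = letter N s) with hBdef
  have hB : B ⊆ Finset.Icc 1 N := Finset.filter_subset _ _
  have hz := letterZero_val N
  have hmem : ∀ i, t ≤ i → i ≤ b → (f i).val < N → (f i).val + 1 ∈ B := by
    intro i h1 h2 h
    rw [hBdef, Finset.mem_filter, Finset.mem_Icc]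
    refine ⟨⟨by omega, by omega⟩, i, Finset.mem_Icc.2 ⟨h1, h2⟩, Fin.ext ?_⟩
    rw [letter_val (by omega) (by omega)]; omega
  have hsub : ∀ s ∈ B, ∃ i, t ≤ i ∧ i ≤ b ∧ s = (f i).val + 1 := by
    intro s hs
    rw [hBdef, Finset.mem_filter, Finset.mem_Icc] at hs
    obtain ⟨⟨h1, h2⟩, i, hi, e⟩ := hs
    rw [Finset.mem_Icc] at hi
    refine ⟨i, hi.1, hi.2, ?_⟩
    rw [e, letter_val h1 h2]; omega
  have hbound : (B.card : ℤ) ≤ b - t + 1 := by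
    have : B ⊆ (Finset.Icc t b).image (fun i => (f i).val + 1) := by
      intro s hs
      obtain ⟨i, h1, h2, e⟩ := hsub s hs
      exact Finset.mem_image.2 ⟨i, Finset.mem_Icc.2 ⟨h1, h2⟩, e.symm⟩
    have h2 := (Finset.card_le_card this).trans Finset.card_image_le
    rw [Int.card_Icc] at h2; omega
  have hcnt : ∀ i, t ≤ i → i ≤ b → (f i).val < N → (cnt B ((f i).val + 1) : ℤ) = i - t + 1 := by
    intro i h1 h2 h
    have : cnt B ((f i).val + 1) = (Finset.Icc t i).card := by
      symm
      unfold cnt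
      have hlt : ∀ a, t ≤ a → a < i → f a < f i := by
        intro a ha hai
        rcases hf.lt' ha hai h2 with h' | h'
        · exact h'
        · have := congrArg Fin.val h'.2; omega
      refine Finset.card_bij (fun a _ => (f a).val + 1) ?_ ?_ ?_
      · intro a ha
        rw [Finset.mem_Icc] at ha
        rw [Finset.mem_filter]
        have hle : (f a).val ≤ (f i).val := by
          rcases lt_or_eq_of_le ha.2 with h' | h'
          · exact le_of_lt (hlt a ha.1 h')
          · rw [h']
        exact ⟨hmem a ha.1 (by omega) (by omega), by omega⟩
      · intro a ha a' ha' e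
        rw [Finset.mem_Icc] at ha ha'
        simp only [Nat.add_right_cancel_iff] at e
        rcases lt_trichotomy a a' with h' | h' | h'
        · rcases hf.lt' ha.1 h' (by omega) with h3 | h3
          · rw [Fin.lt_def] at h3; omega
          · rcases lt_or_eq_of_le ha'.2 with h4 | h4
            · have := hlt a' ha'.1 h4
              rw [Fin.lt_def, h3.2] at this; omega
            · rw [h4] at h3; have := congrArg Fin.val h3.2; omega
        · exact h'
        · rcases hf.lt' ha'.1 h' (by omega) with h3 | h3
          · rw [Fin.lt_def] at h3; omega
          · rcases lt_or_eq_of_le ha.2 with h4 | h4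
            · have := hlt a ha.1 h4
              rw [Fin.lt_def, h3.2] at this; omega
            · rw [h4] at h3; have := congrArg Fin.val h3.2; omega
      · intro s hs
        rw [Finset.mem_filter] at hs
        obtain ⟨a, ha1, ha2, rfl⟩ := hsub s hs.1
        refine ⟨a, Finset.mem_Icc.2 ⟨ha1, ?_⟩, rfl⟩
        by_contra hn
        rcases hf.lt' h1 (by omega : i < a) ha2 with h3 | h3
        · rw [Fin.lt_def] at h3; omega
        · have := congrArg Fin.val h3.1; omega
    rw [this, Int.card_Icc]; omega
  have hiff : ∀ i, t ≤ i → i ≤ b → ((f i).val < N ↔ i < t + B.card) := by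
    intro i h1 h2
    constructor
    · intro h
      have := hcnt i h1 h2 h
      have := cnt_le_card B ((f i).val + 1)
      omega
    · intro h
      by_contra hn
      have : B ⊆ (Finset.Ico t i).image (fun i => (f i).val + 1) := by
        intro s hs
        obtain ⟨a, ha1, ha2, rfl⟩ := hsub s hs
        refine Finset.mem_image.2 ⟨a, Finset.mem_Ico.2 ⟨ha1, ?_⟩, rfl⟩
        by_contra hia
        have hsN := (Finset.mem_Icc.1 (hB hs)).2
        rcases lt_or_eq_of_le (not_lt.1 hia) with h4 | h4
        · rcases hf.lt' h1 h4 ha2 with h3 | h3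
          · rw [Fin.lt_def] at h3; omega
          · have := congrArg Fin.val h3.2; omega
        · rw [h4] at hn; omega
      have h2 := (Finset.card_le_card this).trans Finset.card_image_le
      rw [Int.card_Ico] at h2; omega
  refine ⟨B, hB, hbound, hiff, fun i h1 h2 => ?_⟩
  have h := (hiff i h1 (by omega)).2 h2
  refine ⟨_, hmem i h1 (by omega) h, hcnt i h1 (by omega) h, Fin.ext ?_⟩
  rw [letter_val (by omega) (by omega)]; omega

lemma VerticalRule.exists_filling {N : ℕ} {t b : ℤ} {f : ℤ → Letter N}
    (hf : VerticalRule N t b f) (htb : t ≤ b) :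
    ∃ B ⊆ Finset.Icc 1 N, ∃ B' ⊆ Finset.Icc 1 N, (B.card : ℤ) + B'.card ≤ b - t + 1 ∧
      IsColumnFilling N t b B B' f := by
  have hz := letterZero_val N
  have hrev : ∀ a : Letter N, (Fin.rev a).val = 2 * N - a.val := by
    intro a; rw [Fin.val_rev]; omega
  -- Reversing the column and the alphabet exchanges the letters `s` and `s̄`.
  have hg : VerticalRule N (-b) (-t) (fun i => Fin.rev (f (-i))) := by
    intro i h1 h2
    have := hf (-i - 1) (by omega) (by omega)
    rw [show -i - 1 + 1 = -i by ring] at this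
    beta_reduce
    rw [show -(i + 1) = -i - 1 by ring]
    rcases this with h | h
    · left; rw [Fin.lt_def, hrev, hrev]; rw [Fin.lt_def] at h; omega
    · right
      constructor
      · apply Fin.ext; rw [hrev, h.2]; omega
      · apply Fin.ext; rw [hrev, h.1]; omega
  obtain ⟨B, hB, hBc, hB1, hB2⟩ := hf.exists_top htb
  obtain ⟨B', hB', hBc', hB1', hB2'⟩ := hg.exists_top (by omega)
  have hbar : ∀ i, t ≤ i → i ≤ b → (N < (f i).val ↔ b - B'.card < i) := by
    intro i h1 h2
    have := hB1' (-i) (by omega) (by omega)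
    rw [hrev, neg_neg] at this
    have := (f i).isLt
    constructor <;> intro h <;> omega
  refine ⟨B, hB, B', hB', ?_, hB2, fun i h1 h2 => ?_, fun i h1 h2 => ?_⟩
  · by_contra hn
    have h1 := (hB1 (b - B'.card + 1) (by omega) (by omega)).2 (by omega)
    have h2 := (hbar (b - B'.card + 1) (by omega) (by omega)).2 (by omega)
    omega
  · apply Fin.ext
    have h3 := (hB1 i (by omega) (by omega)).not
    have h4 := (hbar i (by omega) (by omega)).not
    omega
  · obtain ⟨s, hs, e, e'⟩ := hB2' (-i) (by omega) (by omega)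
    refine ⟨s, hs, by omega, ?_⟩
    have hs' := Finset.mem_Icc.1 (hB' hs)
    have := congrArg Fin.val e'
    rw [hrev, neg_neg, letter_val hs'.1 hs'.2] at this
    apply Fin.ext
    have := (f i).isLt
    rw [letterBar_val hs'.1 hs'.2]; omega

/-! ### The tableau rules in terms of the sets of letters of the columns -/

/-- `T` is filled, column by column, by the letters `s ∈ B j` and `s̄`, `s ∈ B' j`, and by zeros. -/
def IsFilling (N : ℕ) (D : Finset (ℤ × ℕ)) (B B' : ℕ → Finset ℕ) (T : {x // x ∈ D} → Letter N) :
    Prop :=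
  ∀ j ∈ nonemptyColumns D,
    IsColumnFilling N (topRow D j) (bottomRow D j) (B j) (B' j) (colFun D T j)

lemma mem_tableaux_iff {N : ℕ} {D : Finset (ℤ × ℕ)} (hD : IsSkewDiagram D)
    {T : {x // x ∈ D} → Letter N} :
    T ∈ tableaux N D ↔
      (∀ i j, (i, j) ∈ D → (i, j + 1) ∈ D → colFun D T j i ≤ colFun D T (j + 1) i ∧
        ¬ (colFun D T j i = letterZero N ∧ colFun D T (j + 1) i = letterZero N)) ∧
      ∀ j ∈ nonemptyColumns D,
        VerticalRule N (topRow D j) (bottomRow D j) (colFun D T j) := by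
  constructor
  · rintro ⟨h1, h2⟩
    refine ⟨fun i j h h' => ?_, fun j hj i hi hi' => ?_⟩
    · rw [colFun_eq _ h, colFun_eq _ h']; exact h1 i j h h'
    · have h := (hD.mem_iff hj).2 ⟨hi, hi'.le⟩
      have h' : (i + 1, j) ∈ D := (hD.mem_iff hj).2 ⟨by omega, by omega⟩
      rw [colFun_eq _ h, colFun_eq _ h']; exact h2 i j h h'
  · rintro ⟨h1, h2⟩
    refine ⟨fun i j h h' => ?_, fun i j h h' => ?_⟩
    · have := h1 i j h h'
      rwa [colFun_eq _ h, colFun_eq _ h'] at this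
    · have hj := mem_nonemptyColumns.2 ⟨i, h⟩
      have := h2 j hj i (topRow_le h) (by have := le_bottomRow h'; omega)
      rwa [colFun_eq _ h, colFun_eq _ h'] at this

lemma exists_isFilling {N : ℕ} {D : Finset (ℤ × ℕ)} (hD : IsSkewDiagram D)
    {T : {x // x ∈ D} → Letter N} (hT : T ∈ tableaux N D) :
    ∃ B B' : ℕ → Finset ℕ, (∀ j, B j ⊆ Finset.Icc 1 N) ∧ (∀ j, B' j ⊆ Finset.Icc 1 N) ∧
      (∀ j ∈ nonemptyColumns D,
        ((B j).card : ℤ) + (B' j).card ≤ bottomRow D j - topRow D j + 1) ∧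
      IsFilling N D B B' T := by
  have h : ∀ j, ∃ B B' : Finset ℕ, B ⊆ Finset.Icc 1 N ∧ B' ⊆ Finset.Icc 1 N ∧
      (j ∈ nonemptyColumns D → ((B.card : ℤ) + B'.card ≤ bottomRow D j - topRow D j + 1 ∧
        IsColumnFilling N (topRow D j) (bottomRow D j) B B' (colFun D T j))) := by
    intro j
    by_cases hj : j ∈ nonemptyColumns D
    · obtain ⟨B, hB, B', hB', h1, h2⟩ :=
        (((mem_tableaux_iff hD).1 hT).2 j hj).exists_filling (topRow_le_bottomRow hj)
      exact ⟨B, B', hB, hB', fun _ => ⟨h1, h2⟩⟩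
    · exact ⟨∅, ∅, by simp, by simp, fun h => absurd h hj⟩
  choose B B' h1 h2 h3 using h
  exact ⟨B, B', h1, h2, fun j hj => (h3 j hj).1, fun j hj => (h3 j hj).2⟩

lemma IsFilling.unique {N : ℕ} {D : Finset (ℤ × ℕ)} {B B' : ℕ → Finset ℕ}
    {T T' : {x // x ∈ D} → Letter N} (h : IsFilling N D B B' T) (h' : IsFilling N D B B' T') :
    T = T' := by
  funext ⟨⟨i, j⟩, hx⟩
  have hj := mem_nonemptyColumns.2 ⟨i, hx⟩
  have := (h j hj).congr (h' j hj) (topRow_le hx) (le_bottomRow hx)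
  rwa [colFun_eq _ hx, colFun_eq _ hx] at this

/-- The weak horizontal rule holds for any two boxes of the same row of a tableau, and no row
contains two zeros. -/
lemma row_rule {N : ℕ} {D : Finset (ℤ × ℕ)} (hD : IsSkewDiagram D)
    {T : {x // x ∈ D} → Letter N} (hT : T ∈ tableaux N D) {i : ℤ} {j j' : ℕ} (hjj : j < j')
    (h : (i, j) ∈ D) (h' : (i, j') ∈ D) :
    colFun D T j i ≤ colFun D T j' i ∧
      ¬ (colFun D T j i = letterZero N ∧ colFun D T j' i = letterZero N) := by
  have h1 := ((mem_tableaux_iff hD).1 hT).1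
  have hz := letterZero_val N
  obtain ⟨n, rfl⟩ : ∃ n, j' = j + n + 1 := ⟨j' - j - 1, by omega⟩
  clear hjj
  induction n with
  | zero => exact h1 i j h h'
  | succ n ih =>
    have hm : (i, j + n + 1) ∈ D := hD.between h h' le_rfl le_rfl (by omega) (by omega)
    have a := ih hm
    have b := h1 i (j + n + 1) hm h'
    refine ⟨a.1.trans b.1, fun hc => ?_⟩
    have e : colFun D T (j + n + 1) i = letterZero N :=
      le_antisymm (hc.2 ▸ b.1) (hc.1 ▸ a.1)
    exact a.2 ⟨hc.1, e⟩

section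

variable {N : ℕ} {D : Finset (ℤ × ℕ)} {B B' : ℕ → Finset ℕ} {T : {x // x ∈ D} → Letter N}

/-- In a tableau, the boxes of column `j'` that lie below all letters `1, …, N` of an earlier column
`j` contain barred letters. -/
lemma card_add_card_of_mem_tableaux (hD : IsSkewDiagram D) (hB : ∀ j, B j ⊆ Finset.Icc 1 N)
    (hB' : ∀ j, B' j ⊆ Finset.Icc 1 N)
    (hc : ∀ j ∈ nonemptyColumns D,
      ((B j).card : ℤ) + (B' j).card ≤ bottomRow D j - topRow D j + 1)
    (hF : IsFilling N D B B' T) (hT : T ∈ tableaux N D) {j j' : ℕ} (hj : j ∈ nonemptyColumns D)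
    (hj' : j' ∈ nonemptyColumns D) (hjj : j < j') :
    bottomRow D j' - topRow D j + 1 ≤ (B j).card + (B' j').card := by
  have tt := hD.topRow_anti hj hj' hjj.le
  have bb := hD.bottomRow_anti hj hj' hjj.le
  have c := hc j hj
  have c' := hc j' hj'
  have hz := letterZero_val N
  by_contra hn
  have m1 : (topRow D j + (B j).card, j) ∈ D := (hD.mem_iff hj).2 ⟨by omega, by omega⟩
  have m2 : (topRow D j + (B j).card, j') ∈ D := (hD.mem_iff hj').2 ⟨by omega, by omega⟩
  obtain ⟨r1, r2⟩ := row_rule hD hT hjj m1 m2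
  have v1 : N ≤ (colFun D T j (topRow D j + (B j).card)).val := by
    by_cases h : topRow D j + ((B j).card : ℤ) ≤ bottomRow D j - (B' j).card
    · exact ((hF j hj).val_mid le_rfl h).ge
    · exact ((hF j hj).val_bottom (hB' j) (by omega) (le_bottomRow m1)).le
  have v2 : (colFun D T j' (topRow D j + (B j).card)).val ≤ N := by
    by_cases h : topRow D j' + ((B j').card : ℤ) ≤ topRow D j + (B j).card
    · exact ((hF j' hj').val_mid h (by omega)).le
    · exact ((hF j' hj').val_top (hB j') (by omega) (by omega)).le
  rw [Fin.le_def] at r1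
  exact r2 ⟨Fin.ext (by omega), Fin.ext (by omega)⟩

lemma cnt_top_of_mem_tableaux (hD : IsSkewDiagram D) (hB : ∀ j, B j ⊆ Finset.Icc 1 N)
    (hB' : ∀ j, B' j ⊆ Finset.Icc 1 N)
    (hc : ∀ j ∈ nonemptyColumns D,
      ((B j).card : ℤ) + (B' j).card ≤ bottomRow D j - topRow D j + 1)
    (hF : IsFilling N D B B' T) (hT : T ∈ tableaux N D) {j j' : ℕ} (hj : j ∈ nonemptyColumns D)
    (hj' : j' ∈ nonemptyColumns D) (hjj : j < j') (r : ℕ) :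
    (cnt (B j') r : ℤ) ≤ cnt (B j) r + (topRow D j - topRow D j') := by
  have tt := hD.topRow_anti hj hj' hjj.le
  have bb := hD.bottomRow_anti hj hj' hjj.le
  have c := hc j hj
  have c' := hc j' hj'
  by_contra hn
  have hr := cnt_le_card (B j') r
  obtain ⟨s', hs', es'⟩ := exists_cnt_eq (hB j') (n := cnt (B j') r - 1)
    (by rw [cnt_top (hB j')]; omega)
  -- the box of column `j'` containing the largest letter that is at most `r`
  set i := topRow D j' + (cnt (B j') r : ℤ) - 1 with hi
  obtain ⟨s, hs, es, e⟩ := (hF j' hj').1 i (by omega) (by omega)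
  obtain rfl : s = s' := cnt_inj hs hs' (by omega)
  have hsr : s ≤ r := by
    by_contra h
    have := cnt_lt (by omega : r < s) hs
    omega
  have m1 : (i, j') ∈ D := (hD.mem_iff hj').2 ⟨by omega, by omega⟩
  have m2 : (i, j) ∈ D := (hD.mem_iff hj).2 ⟨by omega, by omega⟩
  have r1 := (row_rule hD hT hjj m2 m1).1
  have hs1 := Finset.mem_Icc.1 (hB j' hs)
  rw [e, Fin.le_def, letter_val hs1.1 hs1.2] at r1
  by_cases h : i < topRow D j + (B j).card
  · obtain ⟨q, hq, eq, eq'⟩ := (hF j hj).1 i (by omega) h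
    have hq1 := Finset.mem_Icc.1 (hB j hq)
    rw [eq', letter_val hq1.1 hq1.2] at r1
    have := cnt_mono (B j) (show q ≤ r by omega)
    omega
  · by_cases h' : i ≤ bottomRow D j - (B' j).card
    · have := (hF j hj).val_mid (by omega) h'; omega
    · have := (hF j hj).val_bottom (hB' j) (i := i) (by omega) (by omega); omega

lemma cnt_bottom_of_mem_tableaux (hD : IsSkewDiagram D) (hB : ∀ j, B j ⊆ Finset.Icc 1 N)
    (hB' : ∀ j, B' j ⊆ Finset.Icc 1 N)
    (hc : ∀ j ∈ nonemptyColumns D,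
      ((B j).card : ℤ) + (B' j).card ≤ bottomRow D j - topRow D j + 1)
    (hF : IsFilling N D B B' T) (hT : T ∈ tableaux N D) {j j' : ℕ} (hj : j ∈ nonemptyColumns D)
    (hj' : j' ∈ nonemptyColumns D) (hjj : j < j') (r : ℕ) :
    (cnt (B' j) r : ℤ) ≤ cnt (B' j') r + (bottomRow D j - bottomRow D j') := by
  have tt := hD.topRow_anti hj hj' hjj.le
  have bb := hD.bottomRow_anti hj hj' hjj.le
  have c := hc j hj
  have c' := hc j' hj'
  by_contra hn
  have hr := cnt_le_card (B' j) r
  obtain ⟨s', hs', es'⟩ := exists_cnt_eq (hB' j) (n := cnt (B' j) r - 1)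
    (by rw [cnt_top (hB' j)]; omega)
  set i := bottomRow D j - (cnt (B' j) r : ℤ) + 1 with hi
  obtain ⟨s, hs, es, e⟩ := (hF j hj).2.2 i (by omega) (by omega)
  obtain rfl : s = s' := cnt_inj hs hs' (by omega)
  have hsr : s ≤ r := by
    by_contra h
    have := cnt_lt (by omega : r < s) hs
    omega
  have m1 : (i, j) ∈ D := (hD.mem_iff hj).2 ⟨by omega, by omega⟩
  have m2 : (i, j') ∈ D := (hD.mem_iff hj').2 ⟨by omega, by omega⟩
  have r1 := (row_rule hD hT hjj m1 m2).1
  have hs1 := Finset.mem_Icc.1 (hB' j hs)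
  rw [e, Fin.le_def, letterBar_val hs1.1 hs1.2] at r1
  by_cases h : bottomRow D j' - (B' j').card < i
  · obtain ⟨q, hq, eq, eq'⟩ := (hF j' hj').2.2 i h (by omega)
    have hq1 := Finset.mem_Icc.1 (hB' j' hq)
    rw [eq', letterBar_val hq1.1 hq1.2] at r1
    have := cnt_mono (B' j') (show q ≤ r by omega)
    omega
  · by_cases h' : topRow D j' + (B j').card ≤ i
    · have := (hF j' hj').val_mid (i := i) (by omega) (by omega); omega
    · have := (hF j' hj').val_top (hB j') (i := i) (by omega) (by omega); omega

/-- The inequalities between the sets of letters of adjacent columns that correspond to the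
horizontal rule. -/
lemma mem_tableaux_of_le (hD : IsSkewDiagram D) (hB : ∀ j, B j ⊆ Finset.Icc 1 N)
    (hB' : ∀ j, B' j ⊆ Finset.Icc 1 N)
    (hc : ∀ j ∈ nonemptyColumns D,
      ((B j).card : ℤ) + (B' j).card ≤ bottomRow D j - topRow D j + 1)
    (hF : IsFilling N D B B' T)
    (h1 : ∀ j ∈ nonemptyColumns D, j + 1 ∈ nonemptyColumns D → ∀ r < N,
      (cnt (B (j + 1)) r : ℤ) ≤ cnt (B j) r + (topRow D j - topRow D (j + 1)))
    (h2 : ∀ j ∈ nonemptyColumns D, j + 1 ∈ nonemptyColumns D → ∀ r < N,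
      (cnt (B' j) r : ℤ) ≤ cnt (B' (j + 1)) r + (bottomRow D j - bottomRow D (j + 1)))
    (h3 : ∀ j ∈ nonemptyColumns D, j + 1 ∈ nonemptyColumns D →
      bottomRow D (j + 1) - topRow D j + 1 ≤ (B j).card + (B' (j + 1)).card) :
    T ∈ tableaux N D := by
  have hz := letterZero_val N
  rw [mem_tableaux_iff hD]
  constructor
  · intro i j m m'
    have hj := mem_nonemptyColumns.2 ⟨i, m⟩
    have hj' := mem_nonemptyColumns.2 ⟨i, m'⟩
    have c := hc j hj
    have c' := hc _ hj'
    have F := hF j hj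
    have F' := hF _ hj'
    have a1 := h1 j hj hj'
    have a2 := h2 j hj hj'
    have a3 := h3 j hj hj'
    have i1 := topRow_le m
    have i2 := le_bottomRow m
    have i1' := topRow_le m'
    have i2' := le_bottomRow m'
    suffices hs : (colFun D T j i).val ≤ (colFun D T (j + 1) i).val ∧
        ¬ ((colFun D T j i).val = N ∧ (colFun D T (j + 1) i).val = N) by
      refine ⟨hs.1, fun h => hs.2 ?_⟩
      rw [h.1, h.2]; exact ⟨hz, hz⟩
    by_cases hi : i < topRow D j + (B j).card
    · have v := F.val_top (hB j) i1 hi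
      by_cases hi' : i < topRow D (j + 1) + (B (j + 1)).card
      · refine ⟨?_, by omega⟩
        obtain ⟨s, hs, e1, e2⟩ := F.1 i i1 hi
        obtain ⟨s', hs', e1', e2'⟩ := F'.1 i i1' hi'
        have hsI := Finset.mem_Icc.1 (hB _ hs)
        have hsI' := Finset.mem_Icc.1 (hB _ hs')
        rw [e2, e2', letter_val hsI.1 hsI.2, letter_val hsI'.1 hsI'.2]
        by_contra hlt
        have := a1 s' (by omega)
        have := cnt_lt (show s' < s by omega) hs
        omega
      · by_cases hi2 : i ≤ bottomRow D (j + 1) - (B' (j + 1)).card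
        · have := F'.val_mid (by omega) hi2; omega
        · have := F'.val_bottom (hB' _) (i := i) (by omega) i2'; omega
    · have v' := F'.val_bottom (hB' _) (i := i) (by omega) i2'
      refine ⟨?_, by omega⟩
      by_cases hi2 : i ≤ bottomRow D j - (B' j).card
      · have := F.val_mid (by omega) hi2; omega
      · obtain ⟨s, hs, e1, e2⟩ := F.2.2 i (by omega) i2
        obtain ⟨s', hs', e1', e2'⟩ := F'.2.2 i (by omega) i2'
        have hsI := Finset.mem_Icc.1 (hB' _ hs)
        have hsI' := Finset.mem_Icc.1 (hB' _ hs')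
        rw [e2, e2', letterBar_val hsI.1 hsI.2, letterBar_val hsI'.1 hsI'.2]
        by_contra hlt
        have := a2 s (by omega)
        have := cnt_lt (show s < s' by omega) hs'
        omega
  · intro j hj i i1 i2
    have c := hc j hj
    have F := hF j hj
    by_cases hA : i + 1 < topRow D j + (B j).card
    · left
      obtain ⟨s, hs, e1, e2⟩ := F.1 i i1 (by omega)
      obtain ⟨s', hs', e1', e2'⟩ := F.1 (i + 1) (by omega) hA
      rw [e2, e2', letter_lt_letter (hB _ hs) (hB _ hs')]
      by_contra hlt
      have := cnt_mono (B j) (show s' ≤ s by omega)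
      omega
    · by_cases hA' : i < topRow D j + (B j).card
      · left
        have v := F.val_top (hB j) i1 hA'
        rw [Fin.lt_def]
        by_cases hi2 : i + 1 ≤ bottomRow D j - (B' j).card
        · have := F.val_mid (by omega) hi2; omega
        · have := F.val_bottom (hB' j) (i := i + 1) (by omega) (by omega); omega
      · by_cases hC : bottomRow D j - (B' j).card < i
        · left
          obtain ⟨s, hs, e1, e2⟩ := F.2.2 i hC (by omega)
          obtain ⟨s', hs', e1', e2'⟩ := F.2.2 (i + 1) (by omega) (by omega)
          rw [e2, e2', letterBar_lt_letterBar (hB' _ hs) (hB' _ hs')]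
          by_contra hlt
          have := cnt_mono (B' j) (show s ≤ s' by omega)
          omega
        · by_cases hC' : bottomRow D j - (B' j).card < i + 1
          · left
            have := F.val_mid (i := i) (by omega) (by omega)
            have := F.val_bottom (hB' j) (i := i + 1) (by omega) (by omega)
            rw [Fin.lt_def]; omega
          · right
            exact ⟨F.2.1 i (by omega) (by omega), F.2.1 (i + 1) (by omega) (by omega)⟩

end

lemma tableauMonomial_eq {N : ℕ} {D : Finset (ℤ × ℕ)} (hD : IsSkewDiagram D)
    (T : {x // x ∈ D} → Letter N) :
    tableauMonomial N D T = ∏ j ∈ nonemptyColumns D,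
      ∏ i ∈ Finset.Icc (topRow D j) (bottomRow D j),
        boxMonomial N (colFun D T j i) (4 * ((j : ℤ) - i)) := by
  have h1 : tableauMonomial N D T =
      ∏ x ∈ D, boxMonomial N (colFun D T x.2 x.1) (4 * ((x.2 : ℤ) - x.1)) := by
    rw [tableauMonomial, ← Finset.prod_coe_sort D]
    refine Finset.prod_congr rfl fun x _ => ?_
    rw [colFun_eq T x.2]
  rw [h1, ← Finset.prod_fiberwise_of_maps_to (g := Prod.snd) (t := nonemptyColumns D)
    (fun x hx => Finset.mem_image_of_mem _ hx)]
  refine Finset.prod_congr rfl fun j hj => ?_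
  rw [← hD.column_eq hj, column, Finset.prod_image]
  · refine Finset.prod_congr rfl fun x hx => ?_
    rw [(Finset.mem_filter.1 hx).2]
  · intro a ha b hb h
    exact Prod.ext h ((Finset.mem_filter.1 ha).2.trans (Finset.mem_filter.1 hb).2.symm)

/-- The monomial of a filling is a product of monomials of spin paths, two for each column. -/
theorem IsFilling.tableauMonomial_eq {N : ℕ} {D : Finset (ℤ × ℕ)} (hD : IsSkewDiagram D)
    {B B' : ℕ → Finset ℕ} {T : {x // x ∈ D} → Letter N} (hB : ∀ j, B j ⊆ Finset.Icc 1 N)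
    (hB' : ∀ j, B' j ⊆ Finset.Icc 1 N)
    (hc : ∀ j ∈ nonemptyColumns D,
      ((B j).card : ℤ) + (B' j).card ≤ bottomRow D j - topRow D j + 1)
    (hF : IsFilling N D B B' T) :
    tableauMonomial N D T = ∏ j ∈ nonemptyColumns D,
      (spinMonomial N (4 * (j - topRow D j) - 2 * N + 3) (B j) *
        spinMonomial N (4 * (j - bottomRow D j) + 2 * N - 3) (Finset.Icc 1 N \ B' j)) := by
  rw [_root_.tableauMonomial_eq hD]
  exact Finset.prod_congr rfl fun j hj => prod_column (hB j) (hB' j) (hc j hj) (hF j hj)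

/-! ### Chains of spin nodes -/

/-- A chain of indices `κ m`, `m ∈ S`, of sets `𝒫_{N,κ m}` of spin paths. The paths with even and
with odd `m` start on opposite sides (`mod_four`), `κ` is increasing on each side
(`lt_of_even_sub`), and an inversion `κ m' < κ m` with `m < m'` is only possible if `m + 1` and
`m' - 1` belong to `S` as well (`lt_of_gap`). The bound `sub_le` on the inversions of neighbours
says that the node `(i, k)` they form has `1 ≤ i`. -/
structure IsSpinChain (N : ℕ) (S : Finset ℕ) (κ : ℕ → ℤ) : Prop where
  lt_of_even_sub : ∀ m ∈ S, ∀ m' ∈ S, m < m' → m % 2 = m' % 2 → κ m < κ m'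
  mod_four : ∀ m, κ m % 4 = (2 * N + 1 + 2 * m) % 4
  lt_of_gap : ∀ m ∈ S, ∀ m' ∈ S, m < m' → m % 2 ≠ m' % 2 → (m + 1 ∉ S ∨ m' - 1 ∉ S) → κ m < κ m'
  sub_le : ∀ m ∈ S, m + 1 ∈ S → κ m - κ (m + 1) ≤ 4 * N - 6

/-- The spin paths with index `m` and `m + 1` are the two halves of one path. -/
def Merged (S : Finset ℕ) (κ : ℕ → ℤ) (m : ℕ) : Prop := m ∈ S ∧ m + 1 ∈ S ∧ κ (m + 1) < κ m

instance (S : Finset ℕ) (κ : ℕ → ℤ) : DecidablePred (Merged S κ) := fun _ =>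
  inferInstanceAs (Decidable (_ ∧ _ ∧ _))

/-- The set of nodes of the snake of a spin chain. A node `(i, k)` with `i < N` stands for two
neighbouring elements of `S` and is labelled by the larger one. -/
def chainNodes (S : Finset ℕ) (κ : ℕ → ℤ) : Finset ℕ := S.filter fun m => ¬ Merged S κ m

/-- The element `(i, k)` of `𝒳` belonging to a node. For a node standing for `m - 1` and `m` it is
the solution of `k - (2N - 2i - 1) = κ m`, `k + (2N - 2i - 1) = κ (m - 1)`. -/
def nodeKey (N : ℕ) (S : Finset ℕ) (κ : ℕ → ℤ) (m : ℕ) : ℕ × ℤ :=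
  if Merged S κ (m - 1) then
    (((4 * N - 2 - (κ (m - 1) - κ m)) / 4).toNat, (κ (m - 1) + κ m) / 2)
  else (N, κ m)

/-- The path belonging to a node, for a given family of sets of descents. -/
def nodePath (N : ℕ) (ε : ℝ) (S : Finset ℕ) (κ : ℕ → ℤ) (E : ℕ → Finset ℕ) (m : ℕ) : Path2 :=
  if Merged S κ (m - 1) then
    spinPath N ε (κ m) (E m) ++ (spinPath N ε (κ (m - 1)) (E (m - 1))).reverse
  else spinPath N ε (κ m) (E m)

namespace IsSpinChain

variable {N : ℕ} {S : Finset ℕ} {κ : ℕ → ℤ} (hS : IsSpinChain N S κ)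
include hS

lemma odd (m : ℕ) : κ m % 2 = 1 := by have := hS.mod_four m; omega

lemma opposite {m m' : ℕ} (h : m % 2 ≠ m' % 2) : (κ m' - κ m) % 4 = 2 := by
  have := hS.mod_four m; have := hS.mod_four m'; omega

lemma same {m m' : ℕ} (h : m % 2 = m' % 2) : κ m % 4 = κ m' % 4 := by
  have := hS.mod_four m; have := hS.mod_four m'; omega

lemma not_merged_succ {m : ℕ} (h : Merged S κ m) : ¬ Merged S κ (m + 1) := by
  intro h'
  have := hS.lt_of_even_sub m h.1 (m + 1 + 1) h'.2.1 (by omega) (by omega)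
  have := h.2.2; have := h'.2.2
  omega

lemma succ_mem_nodes {m : ℕ} (h : Merged S κ m) : m + 1 ∈ chainNodes S κ :=
  Finset.mem_filter.2 ⟨h.2.1, hS.not_merged_succ h⟩

omit hS in
lemma pos_of_merged {m : ℕ} (hm : m ∈ chainNodes S κ) (h : Merged S κ (m - 1)) : 1 ≤ m := by
  by_contra h0
  obtain rfl : m = 0 := by omega
  exact (Finset.mem_filter.1 hm).2 h

lemma lt_of_node {n m : ℕ} (hn : n ∈ chainNodes S κ) (hm : m ∈ S) (h : n < m) : κ n < κ m := by
  obtain ⟨hnS, hnm⟩ := Finset.mem_filter.1 hn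
  by_cases hp : n % 2 = m % 2
  · exact hS.lt_of_even_sub n hnS m hm h hp
  · by_cases h1 : n + 1 ∈ S
    · have h2 : κ n < κ (n + 1) := by
        have h3 : ¬ κ (n + 1) < κ n := fun h3 => hnm ⟨hnS, h1, h3⟩
        have := hS.opposite (show n % 2 ≠ (n + 1) % 2 by omega)
        omega
      rcases Nat.lt_or_ge (n + 1) m with h4 | h4
      · exact h2.trans (hS.lt_of_even_sub _ h1 m hm h4 (by omega))
      · obtain rfl : m = n + 1 := by omega
        exact h2
    · exact hS.lt_of_gap n hnS m hm h hp (Or.inl h1)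

lemma lt_of_single {m n : ℕ} (hn : n ∈ S) (hn' : ¬ Merged S κ (n - 1)) (hm : m ∈ S) (h : m < n) :
    κ m < κ n := by
  by_cases hp : m % 2 = n % 2
  · exact hS.lt_of_even_sub m hm n hn h hp
  · have e : n - 1 + 1 = n := by omega
    by_cases h1 : n - 1 ∈ S
    · have h2 : κ (n - 1) < κ n := by
        have h3 : ¬ κ n < κ (n - 1) := fun h3 => hn' ⟨h1, by rwa [e], by rwa [e]⟩
        have := hS.opposite (show n % 2 ≠ (n - 1) % 2 by omega)
        omega
      rcases Nat.lt_or_ge m (n - 1) with h4 | h4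
      · exact (hS.lt_of_even_sub m hm _ h1 h4 (by omega)).trans h2
      · obtain rfl : m = n - 1 := by omega
        exact h2
    · exact hS.lt_of_gap m hm n hn h hp (Or.inr h1)

omit hS in
/-- The two halves of a path are later in the chain than every node before it. -/
lemma lt_pred_of_merged {n n' : ℕ} (hn : n ∈ chainNodes S κ) (hnn : n < n')
    (h' : Merged S κ (n' - 1)) : n < n' - 1 := by
  by_contra h
  obtain rfl : n = n' - 1 := by omega
  exact (Finset.mem_filter.1 hn).2 h'

lemma nodeKey_lt {n n' : ℕ} (hn : n ∈ chainNodes S κ) (hn' : n' ∈ chainNodes S κ) (h : n < n') :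
    (nodeKey N S κ n).2 < (nodeKey N S κ n').2 := by
  have nS := (Finset.mem_filter.1 hn).1
  have nS' := (Finset.mem_filter.1 hn').1
  have o1 := hS.odd n
  have o2 := hS.odd n'
  have o3 := hS.odd (n - 1)
  have o4 := hS.odd (n' - 1)
  have l1 := hS.lt_of_node hn nS' h
  unfold nodeKey
  by_cases m : Merged S κ (n - 1) <;> by_cases m' : Merged S κ (n' - 1)
  · rw [if_pos m, if_pos m']
    simp only
    have p := pos_of_merged hn m
    have q := lt_pred_of_merged hn h m'
    by_cases par : n % 2 = n' % 2
    · have := hS.lt_of_even_sub n nS n' nS' h par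
      have := hS.lt_of_even_sub (n - 1) m.1 (n' - 1) m'.1 (by omega) (by omega)
      omega
    · have := hS.lt_of_even_sub n nS (n' - 1) m'.1 q (by omega)
      have := hS.lt_of_even_sub (n - 1) m.1 n' nS' (by omega) (by omega)
      omega
  · rw [if_pos m, if_neg m']
    simp only
    have := hS.lt_of_single nS' m' m.1 (by omega)
    omega
  · rw [if_neg m, if_pos m']
    simp only
    have := hS.lt_of_node hn m'.1 (lt_pred_of_merged hn h m')
    omega
  · rw [if_neg m, if_neg m']
    exact l1

/-- The defining properties of the index of a node standing for two spin paths. -/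
lemma nodeKey_merged {m : ℕ} (hm : m ∈ chainNodes S κ) (h : Merged S κ (m - 1)) :
    1 ≤ (nodeKey N S κ m).1 ∧ (nodeKey N S κ m).1 < N ∧
      (nodeKey N S κ m).2 - (2 * N - 2 * (nodeKey N S κ m).1 - 1) = κ m ∧
      (nodeKey N S κ m).2 + (2 * N - 2 * (nodeKey N S κ m).1 - 1) = κ (m - 1) := by
  have p := pos_of_merged hm h
  have e : m - 1 + 1 = m := by omega
  have h2 := h.2.2
  have h3 := hS.sub_le (m - 1) h.1 h.2.1
  have h4 := hS.opposite (show (m - 1) % 2 ≠ m % 2 by omega)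
  have h5 := hS.odd m
  rw [e] at h2 h3
  unfold nodeKey
  rw [if_pos h]
  simp only
  refine ⟨by omega, by omega, by omega, by omega⟩

lemma prod_nodes {M : Type*} [CommMonoid M] (f : ℕ → M) :
    ∏ n ∈ chainNodes S κ, (if Merged S κ (n - 1) then f n * f (n - 1) else f n) =
      ∏ m ∈ S, f m := by
  have h1 : ∀ n ∈ chainNodes S κ, (if Merged S κ (n - 1) then f n * f (n - 1) else f n) =
      f n * if Merged S κ (n - 1) then f (n - 1) else 1 := by
    intro n _; split_ifs <;> simp
  rw [Finset.prod_congr rfl h1, Finset.prod_mul_distrib, ← Finset.prod_filter,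
    ← Finset.prod_filter_mul_prod_filter_not S (fun m => Merged S κ m), mul_comm]
  congr 1
  symm
  refine Finset.prod_bij (fun m _ => m + 1) ?_ ?_ ?_ ?_
  · intro m hm
    rw [Finset.mem_filter] at hm ⊢
    exact ⟨hS.succ_mem_nodes hm.2, hm.2⟩
  · intro a _ b _ h; exact Nat.add_right_cancel h
  · intro n hn
    rw [Finset.mem_filter] at hn
    have := pos_of_merged hn.1 hn.2
    exact ⟨n - 1, Finset.mem_filter.2 ⟨hn.2.1, hn.2⟩, by omega⟩
  · intro m _; rfl

end IsSpinChain

lemma mem_paths_iff {N : ℕ} (hN : 1 ≤ N) {ε : ℝ} (hε : 0 < ε) {i : ℕ} {k : ℤ} (hi : i ≠ N)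
    {p : Path2} :
    p ∈ paths N ε i k ↔ ∃ E ⊆ Finset.Icc 1 N, ∃ F ⊆ Finset.Icc 1 N,
      spinCtr N ε (k + (2 * N - 2 * i - 1)) F < spinCtr N ε (k - (2 * N - 2 * i - 1)) E ∧
      p = spinPath N ε (k - (2 * N - 2 * i - 1)) E ++
        (spinPath N ε (k + (2 * N - 2 * i - 1)) F).reverse := by
  have key : ∀ (k k' : ℤ) (E F : Finset ℕ), (∃ y : ℝ, 0 < y ∧
      (spinPath N ε k E).getD N 0 - (spinPath N ε k' F).getD N 0 = (0, y)) ↔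
      spinCtr N ε k' F < spinCtr N ε k E := by
    intro k k' E F
    rw [getD_spinPath _ _ _ le_rfl, getD_spinPath _ _ _ le_rfl]
    simp [spinAbscissa, spinY]
  rw [paths, if_neg hi, Set.mem_ofPred_eq]
  constructor
  · rintro ⟨a, ha, b, hb, h, rfl⟩
    obtain ⟨E, hE, rfl⟩ := (mem_spinPaths_iff hN hε).1 ha
    obtain ⟨F, hF, rfl⟩ := (mem_spinPaths_iff hN hε).1 hb
    exact ⟨E, hE, F, hF, (key _ _ _ _).1 h, rfl⟩
  · rintro ⟨E, hE, F, hF, h, rfl⟩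
    exact ⟨_, (mem_spinPaths_iff hN hε).2 ⟨E, hE, rfl⟩, _,
      (mem_spinPaths_iff hN hε).2 ⟨F, hF, rfl⟩, (key _ _ _ _).2 h, rfl⟩

/-- A family of non-overlapping spin paths along a chain. -/
def IsSpinFamily (N : ℕ) (ε : ℝ) (S : Finset ℕ) (κ : ℕ → ℤ) (E : ℕ → Finset ℕ) : Prop :=
  (∀ m, E m ⊆ Finset.Icc 1 N) ∧ ∀ m ∈ S, ∀ m' ∈ S, m < m' →
    StrictlyAbove (spinPath N ε (κ m) (E m)) (spinPath N ε (κ m') (E m'))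

/-- Families of non-overlapping paths indexed by the nodes are the same as families of
non-overlapping spin paths indexed by the chain. -/
theorem IsSpinChain.nonOverlapping_iff {N : ℕ} (hN : 1 ≤ N) {ε : ℝ} (hε : 0 < ε) {S : Finset ℕ}
    {κ : ℕ → ℤ} (hS : IsSpinChain N S κ) (P : ℕ → Path2) :
    ((∀ n ∈ chainNodes S κ, P n ∈ paths N ε (nodeKey N S κ n).1 (nodeKey N S κ n).2) ∧
      ∀ n ∈ chainNodes S κ, ∀ n' ∈ chainNodes S κ, n < n' → StrictlyAbove (P n) (P n')) ↔
    ∃ E, IsSpinFamily N ε S κ E ∧ ∀ n ∈ chainNodes S κ, P n = nodePath N ε S κ E n := by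
  have hcl : ∀ m, Merged S κ m → (κ (m + 1) - κ m) % 4 = 2 := fun m _ => hS.opposite (by omega)
  constructor
  · rintro ⟨h1, h2⟩
    have h : ∀ n, ∃ F G : Finset ℕ, F ⊆ Finset.Icc 1 N ∧ G ⊆ Finset.Icc 1 N ∧
        (n ∈ chainNodes S κ → (Merged S κ (n - 1) →
          spinCtr N ε (κ (n - 1)) G < spinCtr N ε (κ n) F ∧
          P n = spinPath N ε (κ n) F ++ (spinPath N ε (κ (n - 1)) G).reverse) ∧
          (¬ Merged S κ (n - 1) → P n = spinPath N ε (κ n) F)) := by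
      intro n
      by_cases hn : n ∈ chainNodes S κ
      · have hp := h1 n hn
        by_cases hm : Merged S κ (n - 1)
        · obtain ⟨-, e1, e2, e3⟩ := hS.nodeKey_merged hn hm
          rw [mem_paths_iff hN hε e1.ne] at hp
          rw [e2, e3] at hp
          obtain ⟨F, hF, G, hG, hlt, e⟩ := hp
          exact ⟨F, G, hF, hG, fun _ => ⟨fun _ => ⟨hlt, e⟩, fun h => absurd hm h⟩⟩
        · rw [nodeKey, if_neg hm, paths, if_pos rfl, mem_spinPaths_iff hN hε] at hp
          obtain ⟨F, hF, e⟩ := hp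
          exact ⟨F, ∅, hF, by simp, fun _ => ⟨fun h => absurd h hm, fun _ => e⟩⟩
      · exact ⟨∅, ∅, by simp, by simp, fun h => absurd h hn⟩
    choose F G hF hG hP using h
    set E : ℕ → Finset ℕ := fun m => if Merged S κ m then G (m + 1) else F m with hE
    have hEF : ∀ n ∈ chainNodes S κ, E n = F n := by
      intro n hn; simp only [hE]; rw [if_neg (Finset.mem_filter.1 hn).2]
    have hEG : ∀ n ∈ chainNodes S κ, Merged S κ (n - 1) → E (n - 1) = G n := by
      intro n hn hm
      have := IsSpinChain.pos_of_merged hn hm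
      simp only [hE]; rw [if_pos hm, Nat.sub_add_cancel this]
    have hnode : ∀ n ∈ chainNodes S κ, P n = nodePath N ε S κ E n := by
      intro n hn
      unfold nodePath
      split_ifs with hm
      · rw [((hP n hn).1 hm).2, hEF n hn, hEG n hn hm]
      · rw [(hP n hn).2 hm, hEF n hn]
    refine ⟨E, ⟨?_, ?_⟩, hnode⟩
    · intro m; simp only [hE]; split_ifs
      · exact hG _
      · exact hF _
    · -- each spin path is part of the path of the node containing it
      have hsub : ∀ m ∈ S, ∃ n ∈ chainNodes S κ, m ≤ n ∧ (n = m ∨ (n = m + 1 ∧ Merged S κ m)) ∧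
          ∀ z ∈ spinPath N ε (κ m) (E m), z ∈ P n := by
        intro m hm
        by_cases hmm : Merged S κ m
        · have hn := hS.succ_mem_nodes hmm
          refine ⟨m + 1, hn, by omega, Or.inr ⟨rfl, hmm⟩, fun z hz => ?_⟩
          rw [hnode _ hn, nodePath, if_pos (by simpa using hmm)]
          simp only [Nat.add_sub_cancel, List.mem_append, List.mem_reverse]
          exact Or.inr hz
        · have hn : m ∈ chainNodes S κ := Finset.mem_filter.2 ⟨hm, hmm⟩
          refine ⟨m, hn, le_rfl, Or.inl rfl, fun z hz => ?_⟩
          rw [hnode _ hn, nodePath]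
          split_ifs
          · exact List.mem_append_left _ hz
          · exact hz
      intro m hm m' hm' hlt
      obtain ⟨n, hn, -, hn1, hn2⟩ := hsub m hm
      obtain ⟨n', hn', hle', hn1', hn2'⟩ := hsub m' hm'
      rcases Nat.lt_or_ge n n' with hnn | hnn
      · intro x y z hy hz
        exact h2 n hn n' hn' hnn x y z (hn2 _ hy) (hn2' _ hz)
      · have hmm : Merged S κ m ∧ n = m + 1 := by
          rcases hn1 with h | h
          · omega
          · exact ⟨h.2, h.1⟩
        obtain ⟨hmm, rfl⟩ := hmm
        obtain rfl : m' = m + 1 := by omega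
        rw [strictlyAbove_spinPath_opposite (hS.odd m) (hcl m hmm)]
        have := ((hP (m + 1) hn).1 (by simpa using hmm)).1
        rw [Nat.add_sub_cancel] at this
        rw [hEF _ hn]
        simp only [hE]
        rwa [if_pos hmm]
  · rintro ⟨E, ⟨hE, hA⟩, hP⟩
    refine ⟨fun n hn => ?_, fun n hn n' hn' hnn => ?_⟩
    · rw [hP n hn, nodePath]
      by_cases hm : Merged S κ (n - 1)
      · obtain ⟨-, e1, e2, e3⟩ := hS.nodeKey_merged hn hm
        rw [mem_paths_iff hN hε e1.ne, e2, e3, if_pos hm]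
        refine ⟨E n, hE n, E (n - 1), hE _, ?_, rfl⟩
        have hpos := IsSpinChain.pos_of_merged hn hm
        have h := hA (n - 1) hm.1 n (Finset.mem_filter.1 hn).1 (by omega)
        rwa [strictlyAbove_spinPath_opposite (hS.odd _) (hS.opposite (by omega))] at h
      · rw [if_neg hm, nodeKey, if_neg hm, paths, if_pos rfl, mem_spinPaths_iff hN hε]
        exact ⟨E n, hE n, rfl⟩
    · -- the spin paths of the earlier node precede those of the later node in the chain
      have hmem : ∀ n ∈ chainNodes S κ, ∀ z ∈ nodePath N ε S κ E n,
          ∃ m ∈ S, (m = n ∨ (m = n - 1 ∧ Merged S κ (n - 1))) ∧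
            z ∈ spinPath N ε (κ m) (E m) := by
        intro n hn z hz
        unfold nodePath at hz
        split_ifs at hz with hm
        · rw [List.mem_append, List.mem_reverse] at hz
          rcases hz with hz | hz
          · exact ⟨n, (Finset.mem_filter.1 hn).1, Or.inl rfl, hz⟩
          · exact ⟨n - 1, hm.1, Or.inr ⟨rfl, hm⟩, hz⟩
        · exact ⟨n, (Finset.mem_filter.1 hn).1, Or.inl rfl, hz⟩
      rw [hP n hn, hP n' hn']
      intro x y z hy hz
      obtain ⟨m, hm, h1, h2⟩ := hmem n hn _ hy
      obtain ⟨m', hm', h1', h2'⟩ := hmem n' hn' _ hz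
      refine hA m hm m' hm' ?_ x y z h2 h2'
      rcases h1' with rfl | ⟨rfl, hmg⟩
      · omega
      · have := lt_pred_of_merged hn hnn hmg
        omega

lemma pathMonomial_nodePath {N : ℕ} {ε : ℝ} (hε0 : 0 < ε) (hε : ε < 1 / 2)
    {S : Finset ℕ} {κ : ℕ → ℤ} (hS : IsSpinChain N S κ) {E : ℕ → Finset ℕ}
    (hE : IsSpinFamily N ε S κ E) {n : ℕ} (hn : n ∈ chainNodes S κ) :
    pathMonomial N ε (nodePath N ε S κ E n) =
      if Merged S κ (n - 1) then
        spinMonomial N (κ n) (E n) * spinMonomial N (κ (n - 1)) (E (n - 1))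
      else spinMonomial N (κ n) (E n) := by
  unfold nodePath
  split_ifs with hm
  · have hpos := IsSpinChain.pos_of_merged hn hm
    have h := hE.2 (n - 1) hm.1 n (Finset.mem_filter.1 hn).1 (by omega)
    rw [strictlyAbove_spinPath_opposite (hS.odd _) (hS.opposite (by omega))] at h
    exact pathMonomial_append hε0 hε (hS.odd _) (hS.opposite (by omega)) (hE.1 _) (hE.1 _) h
  · exact pathMonomial_spinPath hε0 hε (hS.odd _) (hE.1 _)

/-! ### The dominant family and the snake of a chain -/

/-- The sets of descents of the family of spin paths with the highest weight. -/
def dominantDescents (N : ℕ) (S : Finset ℕ) (κ : ℕ → ℤ) (m : ℕ) : Finset ℕ :=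
  Finset.Icc 1 (if Merged S κ (m - 1) ∧ ¬ Merged S κ m then (nodeKey N S κ m).1 else N)

lemma spinMonomial_Icc_top {N : ℕ} (hN : 1 ≤ N) (k : ℤ) :
    spinMonomial N k (Finset.Icc 1 N) = varY N N k := by
  have : sideMonomial N k (Finset.Icc 1 N) = 1 := by
    rw [sideMonomial_eq]
    refine Finset.prod_eq_one fun r hr => ?_
    rw [Finset.mem_Ico] at hr
    rw [if_pos (by rw [Finset.mem_Icc]; omega), if_pos (by rw [Finset.mem_Icc]; omega),
      mul_inv_cancel]
  rw [spinMonomial, this, one_mul, endMonomial, if_pos (by rw [Finset.mem_Icc]; omega), spinEnd,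
    if_pos (by rw [Finset.mem_Icc]; omega), Nat.card_Icc]
  congr 1
  push_cast
  omega

lemma spinMonomial_Icc {N i : ℕ} (hi : 1 ≤ i) (hiN : i < N) (k : ℤ) :
    spinMonomial N k (Finset.Icc 1 i) =
      varY N i (k + (2 * N - 2 * i - 1)) * (varY N N (k + 2 * (2 * N - 2 * i - 1)))⁻¹ := by
  have hN' : N ∉ Finset.Icc 1 i := by rw [Finset.mem_Icc]; omega
  have : sideMonomial N k (Finset.Icc 1 i) = varY N i (k + (2 * N - 2 * i - 1)) := by
    rw [sideMonomial_eq, Finset.prod_eq_single i]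
    · rw [if_pos (by rw [Finset.mem_Icc]; omega), if_neg (by rw [Finset.mem_Icc]; omega), mul_one,
        spinVar, spinHt, cnt_Icc]
      congr 1
      simp only [min_self]; ring
    · intro r hr hne
      rw [Finset.mem_Ico] at hr
      by_cases h : r < i
      · rw [if_pos (by rw [Finset.mem_Icc]; omega), if_pos (by rw [Finset.mem_Icc]; omega),
          mul_inv_cancel]
      · rw [if_neg (by rw [Finset.mem_Icc]; omega), if_neg (by rw [Finset.mem_Icc]; omega),
          mul_one]
    · intro h; rw [Finset.mem_Ico] at h; omega
  rw [spinMonomial, this, endMonomial, if_neg hN', spinEnd, if_neg hN', Nat.card_Icc]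
  congr 3
  omega

/-- The product of the monomials of the dominant family is the product of the variables belonging
to the nodes. -/
lemma IsSpinChain.prod_dominant {N : ℕ} (hN : 1 ≤ N) {S : Finset ℕ} {κ : ℕ → ℤ}
    (hS : IsSpinChain N S κ) :
    ∏ m ∈ S, spinMonomial N (κ m) (dominantDescents N S κ m) =
      ∏ n ∈ chainNodes S κ, varY N (nodeKey N S κ n).1 (nodeKey N S κ n).2 := by
  rw [← hS.prod_nodes]
  refine Finset.prod_congr rfl fun n hn => ?_
  have hnm := (Finset.mem_filter.1 hn).2
  split_ifs with hm
  · obtain ⟨e0, e1, e2, e3⟩ := hS.nodeKey_merged hn hm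
    rw [dominantDescents, if_pos ⟨hm, hnm⟩, dominantDescents, if_neg (fun h => h.2 hm),
      spinMonomial_Icc_top hN, spinMonomial_Icc e0 e1, mul_assoc]
    have a : κ n + (2 * N - 2 * (nodeKey N S κ n).1 - 1) = (nodeKey N S κ n).2 := by omega
    have b : κ n + 2 * (2 * N - 2 * (nodeKey N S κ n).1 - 1) = κ (n - 1) := by omega
    rw [a, b, inv_mul_cancel, mul_one]
  · rw [dominantDescents, if_neg (fun h => hm h.1), spinMonomial_Icc_top hN, nodeKey, if_neg hm]

/-- The index sequence of a product of variables with strictly increasing second index. -/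
lemma indexSequence_prod {N : ℕ} {A : Finset ℕ} {key : ℕ → ℕ × ℤ}
    (h1 : ∀ n ∈ A, 1 ≤ (key n).1 ∧ (key n).1 ≤ N)
    (h2 : ∀ n ∈ A, ∀ n' ∈ A, n < n' → (key n).2 < (key n').2) :
    indexSequence (∏ n ∈ A, varY N (key n).1 (key n).2) = (A.sort (· ≤ ·)).map key := by
  have e1 : ∏ n ∈ A, varY N (key n).1 (key n).2 =
      Multiplicative.ofAdd (∑ n ∈ A, Finsupp.single (key n) (1 : ℤ)) := by
    rw [ofAdd_sum]
    refine Finset.prod_congr rfl fun n hn => ?_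
    rw [varY, if_pos (h1 n hn)]
  have e2 : (∑ n ∈ A, Finsupp.single (key n) (1 : ℤ)).mapRange Int.toNat rfl =
      ∑ n ∈ A, Finsupp.single (key n) (1 : ℕ) := by
    ext c
    rw [Finsupp.mapRange_apply, Finsupp.finsetSum_apply, Finsupp.finsetSum_apply]
    have : ∑ n ∈ A, (Finsupp.single (key n) (1 : ℤ)) c =
        ((∑ n ∈ A, (Finsupp.single (key n) (1 : ℕ)) c : ℕ) : ℤ) := by
      push_cast
      refine Finset.sum_congr rfl fun n _ => ?_
      rw [Finsupp.single_apply, Finsupp.single_apply]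
      split_ifs <;> simp
    rw [this, Int.toNat_natCast]
  have e3 : Finsupp.toMultiset (∑ n ∈ A, Finsupp.single (key n) (1 : ℕ)) = A.val.map key := by
    rw [map_sum]
    simp only [Finsupp.toMultiset_single, one_smul]
    rw [← Multiset.sum_map_singleton (A.val.map key), Multiset.map_map]
    rfl
  have e4 : ((A.val.map fun n => toLex ((key n).2, (key n).1)).sort (· ≤ ·)) =
      (A.sort (· ≤ ·)).map fun n => toLex ((key n).2, (key n).1) := by
    symm
    refine Multiset.map_sort (fun n => toLex ((key n).2, (key n).1)) A.val _ _ ?_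
    have hmono : StrictMonoOn (fun n => toLex ((key n).2, (key n).1)) A := by
      intro a ha b hb hab
      exact Prod.Lex.toLex_lt_toLex.2 (Or.inl (h2 a ha b hb hab))
    exact fun a ha b hb => (hmono.le_iff_le ha hb).symm
  rw [indexSequence, e1, toAdd_ofAdd]
  simp only [e2, e3, Multiset.map_map, Function.comp_def, e4, List.map_map, ofLex_toLex,
    Prod.mk.eta]

/-! ### Positions in the snake -/

/-- The position, counted from `0`, of `n` in the increasing enumeration of `A`. -/
def posIn (A : Finset ℕ) (n : ℕ) : ℕ := (A.filter (· < n)).card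

lemma posIn_lt {A : Finset ℕ} {n n' : ℕ} (hn : n ∈ A) (h : n < n') : posIn A n < posIn A n' := by
  refine Finset.card_lt_card ⟨?_, ?_⟩
  · exact Finset.monotone_filter_right _ fun _ _ hx => lt_trans hx h
  · intro hs
    have := hs (Finset.mem_filter.2 ⟨hn, h⟩)
    exact lt_irrefl _ (Finset.mem_filter.1 this).2

lemma posIn_lt_card {A : Finset ℕ} {n : ℕ} (hn : n ∈ A) : posIn A n < A.card :=
  Finset.card_lt_card (Finset.filter_ssubset.2 ⟨n, hn, lt_irrefl _⟩)

lemma posIn_lt_iff {A : Finset ℕ} {n n' : ℕ} (hn : n ∈ A) (hn' : n' ∈ A) :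
    posIn A n < posIn A n' ↔ n < n' := by
  refine ⟨fun h => ?_, posIn_lt hn⟩
  by_contra hc
  rcases lt_or_eq_of_le (not_lt.1 hc) with h' | h'
  · have := posIn_lt hn' h'; omega
  · rw [h'] at h; exact lt_irrefl _ h

lemma posIn_inj {A : Finset ℕ} {n n' : ℕ} (hn : n ∈ A) (hn' : n' ∈ A)
    (h : posIn A n = posIn A n') : n = n' := by
  rcases lt_trichotomy n n' with h' | h' | h'
  · have := posIn_lt hn h'; omega
  · exact h'
  · have := posIn_lt hn' h'; omega

lemma exists_posIn {A : Finset ℕ} {t : ℕ} (ht : t < A.card) : ∃ n ∈ A, posIn A n = t := by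
  have h1 : A.image (posIn A) = Finset.range A.card := by
    apply Finset.eq_of_subset_of_card_le
    · intro x hx
      obtain ⟨n, hn, rfl⟩ := Finset.mem_image.1 hx
      exact Finset.mem_range.2 (posIn_lt_card hn)
    · rw [Finset.card_range, Finset.card_image_of_injOn fun n hn n' hn' h => posIn_inj hn hn' h]
  have := Finset.mem_range.2 ht
  rw [← h1] at this
  obtain ⟨n, hn, e⟩ := Finset.mem_image.1 this
  exact ⟨n, hn, e⟩

lemma getElem_sort_posIn {A : Finset ℕ} {n : ℕ} (hn : n ∈ A)
    (h : posIn A n < (A.sort (· ≤ ·)).length) : (A.sort (· ≤ ·))[posIn A n] = n := by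
  have := Finset.getD_sort_le A 0 hn
  rw [← posIn] at this
  rwa [List.getD_eq_getElem _ _ h] at this

section

variable {A : Finset ℕ} {key : ℕ → ℕ × ℤ} {s : List (ℕ × ℤ)} (hs : s = (A.sort (· ≤ ·)).map key)
include hs

lemma length_eq_card : s.length = A.card := by rw [hs]; simp

lemma getElem_posIn {n : ℕ} (hn : n ∈ A) (h : posIn A n < s.length) :
    s[posIn A n] = key n := by
  subst hs
  rw [List.getElem_map, getElem_sort_posIn hn]

lemma nodeAt_posIn {n : ℕ} (hn : n ∈ A) : nodeAt s (posIn A n + 1) = (key n).1 := by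
  have h : posIn A n < s.length := by rw [length_eq_card hs]; exact posIn_lt_card hn
  rw [nodeAt, Nat.add_sub_cancel, List.getD_eq_getElem _ _ h, getElem_posIn hs hn]

omit hs in
lemma pathAt_succ {T : ℕ} (p : Fin T → Path2) {t : ℕ} (h : t < T) :
    pathAt p (t + 1) = p ⟨t, h⟩ := by
  rw [pathAt, dif_pos (by simpa using h)]
  rfl

/-- Reindexing of a tuple of paths by the nodes. -/
lemma mem_nonOverlapping_iff_nodes {N : ℕ} {ε : ℝ} {p : Fin s.length → Path2} :
    p ∈ nonOverlapping N ε s ↔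
      (∀ n ∈ A, pathAt p (posIn A n + 1) ∈ paths N ε (key n).1 (key n).2) ∧
      ∀ n ∈ A, ∀ n' ∈ A, n < n' →
        StrictlyAbove (pathAt p (posIn A n + 1)) (pathAt p (posIn A n' + 1)) := by
  have hl := length_eq_card hs
  have hlt : ∀ n ∈ A, posIn A n < s.length := fun n hn => by rw [hl]; exact posIn_lt_card hn
  constructor
  · rintro ⟨h1, h2⟩
    refine ⟨fun n hn => ?_, fun n hn n' hn' h => ?_⟩
    · rw [pathAt_succ p (hlt n hn)]
      have := h1 ⟨posIn A n, hlt n hn⟩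
      rw [List.get_eq_getElem] at this
      simp only [getElem_posIn hs hn] at this
      exact this
    · rw [pathAt_succ p (hlt n hn), pathAt_succ p (hlt n' hn')]
      exact h2 _ _ (posIn_lt hn h)
  · rintro ⟨h1, h2⟩
    refine ⟨fun t => ?_, fun t u htu => ?_⟩
    · obtain ⟨t, ht⟩ := t
      obtain ⟨n, hn, rfl⟩ := exists_posIn (A := A) (by rw [← hl]; exact ht)
      have := h1 n hn
      rw [pathAt_succ p ht] at this
      rw [List.get_eq_getElem]
      simp only [getElem_posIn hs hn]
      exact this
    · obtain ⟨t, ht⟩ := t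
      obtain ⟨u, hu⟩ := u
      obtain ⟨n, hn, rfl⟩ := exists_posIn (A := A) (by rw [← hl]; exact ht)
      obtain ⟨n', hn', rfl⟩ := exists_posIn (A := A) (by rw [← hl]; exact hu)
      have := h2 n hn n' hn' ((posIn_lt_iff hn hn').1 htu)
      rwa [pathAt_succ p ht, pathAt_succ p hu] at this

lemma prod_eq_prod_nodes {M : Type*} [CommMonoid M] (p : Fin s.length → Path2)
    (f : Path2 → M) : ∏ t, f (p t) = ∏ n ∈ A, f (pathAt p (posIn A n + 1)) := by
  have hl := length_eq_card hs
  have hlt : ∀ n ∈ A, posIn A n < s.length := fun n hn => by rw [hl]; exact posIn_lt_card hn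
  symm
  refine Finset.prod_bij (fun n hn => ⟨posIn A n, hlt n hn⟩) ?_ ?_ ?_ ?_
  · intro n hn; exact Finset.mem_univ _
  · intro a ha b hb h; exact posIn_inj ha hb (Fin.mk.inj h)
  · rintro ⟨t, ht⟩ -
    obtain ⟨n, hn, rfl⟩ := exists_posIn (A := A) (by rw [← hl]; exact ht)
    exact ⟨n, hn, rfl⟩
  · intro n hn; rw [pathAt_succ p (hlt n hn)]

/-- A tuple of paths is determined by the paths at the nodes. -/
lemma tuple_ext {p q : Fin s.length → Path2}
    (h : ∀ n ∈ A, pathAt p (posIn A n + 1) = pathAt q (posIn A n + 1)) : p = q := by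
  have hl := length_eq_card hs
  funext ⟨t, ht⟩
  obtain ⟨n, hn, rfl⟩ := exists_posIn (A := A) (by rw [← hl]; exact ht)
  have := h n hn
  rwa [pathAt_succ p ht, pathAt_succ q ht] at this

lemma exists_tuple (P : ℕ → Path2) :
    ∃ p : Fin s.length → Path2, ∀ n ∈ A, pathAt p (posIn A n + 1) = P n := by
  have hl := length_eq_card hs
  refine ⟨fun t => P ((A.sort (· ≤ ·)).getD t 0), fun n hn => ?_⟩
  have h : posIn A n < s.length := by rw [hl]; exact posIn_lt_card hn
  rw [pathAt_succ _ h]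
  simp only
  rw [posIn, Finset.getD_sort_le A 0 hn]

end

/-! ### The chain of spin nodes of a skew diagram -/

/-- The index set of the chain of a skew diagram: each non-empty column `j` contributes `2 j` and
`2 j + 1`. -/
def spinIndices (D : Finset (ℤ × ℕ)) : Finset ℕ :=
  (nonemptyColumns D).image (2 * ·) ∪ (nonemptyColumns D).image (2 * · + 1)

/-- The spin nodes of a skew diagram: `2 j` belongs to the bottom and `2 j + 1` to the top of
column `j`. -/
def spinNode (N : ℕ) (D : Finset (ℤ × ℕ)) (m : ℕ) : ℤ :=
  if m % 2 = 0 then 4 * ((m / 2 : ℕ) - bottomRow D (m / 2)) + 2 * N - 3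
  else 4 * ((m / 2 : ℕ) - topRow D (m / 2)) - 2 * N + 3

lemma mem_spinIndices {D : Finset (ℤ × ℕ)} {m : ℕ} :
    m ∈ spinIndices D ↔ m / 2 ∈ nonemptyColumns D := by
  simp only [spinIndices, Finset.mem_union, Finset.mem_image]
  constructor
  · rintro (⟨j, hj, rfl⟩ | ⟨j, hj, rfl⟩)
    · rwa [show 2 * j / 2 = j by omega]
    · rwa [show (2 * j + 1) / 2 = j by omega]
  · intro h
    rcases Nat.mod_two_eq_zero_or_one m with h' | h'
    · exact Or.inl ⟨m / 2, h, by omega⟩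
    · exact Or.inr ⟨m / 2, h, by omega⟩

lemma spinNode_even (N : ℕ) (D : Finset (ℤ × ℕ)) (j : ℕ) :
    spinNode N D (2 * j) = 4 * (j - bottomRow D j) + 2 * N - 3 := by
  rw [spinNode, if_pos (by omega), show 2 * j / 2 = j by omega]

lemma spinNode_odd (N : ℕ) (D : Finset (ℤ × ℕ)) (j : ℕ) :
    spinNode N D (2 * j + 1) = 4 * (j - topRow D j) - 2 * N + 3 := by
  rw [spinNode, if_neg (by omega), show (2 * j + 1) / 2 = j by omega]

lemma even_mem_spinIndices {D : Finset (ℤ × ℕ)} {j : ℕ} :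
    2 * j ∈ spinIndices D ↔ j ∈ nonemptyColumns D := by
  rw [mem_spinIndices, show 2 * j / 2 = j by omega]

lemma odd_mem_spinIndices {D : Finset (ℤ × ℕ)} {j : ℕ} :
    2 * j + 1 ∈ spinIndices D ↔ j ∈ nonemptyColumns D := by
  rw [mem_spinIndices, show (2 * j + 1) / 2 = j by omega]

lemma prod_spinIndices {M : Type*} [CommMonoid M] (D : Finset (ℤ × ℕ)) (f : ℕ → M) :
    ∏ m ∈ spinIndices D, f m = ∏ j ∈ nonemptyColumns D, (f (2 * j + 1) * f (2 * j)) := by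
  rw [spinIndices, Finset.prod_union, Finset.prod_image, Finset.prod_image, mul_comm,
    ← Finset.prod_mul_distrib]
  · intro a _ b _ h; simp only at h; omega
  · intro a _ b _ h; simp only at h; omega
  · rw [Finset.disjoint_left]
    intro m h h'
    obtain ⟨j, _, rfl⟩ := Finset.mem_image.1 h
    obtain ⟨j', _, e⟩ := Finset.mem_image.1 h'
    omega

lemma IsGenericSuperSkewDiagram.isSpinChain {N : ℕ} (hN : 1 ≤ N) {D : Finset (ℤ × ℕ)}
    (hD : IsGenericSuperSkewDiagram N D) : IsSpinChain N (spinIndices D) (spinNode N D) := by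
  refine ⟨?_, ?_, ?_, ?_⟩
  · intro m hm m' hm' hlt hp
    rw [mem_spinIndices] at hm hm'
    have h1 := hD.1.topRow_anti hm hm' (by omega)
    have h2 := hD.1.bottomRow_anti hm hm' (by omega)
    unfold spinNode
    split_ifs <;> omega
  · intro m
    unfold spinNode
    split_ifs <;> omega
  · intro m hm m' hm' hlt hp hg
    rw [mem_spinIndices] at hm hm'
    rw [mem_spinIndices, mem_spinIndices] at hg
    obtain ⟨g, hg, h1, h2, hodd⟩ : ∃ g ∉ nonemptyColumns D, m / 2 ≤ g ∧ g ≤ m' / 2 ∧ m % 2 = 1 := by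
      rcases hg with hg | hg
      · have : (m + 1) / 2 ≠ m / 2 := fun e => hg (e ▸ hm)
        exact ⟨_, hg, by omega, by omega, by omega⟩
      · have : (m' - 1) / 2 ≠ m' / 2 := fun e => hg (e ▸ hm')
        exact ⟨_, hg, by omega, by omega, by omega⟩
    have h5 := hD.1.bottomRow_lt_topRow hm hm' hg h1 h2
    have h8 : m / 2 ≠ g := fun e => hg (e ▸ hm)
    rw [spinNode, spinNode, if_neg (by omega), if_pos (by omega)]
    omega
  · intro m hm hm'
    rw [mem_spinIndices] at hm hm'
    rcases Nat.mod_two_eq_zero_or_one m with h | h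
    · obtain ⟨j, rfl⟩ : ∃ j, m = 2 * j := ⟨m / 2, by omega⟩
      rw [show 2 * j / 2 = j by omega] at hm
      have := topRow_le_bottomRow hm
      rw [spinNode_even, spinNode_odd]
      omega
    · obtain ⟨j, rfl⟩ : ∃ j, m = 2 * j + 1 := ⟨m / 2, by omega⟩
      rw [show (2 * j + 1) / 2 = j by omega] at hm
      rw [show (2 * j + 1 + 1) / 2 = j + 1 by omega] at hm'
      have h1 : bottomRow D (j + 1) - topRow D j + 1 < 2 * N := by
        by_cases hc : topRow D j ≤ bottomRow D (j + 1)
        · exact hD.overlap_lt hm hm' hc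
        · omega
      rw [spinNode_odd, show 2 * j + 1 + 1 = 2 * (j + 1) by ring, spinNode_even]
      push_cast
      omega

section

variable {N : ℕ} {D : Finset (ℤ × ℕ)}

lemma merged_even_iff (hD : IsSkewDiagram D) {j : ℕ} (hj : j ∈ nonemptyColumns D) :
    Merged (spinIndices D) (spinNode N D) (2 * j) ↔ colLength D j < N := by
  have := hD.colLength_eq hj
  rw [Merged, even_mem_spinIndices, odd_mem_spinIndices, spinNode_even, spinNode_odd]
  constructor
  · rintro ⟨_, _, h⟩; omega
  · intro h; exact ⟨hj, hj, by omega⟩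

lemma merged_odd_iff {j : ℕ} (hj : j ∈ nonemptyColumns D) :
    Merged (spinIndices D) (spinNode N D) (2 * j + 1) ↔
      j + 1 ∈ nonemptyColumns D ∧ N ≤ bottomRow D (j + 1) - topRow D j := by
  rw [Merged, odd_mem_spinIndices, show 2 * j + 1 + 1 = 2 * (j + 1) by ring, even_mem_spinIndices,
    spinNode_even, spinNode_odd]
  push_cast
  constructor
  · rintro ⟨_, h1, h⟩; exact ⟨h1, by omega⟩
  · rintro ⟨h1, h⟩; exact ⟨hj, h1, by omega⟩

lemma mem_specialColumns_iff (hD : IsSkewDiagram D) {j : ℕ} :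
    j ∈ specialColumns N D ↔ j ∈ nonemptyColumns D ∧ N ≤ colLength D j ∧
      ¬ Merged (spinIndices D) (spinNode N D) (2 * j + 1) := by
  rw [specialColumns, Finset.mem_filter]
  refine and_congr_right fun hj => and_congr_right fun _ => not_congr ?_
  rw [merged_odd_iff hj, sub_add_cancel]
  constructor
  · intro h
    have hj' := mem_nonemptyColumns.2 ⟨_, h⟩
    have := le_bottomRow h
    exact ⟨hj', by omega⟩
  · rintro ⟨hj', h⟩
    have := hD.topRow_anti hj hj' (Nat.le_succ j)
    exact (hD.mem_iff hj').2 ⟨by omega, by omega⟩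

/-- The node to which the spin path at the bottom of column `j` belongs. -/
def mainNode (N : ℕ) (D : Finset (ℤ × ℕ)) (j : ℕ) : ℕ :=
  if colLength D j < N then 2 * j + 1 else 2 * j

lemma mainNode_mem (hN : 1 ≤ N) (hD : IsGenericSuperSkewDiagram N D) {j : ℕ}
    (hj : j ∈ nonemptyColumns D) :
    mainNode N D j ∈ chainNodes (spinIndices D) (spinNode N D) := by
  have hm := merged_even_iff (N := N) hD.1 hj
  unfold mainNode
  split_ifs with h
  · exact (hD.isSpinChain hN).succ_mem_nodes (hm.2 h)
  · exact Finset.mem_filter.2 ⟨even_mem_spinIndices.2 hj, fun h' => h (hm.1 h')⟩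

lemma columnPosition_eq (hN : 1 ≤ N) (hD : IsGenericSuperSkewDiagram N D) {j : ℕ}
    (hj : j ∈ nonemptyColumns D) :
    columnPosition N D j =
      posIn (chainNodes (spinIndices D) (spinNode N D)) (mainNode N D j) + 1 := by
  set A := chainNodes (spinIndices D) (spinNode N D) with hA
  have hC := hD.isSpinChain hN
  have e : A.filter (· < mainNode N D j) =
      ((nonemptyColumns D).filter (· < j)).image (mainNode N D) ∪
        ((specialColumns N D).filter (· < j)).image (2 * · + 1) := by
    ext x
    simp only [Finset.mem_filter, Finset.mem_union, Finset.mem_image]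
    constructor
    · rintro ⟨hx, hlt⟩
      have hxS := (Finset.mem_filter.1 hx).1
      have hxm := (Finset.mem_filter.1 hx).2
      rcases Nat.mod_two_eq_zero_or_one x with h | h
      · obtain ⟨i, rfl⟩ : ∃ i, x = 2 * i := ⟨x / 2, by omega⟩
        have hi := even_mem_spinIndices.1 hxS
        rw [merged_even_iff hD.1 hi] at hxm
        refine Or.inl ⟨i, ⟨hi, ?_⟩, by rw [mainNode, if_neg hxm]⟩
        unfold mainNode at hlt
        split_ifs at hlt with h'
        · have : i ≠ j := fun e => hxm (e ▸ h')
          omega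
        · omega
      · obtain ⟨i, rfl⟩ : ∃ i, x = 2 * i + 1 := ⟨x / 2, by omega⟩
        have hi := odd_mem_spinIndices.1 hxS
        have hij : i < j := by unfold mainNode at hlt; split_ifs at hlt <;> omega
        by_cases hl : colLength D i < N
        · exact Or.inl ⟨i, ⟨hi, hij⟩, by rw [mainNode, if_pos hl]⟩
        · exact Or.inr ⟨i, ⟨(mem_specialColumns_iff hD.1).2 ⟨hi, by omega, hxm⟩, hij⟩, rfl⟩
    · rintro (⟨i, ⟨hi, hij⟩, rfl⟩ | ⟨i, ⟨hi, hij⟩, rfl⟩)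
      · refine ⟨mainNode_mem hN hD hi, ?_⟩
        unfold mainNode; split_ifs <;> omega
      · obtain ⟨h1, h2, h3⟩ := (mem_specialColumns_iff hD.1).1 hi
        refine ⟨Finset.mem_filter.2 ⟨odd_mem_spinIndices.2 h1, h3⟩, ?_⟩
        unfold mainNode; split_ifs <;> omega
  have hd : Disjoint (((nonemptyColumns D).filter (· < j)).image (mainNode N D))
      (((specialColumns N D).filter (· < j)).image (2 * · + 1)) := by
    rw [Finset.disjoint_left]
    intro x h h'
    obtain ⟨i, hi, rfl⟩ := Finset.mem_image.1 h
    obtain ⟨i', hi', e'⟩ := Finset.mem_image.1 h'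
    have h2 := ((mem_specialColumns_iff hD.1).1 (Finset.mem_filter.1 hi').1).2.1
    unfold mainNode at e'
    split_ifs at e' with hl
    · obtain rfl : i' = i := by omega
      omega
    · omega
  have h1 : ((nonemptyColumns D).filter (· ≤ j)).card =
      ((nonemptyColumns D).filter (· < j)).card + 1 := by
    have : (nonemptyColumns D).filter (· ≤ j) = insert j ((nonemptyColumns D).filter (· < j)) := by
      ext x; simp only [Finset.mem_filter, Finset.mem_insert]; grind
    rw [this, Finset.card_insert_of_notMem (by simp)]
  rw [columnPosition, posIn, e, Finset.card_union_of_disjoint hd, Finset.card_image_of_injOn,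
    Finset.card_image_of_injOn, h1]
  · omega
  · intro a _ b _ h; simp only at h; omega
  · intro a _ b _ h
    unfold mainNode at h
    split_ifs at h <;> omega

/-- The node to which the spin path at the top of column `j` belongs, if the column has at least
`N` boxes. -/
def topNode (N : ℕ) (D : Finset (ℤ × ℕ)) (j : ℕ) : ℕ :=
  if Merged (spinIndices D) (spinNode N D) (2 * j + 1) then 2 * j + 2 else 2 * j + 1

lemma topNode_mem (hN : 1 ≤ N) (hD : IsGenericSuperSkewDiagram N D) {j : ℕ}
    (hj : j ∈ nonemptyColumns D) :
    topNode N D j ∈ chainNodes (spinIndices D) (spinNode N D) := by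
  unfold topNode
  split_ifs with h
  · exact (hD.isSpinChain hN).succ_mem_nodes h
  · exact Finset.mem_filter.2 ⟨odd_mem_spinIndices.2 hj, h⟩

lemma columnPosition_succ_eq (hN : 1 ≤ N) (hD : IsGenericSuperSkewDiagram N D) {j : ℕ}
    (hj : j ∈ nonemptyColumns D) (hl : N ≤ colLength D j) :
    columnPosition N D j + 1 =
      posIn (chainNodes (spinIndices D) (spinNode N D)) (topNode N D j) + 1 := by
  set A := chainNodes (spinIndices D) (spinNode N D) with hA
  have hm : mainNode N D j = 2 * j := by rw [mainNode, if_neg (by omega)]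
  have hmem := mainNode_mem hN hD hj
  rw [hm, ← hA] at hmem
  rw [columnPosition_eq hN hD hj, hm]
  have e : A.filter (· < topNode N D j) = insert (2 * j) (A.filter (· < 2 * j)) := by
    ext x
    simp only [Finset.mem_filter, Finset.mem_insert]
    constructor
    · rintro ⟨hx, hlt⟩
      have : x ≠ 2 * j + 1 := by
        rintro rfl
        have := (Finset.mem_filter.1 hx).2
        unfold topNode at hlt
        rw [if_neg this] at hlt
        omega
      have : x < 2 * j + 2 := by unfold topNode at hlt; split_ifs at hlt <;> omega
      by_cases hx2 : x = 2 * j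
      · exact Or.inl hx2
      · exact Or.inr ⟨hx, by omega⟩
    · rintro (rfl | ⟨hx, hlt⟩)
      · refine ⟨hmem, ?_⟩; unfold topNode; split_ifs <;> omega
      · refine ⟨hx, ?_⟩; unfold topNode; split_ifs <;> omega
  rw [posIn, posIn, e, Finset.card_insert_of_notMem (by simp)]

end

/-! ### The letters read off from a family of spin paths -/

section

variable {N : ℕ} {ε : ℝ} {S : Finset ℕ} {κ : ℕ → ℤ} {E : ℕ → Finset ℕ} {n : ℕ}

lemma halfA_append (k k' : ℤ) (F F' : Finset ℕ) :
    halfA N (spinPath N ε k F ++ (spinPath N ε k' F').reverse) = spinPath N ε k F := by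
  rw [halfA, List.take_left' (by simp)]

lemma halfB_append (k k' : ℤ) (F F' : Finset ℕ) :
    halfB N (spinPath N ε k F ++ (spinPath N ε k' F').reverse) = spinPath N ε k' F' := by
  rw [halfB, List.drop_left' (by simp), List.reverse_reverse]

lemma setR_nodePath (hS : IsSpinChain N S κ) (hε : 0 < ε) (hE : ∀ m, E m ⊆ Finset.Icc 1 N)
    (hn : n ∈ chainNodes S κ) :
    setR N (nodeKey N S κ n).1 (nodePath N ε S κ E n) =
      (if Merged S κ (n - 1) then E (n - 1) else E n).image (letter N) := by
  unfold setR
  by_cases hm : Merged S κ (n - 1)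
  · rw [if_neg (hS.nodeKey_merged hn hm).2.1.ne, nodePath, if_pos hm, if_pos hm, halfB_append,
      downSteps_spinPath hε _ (hE _)]
  · rw [nodeKey, nodePath, if_neg hm, if_neg hm, if_pos rfl, if_neg hm,
      downSteps_spinPath hε _ (hE _)]

lemma setRbar_nodePath (hS : IsSpinChain N S κ) (hε : 0 < ε) (hE : ∀ m, E m ⊆ Finset.Icc 1 N)
    (hn : n ∈ chainNodes S κ) :
    setRbar N (nodeKey N S κ n).1 (nodePath N ε S κ E n) =
      (Finset.Icc 1 N \ E n).image (letterBar N) := by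
  unfold setRbar
  by_cases hm : Merged S κ (n - 1)
  · rw [if_neg (hS.nodeKey_merged hn hm).2.1.ne, nodePath, if_pos hm, halfA_append,
      upSteps_spinPath hε _ (hE _)]
  · rw [nodeKey, nodePath, if_neg hm, if_neg hm, if_pos rfl, upSteps_spinPath hε _ (hE _)]

lemma setS_nodePath (hε : 0 < ε) (hE : ∀ m, E m ⊆ Finset.Icc 1 N) (hm : Merged S κ (n - 1)) :
    setS N (nodePath N ε S κ E n) = (E n).image (letter N) := by
  rw [setS, nodePath, if_pos hm, halfA_append, downSteps_spinPath hε _ (hE _)]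

lemma setSbar_nodePath (hε : 0 < ε) (hE : ∀ m, E m ⊆ Finset.Icc 1 N) (hm : Merged S κ (n - 1)) :
    setSbar N (nodePath N ε S κ E n) = (Finset.Icc 1 N \ E (n - 1)).image (letterBar N) := by
  rw [setSbar, nodePath, if_pos hm, halfB_append, upSteps_spinPath hε _ (hE _)]

end

section

variable {N : ℕ} {ε : ℝ} {D : Finset (ℤ × ℕ)} {E : ℕ → Finset ℕ}
  {p : Fin (snake N D).length → Path2}

lemma topLetters_eq (hN : 1 ≤ N) (hε : 0 < ε) (hD : IsGenericSuperSkewDiagram N D)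
    (hs : snake N D = ((chainNodes (spinIndices D) (spinNode N D)).sort (· ≤ ·)).map
      (nodeKey N (spinIndices D) (spinNode N D)))
    (hE : ∀ m, E m ⊆ Finset.Icc 1 N)
    (hp : ∀ n ∈ chainNodes (spinIndices D) (spinNode N D),
      pathAt p (posIn (chainNodes (spinIndices D) (spinNode N D)) n + 1) =
        nodePath N ε (spinIndices D) (spinNode N D) E n)
    {j : ℕ} (hj : j ∈ nonemptyColumns D) :
    topLetters N D p j = (E (2 * j + 1)).image (letter N) := by
  have hm := merged_even_iff (N := N) hD.1 hj
  unfold topLetters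
  by_cases hl : colLength D j < N
  · have hmain : mainNode N D j = 2 * j + 1 := by rw [mainNode, if_pos hl]
    rw [if_pos hl, columnPosition_eq hN hD hj, hp _ (mainNode_mem hN hD hj), hmain,
      setS_nodePath hε hE (by rw [Nat.add_sub_cancel]; exact hm.2 hl)]
  · have ht := topNode_mem hN hD hj
    rw [if_neg hl, columnPosition_succ_eq hN hD hj (by omega), hp _ ht, nodeAt_posIn hs ht,
      setR_nodePath (hD.isSpinChain hN) hε hE ht]
    unfold topNode
    by_cases h : Merged (spinIndices D) (spinNode N D) (2 * j + 1)
    · rw [if_pos h, show 2 * j + 2 - 1 = 2 * j + 1 by omega, if_pos h]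
    · rw [if_neg h, Nat.add_sub_cancel, if_neg (fun h' => hl (hm.1 h'))]

lemma bottomLetters_eq (hN : 1 ≤ N) (hε : 0 < ε) (hD : IsGenericSuperSkewDiagram N D)
    (hs : snake N D = ((chainNodes (spinIndices D) (spinNode N D)).sort (· ≤ ·)).map
      (nodeKey N (spinIndices D) (spinNode N D)))
    (hE : ∀ m, E m ⊆ Finset.Icc 1 N)
    (hp : ∀ n ∈ chainNodes (spinIndices D) (spinNode N D),
      pathAt p (posIn (chainNodes (spinIndices D) (spinNode N D)) n + 1) =
        nodePath N ε (spinIndices D) (spinNode N D) E n)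
    {j : ℕ} (hj : j ∈ nonemptyColumns D) :
    bottomLetters N D p j = (Finset.Icc 1 N \ E (2 * j)).image (letterBar N) := by
  have hm := merged_even_iff (N := N) hD.1 hj
  unfold bottomLetters
  have ht := mainNode_mem hN hD hj
  by_cases hl : colLength D j < N
  · have hmain : mainNode N D j = 2 * j + 1 := by rw [mainNode, if_pos hl]
    rw [if_pos hl, columnPosition_eq hN hD hj, hp _ ht, hmain,
      setSbar_nodePath hε hE (by rw [Nat.add_sub_cancel]; exact hm.2 hl), Nat.add_sub_cancel]
  · have hmain : mainNode N D j = 2 * j := by rw [mainNode, if_neg hl]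
    rw [if_neg hl, columnPosition_eq hN hD hj, hp _ ht, nodeAt_posIn hs ht,
      setRbar_nodePath (hD.isSpinChain hN) hε hE ht, hmain]

end

/-! ### The dominant tableau -/

section

variable {N : ℕ} {D : Finset (ℤ × ℕ)}

/-- A zero does not fit into a box of column `j + 1` if and only if column `j` has a box weakly above
it that lies below the letters `1, …, N` of column `j`. -/
lemma not_zeroFits_iff (hD : IsSkewDiagram D) {j : ℕ}
    (hprev : ∀ i, (i, j) ∈ D → ((dominantEntry N D j i).val < N ↔ i < topRow D j + N)) {i : ℤ}
    (hi : (i, j + 1) ∈ D) :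
    ¬ ZeroFits N D j (dominantEntry N D j) i ↔ j ∈ nonemptyColumns D ∧ topRow D j + N ≤ i := by
  have hz := letterZero_val N
  have hj' := mem_nonemptyColumns.2 ⟨i, hi⟩
  have hsmall : ∀ a : Letter N, (a ≤ letterZero N ∧ a ≠ letterZero N) ↔ a.val < N := by
    intro a
    rw [← lt_iff_le_and_ne, Fin.lt_def, hz]
  unfold ZeroFits
  simp only [hsmall]
  constructor
  · intro h
    push Not at h
    obtain ⟨i', h1, h2, h3⟩ := h
    rw [Finset.mem_Icc] at h1
    have := (hprev i' h2).not.1 (by omega)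
    exact ⟨mem_nonemptyColumns.2 ⟨i', h2⟩, by omega⟩
  · rintro ⟨hj, h⟩ hall
    have tt := hD.topRow_anti hj hj' (Nat.le_succ j)
    have bb := hD.bottomRow_anti hj hj' (Nat.le_succ j)
    have := le_bottomRow hi
    have hm : (topRow D j + N, j) ∈ D := (hD.mem_iff hj).2 ⟨by omega, by omega⟩
    have h1 := hall (topRow D j + N) (Finset.mem_Icc.2 ⟨by omega, h⟩) hm
    have := (hprev _ hm).1 h1
    omega

lemma card_not_zeroFits (hD : IsSkewDiagram D) {j : ℕ} (hj : j ∈ nonemptyColumns D)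
    (hprev : ∀ i, (i, j) ∈ D → ((dominantEntry N D j i).val < N ↔ i < topRow D j + N)) {i : ℤ}
    (hi : (i, j + 1) ∈ D)
    {_ : DecidablePred fun i' => ¬ ZeroFits N D j (dominantEntry N D j) i'} :
    ((Finset.Ico (topRow D (j + 1) + N) i).filter
      fun i' => ¬ ZeroFits N D j (dominantEntry N D j) i').card =
      (i - (topRow D j + N)).toNat := by
  have hj' := mem_nonemptyColumns.2 ⟨i, hi⟩
  have tt := hD.topRow_anti hj hj' (Nat.le_succ j)
  rw [← Int.card_Ico]
  congr 1
  ext x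
  rw [Finset.mem_filter, Finset.mem_Ico, Finset.mem_Ico]
  constructor
  · rintro ⟨⟨h1, h2⟩, h3⟩
    have hx : (x, j + 1) ∈ D :=
      (hD.mem_iff hj').2 ⟨by omega, by have := le_bottomRow hi; omega⟩
    exact ⟨((not_zeroFits_iff hD hprev hx).1 h3).2, h2⟩
  · rintro ⟨h1, h2⟩
    have hx : (x, j + 1) ∈ D :=
      (hD.mem_iff hj').2 ⟨by omega, by have := le_bottomRow hi; omega⟩
    exact ⟨⟨by omega, h2⟩, (not_zeroFits_iff hD hprev hx).2 ⟨hj, h1⟩⟩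

lemma dominantEntry_val_lt_iff (hD : IsGenericSuperSkewDiagram N D) (j : ℕ) :
    ∀ i, (i, j) ∈ D → ((dominantEntry N D j i).val < N ↔ i < topRow D j + N) := by
  induction j with
  | zero => intro i hi; exact absurd (hD.1.1 _ hi) (lt_irrefl _)
  | succ j ih =>
    intro i hi
    have hj' := mem_nonemptyColumns.2 ⟨i, hi⟩
    have h0 := topRow_le hi
    rw [dominantEntry]
    by_cases h1 : i < topRow D (j + 1) + N
    · rw [if_pos h1, letter_val (by omega) (by omega)]; omega
    · rw [if_neg h1]
      by_cases h2 : ZeroFits N D j (dominantEntry N D j) i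
      · rw [if_pos h2, letterZero_val]; omega
      · have hj := ((not_zeroFits_iff hD.1 ih hi).1 h2)
        have hov := hD.overlap_lt hj.1 hj' (by have := le_bottomRow hi; omega)
        have := le_bottomRow hi
        rw [if_neg h2, card_not_zeroFits hD.1 hj.1 ih hi, letterBar_val (by omega) (by omega)]
        omega

lemma dominantEntry_succ (hD : IsGenericSuperSkewDiagram N D) {j : ℕ} {i : ℤ}
    (hi : (i, j + 1) ∈ D) :
    (i < topRow D (j + 1) + N →
      dominantEntry N D (j + 1) i = letter N (i - topRow D (j + 1) + 1).toNat) ∧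
    (topRow D (j + 1) + N ≤ i → ¬ (j ∈ nonemptyColumns D ∧ topRow D j + N ≤ i) →
      dominantEntry N D (j + 1) i = letterZero N) ∧
    (topRow D (j + 1) + N ≤ i → j ∈ nonemptyColumns D → topRow D j + N ≤ i →
      dominantEntry N D (j + 1) i = letterBar N (N - (i - (topRow D j + N)).toNat)) := by
  have hp := dominantEntry_val_lt_iff hD j
  refine ⟨fun h => ?_, fun h h' => ?_, fun h hj h' => ?_⟩
  · rw [dominantEntry, if_pos h]
  · rw [← not_zeroFits_iff hD.1 hp hi, not_not] at h'
    rw [dominantEntry, if_neg (by omega), if_pos h']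
  · have h2 := (not_zeroFits_iff hD.1 hp hi).2 ⟨hj, h'⟩
    rw [dominantEntry, if_neg (by omega), if_neg h2, card_not_zeroFits hD.1 hj hp hi]

lemma dominantDescents_odd (hN : 1 ≤ N) (hD : IsGenericSuperSkewDiagram N D) {j : ℕ}
    (hj : j ∈ nonemptyColumns D) :
    dominantDescents N (spinIndices D) (spinNode N D) (2 * j + 1) =
      Finset.Icc 1 (min (colLength D j) N) := by
  have hS := hD.isSpinChain hN
  have hm := merged_even_iff (N := N) hD.1 hj
  have hl := hD.1.colLength_eq hj
  unfold dominantDescents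
  rw [Nat.add_sub_cancel]
  by_cases h : colLength D j < N
  · have h1 := hm.2 h
    have h2 := hS.nodeKey_merged (hS.succ_mem_nodes h1) (by rwa [Nat.add_sub_cancel])
    rw [if_pos ⟨h1, hS.not_merged_succ h1⟩]
    congr 1
    rw [Nat.add_sub_cancel, spinNode_even, spinNode_odd] at h2
    omega
  · rw [if_neg (fun h' => h (hm.1 h'.1))]
    congr 1
    omega

/-- The bars `N̄, …` in column `j + 1` of the dominant tableau start in row `t_j + N`, if this row
meets column `j + 1`. -/
lemma dominantDescents_even (hN : 1 ≤ N) (hD : IsGenericSuperSkewDiagram N D) {j : ℕ}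
    (hj : j + 1 ∈ nonemptyColumns D) :
    ∃ i : ℕ, dominantDescents N (spinIndices D) (spinNode N D) (2 * (j + 1)) = Finset.Icc 1 i ∧
      i ≤ N ∧
      ((j ∈ nonemptyColumns D ∧ (N : ℤ) ≤ bottomRow D (j + 1) - topRow D j ∧
          (i : ℤ) = 2 * N - 1 - bottomRow D (j + 1) + topRow D j) ∨
        (¬ (j ∈ nonemptyColumns D ∧ (N : ℤ) ≤ bottomRow D (j + 1) - topRow D j) ∧ i = N)) := by
  have hS := hD.isSpinChain hN
  have e : 2 * (j + 1) - 1 = 2 * j + 1 := by omega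
  unfold dominantDescents
  rw [e]
  refine ⟨_, rfl, ?_⟩
  by_cases hjc : j ∈ nonemptyColumns D
  · have hm := merged_odd_iff (N := N) hjc
    by_cases h : Merged (spinIndices D) (spinNode N D) (2 * j + 1)
    · have h1 := hS.not_merged_succ h
      have h2 := hS.nodeKey_merged (hS.succ_mem_nodes h) (by rwa [Nat.add_sub_cancel])
      rw [Nat.add_sub_cancel, show 2 * j + 1 + 1 = 2 * (j + 1) by ring, spinNode_even,
        spinNode_odd] at h2
      rw [show 2 * j + 1 + 1 = 2 * (j + 1) by ring] at h1
      rw [if_pos ⟨h, h1⟩]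
      push_cast at h2
      exact ⟨h2.2.1.le, Or.inl ⟨hjc, (hm.1 h).2, by omega⟩⟩
    · rw [if_neg (fun h' => h h'.1)]
      exact ⟨le_rfl, Or.inr ⟨fun h' => h (hm.2 ⟨hj, h'.2⟩), rfl⟩⟩
  · have h : ¬ Merged (spinIndices D) (spinNode N D) (2 * j + 1) := fun h =>
      hjc (odd_mem_spinIndices.1 h.1)
    rw [if_neg (fun h' => h h'.1)]
    exact ⟨le_rfl, Or.inr ⟨fun h' => hjc h'.1, rfl⟩⟩

lemma dominantTableau_isFilling (hN : 1 ≤ N) (hD : IsGenericSuperSkewDiagram N D) :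
    (∀ j ∈ nonemptyColumns D,
      ((dominantDescents N (spinIndices D) (spinNode N D) (2 * j + 1)).card : ℤ) +
        (Finset.Icc 1 N \ dominantDescents N (spinIndices D) (spinNode N D) (2 * j)).card ≤
        bottomRow D j - topRow D j + 1) ∧
    IsFilling N D (fun j => dominantDescents N (spinIndices D) (spinNode N D) (2 * j + 1))
      (fun j => Finset.Icc 1 N \ dominantDescents N (spinIndices D) (spinNode N D) (2 * j))
      (dominantTableau N D) := by
  rw [IsFilling, ← forall₂_and]
  intro j hj
  obtain ⟨j, rfl⟩ : ∃ j', j = j' + 1 := ⟨j - 1, by have := hD.1.pos hj; omega⟩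
  obtain ⟨q, e, hqN, hq⟩ := dominantDescents_even hN hD hj
  have hl := hD.1.colLength_eq hj
  have htb := topRow_le_bottomRow hj
  rw [dominantDescents_odd hN hD hj, e]
  have hsub : Finset.Icc 1 q ⊆ Finset.Icc 1 N := Finset.Icc_subset_Icc_right hqN
  have c1 : (Finset.Icc 1 (min (colLength D (j + 1)) N)).card = min (colLength D (j + 1)) N := by
    rw [Nat.card_Icc]; omega
  have c2 : (Finset.Icc 1 N \ Finset.Icc 1 q).card = N - q := by
    have := cnt_compl le_rfl hsub
    rw [cnt_top hsub, cnt_top Finset.sdiff_subset, Nat.card_Icc] at this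
    omega
  have tt : j ∈ nonemptyColumns D → topRow D (j + 1) ≤ topRow D j := fun h =>
    hD.1.topRow_anti h hj (Nat.le_succ j)
  have ov : j ∈ nonemptyColumns D → topRow D j ≤ bottomRow D (j + 1) →
    bottomRow D (j + 1) - topRow D j + 1 < 2 * N := fun h => hD.overlap_lt h hj
  have hcol : ∀ i, topRow D (j + 1) ≤ i → i ≤ bottomRow D (j + 1) →
      (i, j + 1) ∈ D ∧ colFun D (dominantTableau N D) (j + 1) i = dominantEntry N D (j + 1) i := by
    intro i h1 h2
    have hm := (hD.1.mem_iff hj).2 ⟨h1, h2⟩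
    exact ⟨hm, by rw [colFun_eq _ hm, dominantTableau]⟩
  refine ⟨?_, fun i h1 h2 => ?_, fun i h1 h2 => ?_, fun i h1 h2 => ?_⟩
  · rw [c1, c2]
    rcases hq with ⟨h1, h2, h3⟩ | ⟨-, h3⟩
    · have := tt h1; omega
    · omega
  · rw [c1] at h2
    obtain ⟨hm, ec⟩ := hcol i h1 (by omega)
    refine ⟨(i - topRow D (j + 1) + 1).toNat, Finset.mem_Icc.2 ⟨by omega, by omega⟩, ?_, ?_⟩
    · rw [cnt_Icc]; omega
    · rw [ec, (dominantEntry_succ hD hm).1 (by omega)]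
  · rw [c1] at h1
    rw [c2] at h2
    obtain ⟨hm, ec⟩ := hcol i (by omega) (by omega)
    rw [ec, (dominantEntry_succ hD hm).2.1 (by omega)]
    rintro ⟨h3, h4⟩
    rcases hq with ⟨h5, h6, h7⟩ | ⟨h5, h7⟩
    · omega
    · exact h5 ⟨h3, by omega⟩
  · rw [c2] at h1
    rcases hq with ⟨h5, h6, h7⟩ | ⟨h5, h7⟩
    · have := tt h5
      have := ov h5 (by omega)
      obtain ⟨hm, ec⟩ := hcol i (by omega) (by omega)
      refine ⟨N - (i - (topRow D j + N)).toNat, ?_, ?_, ?_⟩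
      · rw [Finset.mem_sdiff, Finset.mem_Icc, Finset.mem_Icc]; omega
      · have := cnt_compl (r := N - (i - (topRow D j + N)).toNat) (by omega) hsub
        rw [cnt_Icc] at this
        omega
      · rw [ec, (dominantEntry_succ hD hm).2.2 (by omega) h5 (by omega)]
    · omega

/-- The snake of a skew diagram is the list of the elements of `𝒳` belonging to the nodes of its
chain. -/
theorem snake_eq (hN : 1 ≤ N) (hD : IsGenericSuperSkewDiagram N D) :
    snake N D = ((chainNodes (spinIndices D) (spinNode N D)).sort (· ≤ ·)).map
      (nodeKey N (spinIndices D) (spinNode N D)) := by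
  have hS := hD.isSpinChain hN
  have hsub : ∀ m, dominantDescents N (spinIndices D) (spinNode N D) m ⊆ Finset.Icc 1 N := by
    intro m
    unfold dominantDescents
    refine Finset.Icc_subset_Icc_right ?_
    split_ifs with h
    · by_cases hm : m ∈ spinIndices D
      · exact (hS.nodeKey_merged (Finset.mem_filter.2 ⟨hm, h.2⟩) h.1).2.1.le
      · exfalso
        by_cases h0 : m = 0
        · subst h0; exact hm h.1.1
        · have := h.1.2.1
          rw [Nat.sub_add_cancel (by omega)] at this
          exact hm this
    · exact le_rfl
  obtain ⟨hc, hF⟩ := dominantTableau_isFilling hN hD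
  rw [snake, hF.tableauMonomial_eq hD.1 (fun j => hsub _) (fun j => Finset.sdiff_subset) hc]
  have e : ∏ j ∈ nonemptyColumns D,
      (spinMonomial N (4 * (j - topRow D j) - 2 * N + 3)
        (dominantDescents N (spinIndices D) (spinNode N D) (2 * j + 1)) *
      spinMonomial N (4 * (j - bottomRow D j) + 2 * N - 3) (Finset.Icc 1 N \
        (Finset.Icc 1 N \ dominantDescents N (spinIndices D) (spinNode N D) (2 * j)))) =
      ∏ m ∈ spinIndices D, spinMonomial N (spinNode N D m)
        (dominantDescents N (spinIndices D) (spinNode N D) m) := by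
    rw [prod_spinIndices]
    refine Finset.prod_congr rfl fun j _ => ?_
    rw [spinNode_even, spinNode_odd, Finset.sdiff_sdiff_eq_self (hsub _)]
  rw [e, hS.prod_dominant hN]
  refine indexSequence_prod (fun n hn => ?_) (fun n hn n' hn' h => hS.nodeKey_lt hn hn' h)
  by_cases hm : Merged (spinIndices D) (spinNode N D) (n - 1)
  · have := hS.nodeKey_merged hn hm
    exact ⟨this.1, this.2.1.le⟩
  · rw [nodeKey, if_neg hm]
    exact ⟨hN, le_rfl⟩

end

/-! ### Families of spin paths and tableaux -/

section

variable {N : ℕ} {ε : ℝ} {D : Finset (ℤ × ℕ)} {E : ℕ → Finset ℕ}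

lemma card_compl {A : Finset ℕ} (hA : A ⊆ Finset.Icc 1 N) :
    (Finset.Icc 1 N \ A).card + A.card = N := by
  rw [Finset.card_sdiff_add_card_eq_card hA, Nat.card_Icc]; omega

/-- Since the spin path at the bottom of a column is strictly above the one at its top, the letters
read off from the two paths fit into the column. -/
lemma IsSpinFamily.card_le (hN : 1 ≤ N) (hε0 : 0 < ε) (hε : ε < 1 / 2)
    (hD : IsGenericSuperSkewDiagram N D) (hE : IsSpinFamily N ε (spinIndices D) (spinNode N D) E)
    {j : ℕ} (hj : j ∈ nonemptyColumns D) :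
    ((E (2 * j + 1)).card : ℤ) + (Finset.Icc 1 N \ E (2 * j)).card ≤
      bottomRow D j - topRow D j + 1 := by
  have hS := hD.isSpinChain hN
  have h := hE.2 (2 * j) (even_mem_spinIndices.2 hj) (2 * j + 1) (odd_mem_spinIndices.2 hj)
    (by omega)
  have ho := hS.opposite (show (2 * j) % 2 ≠ (2 * j + 1) % 2 by omega)
  rw [strictlyAbove_spinPath_opposite (hS.odd _) ho, spinCtr_lt_iff hε0 hε ho, spinNode_even,
    spinNode_odd] at h
  have := card_compl (hE.1 (2 * j))
  omega

lemma IsSpinFamily.mem_tableaux (hN : 1 ≤ N) (hε0 : 0 < ε) (hε : ε < 1 / 2)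
    (hD : IsGenericSuperSkewDiagram N D) (hE : IsSpinFamily N ε (spinIndices D) (spinNode N D) E)
    {T : {x // x ∈ D} → Letter N}
    (hF : IsFilling N D (fun j => E (2 * j + 1)) (fun j => Finset.Icc 1 N \ E (2 * j)) T) :
    T ∈ tableaux N D := by
  have hS := hD.isSpinChain hN
  refine mem_tableaux_of_le hD.1 (fun j => hE.1 _) (fun j => Finset.sdiff_subset)
    (fun j hj => hE.card_le hN hε0 hε hD hj) hF ?_ ?_ ?_
  · intro j hj hj' r hr
    have h := hE.2 (2 * j + 1) (odd_mem_spinIndices.2 hj) (2 * (j + 1) + 1)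
      (odd_mem_spinIndices.2 hj') (by omega)
    rw [strictlyAbove_spinPath_same (hS.same (by omega)), spinNode_odd, spinNode_odd] at h
    have := h.1 r hr
    unfold spinHt at this
    push_cast at this
    omega
  · intro j hj hj' r hr
    have h := hE.2 (2 * j) (even_mem_spinIndices.2 hj) (2 * (j + 1))
      (even_mem_spinIndices.2 hj') (by omega)
    rw [strictlyAbove_spinPath_same (hS.same (by omega)), spinNode_even, spinNode_even] at h
    have := h.1 r hr
    have c1 := cnt_compl hr.le (hE.1 (2 * j))
    have c2 := cnt_compl hr.le (hE.1 (2 * (j + 1)))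
    unfold spinHt at this
    push_cast at this
    omega
  · intro j hj hj'
    have h := hE.2 (2 * j + 1) (odd_mem_spinIndices.2 hj) (2 * (j + 1))
      (even_mem_spinIndices.2 hj') (by omega)
    have ho := hS.opposite (show (2 * j + 1) % 2 ≠ (2 * (j + 1)) % 2 by omega)
    rw [strictlyAbove_spinPath_opposite (hS.odd _) ho, spinCtr_lt_iff hε0 hε ho, spinNode_even,
      spinNode_odd] at h
    have := card_compl (hE.1 (2 * (j + 1)))
    push_cast at h
    omega

/-- Every tableau comes from a family of non-overlapping spin paths. -/
lemma exists_isSpinFamily (hN : 1 ≤ N) (hε0 : 0 < ε) (hε : ε < 1 / 2)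
    (hD : IsGenericSuperSkewDiagram N D) {T : {x // x ∈ D} → Letter N} (hT : T ∈ tableaux N D) :
    ∃ E, IsSpinFamily N ε (spinIndices D) (spinNode N D) E ∧
      IsFilling N D (fun j => E (2 * j + 1)) (fun j => Finset.Icc 1 N \ E (2 * j)) T := by
  have hS := hD.isSpinChain hN
  obtain ⟨B, B', hB, hB', hc, hF⟩ := exists_isFilling hD.1 hT
  set E : ℕ → Finset ℕ := fun m => if m % 2 = 0 then Finset.Icc 1 N \ B' (m / 2) else B (m / 2)
    with hEdef
  have hodd : ∀ j, E (2 * j + 1) = B j := by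
    intro j
    simp only [hEdef]
    rw [if_neg (by omega), show (2 * j + 1) / 2 = j by omega]
  have heven : ∀ j, E (2 * j) = Finset.Icc 1 N \ B' j := by
    intro j
    simp only [hEdef]
    rw [if_pos (by omega), show 2 * j / 2 = j by omega]
  have hsub : ∀ m, E m ⊆ Finset.Icc 1 N := by
    intro m
    simp only [hEdef]
    split_ifs
    · exact Finset.sdiff_subset
    · exact hB _
  refine ⟨E, ⟨hsub, ?_⟩, ?_⟩
  · intro m hm m' hm' hlt
    obtain ⟨j, hj⟩ : ∃ j, m = 2 * j ∨ m = 2 * j + 1 := ⟨m / 2, by omega⟩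
    obtain ⟨j', hj'⟩ : ∃ j', m' = 2 * j' ∨ m' = 2 * j' + 1 := ⟨m' / 2, by omega⟩
    have cj := card_compl (hB' j)
    have cj' := card_compl (hB' j')
    rcases hj with rfl | rfl <;> rcases hj' with rfl | rfl
    · rw [even_mem_spinIndices] at hm hm'
      have h := cnt_bottom_of_mem_tableaux hD.1 hB hB' hc hF hT hm hm' (by omega)
      rw [strictlyAbove_spinPath_same (hS.same (by omega)), heven, heven, spinNode_even,
        spinNode_even]
      refine ⟨fun r hr => ?_, ?_⟩
      · have := h r
        have c1 := cnt_compl hr.le (hB' j)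
        have c2 := cnt_compl hr.le (hB' j')
        unfold spinHt
        omega
      · have := h N
        rw [cnt_top (hB' j), cnt_top (hB' j')] at this
        exact spinCtr_lt_of_lt hε0 hε (by omega) (by omega)
    · rw [even_mem_spinIndices] at hm
      rw [odd_mem_spinIndices] at hm'
      have ho := hS.opposite (show (2 * j) % 2 ≠ (2 * j' + 1) % 2 by omega)
      rw [strictlyAbove_spinPath_opposite (hS.odd _) ho, spinCtr_lt_iff hε0 hε ho, heven, hodd,
        spinNode_even, spinNode_odd]
      -- the unbarred letters of a later column end no lower than those of column `j`
      have h1 : ((B j').card : ℤ) ≤ (B j).card + (topRow D j - topRow D j') := by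
        rcases Nat.lt_or_ge j j' with h | h
        · have := cnt_top_of_mem_tableaux hD.1 hB hB' hc hF hT hm hm' h N
          rwa [cnt_top (hB j), cnt_top (hB j')] at this
        · obtain rfl : j' = j := by omega
          omega
      have := hc j hm
      omega
    · rw [odd_mem_spinIndices] at hm
      rw [even_mem_spinIndices] at hm'
      have ho := hS.opposite (show (2 * j + 1) % 2 ≠ (2 * j') % 2 by omega)
      rw [strictlyAbove_spinPath_opposite (hS.odd _) ho, spinCtr_lt_iff hε0 hε ho, heven, hodd,
        spinNode_even, spinNode_odd]
      have := card_add_card_of_mem_tableaux hD.1 hB hB' hc hF hT hm hm' (by omega)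
      omega
    · rw [odd_mem_spinIndices] at hm hm'
      have h := cnt_top_of_mem_tableaux hD.1 hB hB' hc hF hT hm hm' (by omega)
      rw [strictlyAbove_spinPath_same (hS.same (by omega)), hodd, hodd, spinNode_odd,
        spinNode_odd]
      refine ⟨fun r hr => ?_, ?_⟩
      · have := h r
        unfold spinHt
        omega
      · have := h N
        rw [cnt_top (hB j), cnt_top (hB j')] at this
        exact spinCtr_lt_of_lt hε0 hε (by omega) (by omega)
  · intro j hj
    have h := hF j hj
    simp only [hodd, heven]
    rwa [Finset.sdiff_sdiff_eq_self (hB' j)]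

end

theorem proposition6p9 (N : ℕ) (hN : 1 ≤ N) (ε : ℝ) (hε0 : 0 < ε) (hε : ε < 1 / 2)
    (D : Finset (ℤ × ℕ)) (hD : IsGenericSuperSkewDiagram N D) :
    (∀ p ∈ nonOverlapping N ε (snake N D), ∀ j ∈ nonemptyColumns D,
      (topLetters N D p j).card + (bottomLetters N D p j).card ≤ colLength D j) ∧
    Set.BijOn (fillDiagram N D) (nonOverlapping N ε (snake N D)) (tableaux N D) ∧
    ∀ p ∈ nonOverlapping N ε (snake N D),
      ∏ t, pathMonomial N ε (p t) = tableauMonomial N D (fillDiagram N D p) := by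
  have hS := hD.isSpinChain hN
  have hs := snake_eq hN hD
  set A := chainNodes (spinIndices D) (spinNode N D) with hA
  -- tuples of non-overlapping paths are families of non-overlapping spin paths
  have hfam : ∀ p : Fin (snake N D).length → Path2, p ∈ nonOverlapping N ε (snake N D) ↔
      ∃ E, IsSpinFamily N ε (spinIndices D) (spinNode N D) E ∧
        ∀ n ∈ A, pathAt p (posIn A n + 1) =
          nodePath N ε (spinIndices D) (spinNode N D) E n := fun p =>
    (mem_nonOverlapping_iff_nodes hs).trans
      (hS.nonOverlapping_iff hN hε0 fun n => pathAt p (posIn A n + 1))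
  have htop : ∀ p E, IsSpinFamily N ε (spinIndices D) (spinNode N D) E →
      (∀ n ∈ A, pathAt p (posIn A n + 1) =
        nodePath N ε (spinIndices D) (spinNode N D) E n) → ∀ j ∈ nonemptyColumns D,
      topLetters N D p j = (E (2 * j + 1)).image (letter N) ∧
      bottomLetters N D p j = (Finset.Icc 1 N \ E (2 * j)).image (letterBar N) :=
    fun p E hE hp j hj => ⟨topLetters_eq hN hε0 hD hs hE.1 hp hj,
      bottomLetters_eq hN hε0 hD hs hE.1 hp hj⟩
  have hfill : ∀ p E, IsSpinFamily N ε (spinIndices D) (spinNode N D) E →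
      (∀ n ∈ A, pathAt p (posIn A n + 1) =
        nodePath N ε (spinIndices D) (spinNode N D) E n) →
      IsFilling N D (fun j => E (2 * j + 1)) (fun j => Finset.Icc 1 N \ E (2 * j))
        (fillDiagram N D p) := by
    intro p E hE hp j hj
    obtain ⟨h1, h2⟩ := htop p E hE hp j hj
    have hc := hE.card_le hN hε0 hε hD hj
    have hl := hD.1.colLength_eq hj
    have hc' : (E (2 * j + 1)).card + (Finset.Icc 1 N \ E (2 * j)).card ≤ colLength D j := by
      omega
    exact isColumnFilling_fillDiagram hD.1 hj (hE.1 _) Finset.sdiff_subset h1 h2 hc'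
  refine ⟨fun p hp j hj => ?_, ⟨fun p hp => ?_, fun p hp q hq hpq => ?_, fun T hT => ?_⟩,
    fun p hp => ?_⟩
  · obtain ⟨E, hE, hpE⟩ := (hfam p).1 hp
    obtain ⟨h1, h2⟩ := htop p E hE hpE j hj
    rw [h1, h2, Finset.card_image_of_injOn (letter_injOn (hE.1 _)),
      Finset.card_image_of_injOn (letterBar_injOn Finset.sdiff_subset)]
    have hc := hE.card_le hN hε0 hε hD hj
    have hl := hD.1.colLength_eq hj
    omega
  · obtain ⟨E, hE, hpE⟩ := (hfam p).1 hp
    exact hE.mem_tableaux hN hε0 hε hD (hfill p E hE hpE)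
  · obtain ⟨E, hE, hpE⟩ := (hfam p).1 hp
    obtain ⟨F, hF, hqF⟩ := (hfam q).1 hq
    have f1 := hfill p E hE hpE
    have f2 := hfill q F hF hqF
    rw [← hpq] at f2
    have hEF : ∀ m ∈ spinIndices D, E m = F m := by
      have hcol : ∀ j ∈ nonemptyColumns D, E (2 * j + 1) = F (2 * j + 1) ∧
          E (2 * j) = F (2 * j) := by
        intro j hj
        have c1 := hE.card_le hN hε0 hε hD hj
        have c2 := hF.card_le hN hε0 hε hD hj
        have g1 := f1 j hj
        have g2 := f2 j hj
        refine ⟨?_, ?_⟩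
        · exact Finset.Subset.antisymm
            (g1.top_subset (hE.1 _) c1 g2 (hF.1 _) Finset.sdiff_subset)
            (g2.top_subset (hF.1 _) c2 g1 (hE.1 _) Finset.sdiff_subset)
        · have := Finset.Subset.antisymm
            (g1.bottom_subset Finset.sdiff_subset c1 g2 (hF.1 _) Finset.sdiff_subset)
            (g2.bottom_subset Finset.sdiff_subset c2 g1 (hE.1 _) Finset.sdiff_subset)
          beta_reduce at this
          rw [← Finset.sdiff_sdiff_eq_self (hE.1 (2 * j)), this,
            Finset.sdiff_sdiff_eq_self (hF.1 (2 * j))]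
      intro m hm
      have hj := mem_spinIndices.1 hm
      rcases Nat.mod_two_eq_zero_or_one m with h | h
      · have := (hcol _ hj).2
        rwa [show 2 * (m / 2) = m by omega] at this
      · have := (hcol _ hj).1
        rwa [show 2 * (m / 2) + 1 = m by omega] at this
    refine tuple_ext hs fun n hn => ?_
    rw [hpE n hn, hqF n hn, nodePath, nodePath, hEF n (Finset.mem_filter.1 hn).1]
    split_ifs with hm
    · rw [hEF _ hm.1]
    · rfl
  · obtain ⟨E, hE, hF⟩ := exists_isSpinFamily hN hε0 hε hD hT
    obtain ⟨p, hp⟩ := exists_tuple hs fun n => nodePath N ε (spinIndices D) (spinNode N D) E n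
    exact ⟨p, (hfam p).2 ⟨E, hE, hp⟩, (hfill p E hE hp).unique hF⟩
  · obtain ⟨E, hE, hpE⟩ := (hfam p).1 hp
    rw [(hfill p E hE hpE).tableauMonomial_eq hD.1 (fun j => hE.1 _)
      (fun j => Finset.sdiff_subset) (fun j hj => hE.card_le hN hε0 hε hD hj),
      prod_eq_prod_nodes hs p]
    have h1 : ∀ n ∈ A, pathMonomial N ε (pathAt p (posIn A n + 1)) =
        if Merged (spinIndices D) (spinNode N D) (n - 1) then
          spinMonomial N (spinNode N D n) (E n) *
            spinMonomial N (spinNode N D (n - 1)) (E (n - 1))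
        else spinMonomial N (spinNode N D n) (E n) := by
      intro n hn
      rw [hpE n hn, pathMonomial_nodePath hε0 hε hS hE hn]
    rw [Finset.prod_congr rfl h1,
      hS.prod_nodes (fun m => spinMonomial N (spinNode N D m) (E m)), prod_spinIndices]
    refine Finset.prod_congr rfl fun j _ => ?_
    rw [spinNode_even, spinNode_odd, Finset.sdiff_sdiff_eq_self (hE.1 _)]
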